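/- Let $m\ge 1$ and $1\le k\le [m/2]+1$ be integers and let $n=4m+2-2k$ (so $n$ is even and $2m<n\le 4m$). Let $V$ be a real-valued measurable function on $\mathbf R^n$ with $|V(x)|\lesssim(1+|x|)^{-\beta}$ for some $\beta>n+4k$, and let $H=(-\Delta)^m+V$. Notation. $L^2=L^2(\mathbf R^n)$ is the space of complex-valued square integrable functions; $L^2_s=\{f:(1+|\cdot|)^sf\in L^2\}$ and $W_\sigma=\bigcap_{s>\sigma}L^2_{-s}$. Put $v=|V|^{1/2}$, and $U(x)=1$ if $V(x)\ge 0$, $U(x)=-1$ if $V(x)<0$. Let $G_0$ be the integral operator with kernel $d_0|x-y|^{2m-n}$, $d_0=\frac{\Gamma(n/2-m)}{4^m\pi^{n/2}\Gamma(m)}$ (that is, $G_0=(-\Delta)^{-m}$), and for $j\ge 2$ let $G_j$ be the integral operator with kernel $|x-y|^{2j-2}$. Let $P=\|v\|_{L^2}^{-2}\,v\langle v,\cdot\rangle$ be the orthogonal projection of $L^2$ onto the span of $v$ ($P=0$ if $v=0$). Let $T_0=U+vG_0v$ and let $S_1$ be the orthogonal projection of $L^2$ onto $\ker T_0$. Inductively,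 for $1\le j\le k$, let $T_1=S_1PS_1$ and $T_j=S_jvG_jvS_j$ if $j\ge2$, and let $S_{j+1}$ be the orthogonal projection onto the kernel of $T_j$ as an operator on $S_jL^2$. (The $T_j$ are self-adjoint, so these are the Riesz projections onto the kernels.) Then the operators $T_0$, $P$ and $vG_jv$ ($2\le j\le k$) are bounded on $L^2$, given by a.e. absolutely convergent integrals, and for every $\phi\in L^2$: (i) $\phi\in S_1L^2\setminus\{0\}$ if and only if $\phi=Uv\psi$ for some $\psi\in W_{2m-\frac n2}$ with $\psi\neq0$ and $H\psi=0$ in the distributional sense. (ii) For $2\le j\le k-1$, $\phi\in S_jL^2\setminus\{0\}$ if and only if $\phi=Uv\psi$ for some $\psi\in W_{2m-\frac n2-j+1}$ with $\psi\ne0$ and $H\psi=0$ in the distributional sense. (iii) $\phi\in S_kL^2\setminus\{0\}$ if and only if $\phi=Uv\psi$ for some $\psi\in W_0$ with $\psi\ne0$ and $H\psi=0$ in the distributional sense. (iv) $\phi\in S_{k+1}L^2\setminus\{0\}$ if and only if $\phi=Uv\psi$ for some $\psi\in L^2$ with $\psi\neq0$ and $H\psi=0$ in the distributional sense. -/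

import Mathlib

open MeasureTheory Filter
open scoped ContDiff

namespace PolyharmonicSchrodinger

noncomputable section

/-- Euclidean space `ℝⁿ` with its Euclidean norm and Lebesgue measure. -/
abbrev Rn (n : ℕ) : Type := EuclideanSpace ℝ (Fin n)

/-- The Hilbert space `L²(ℝⁿ)` of complex valued functions. -/
abbrev L2 (n : ℕ) : Type := Lp ℂ 2 (volume : Measure (Rn n))

/-- Membership in the weighted space `L²_s(ℝⁿ) = {f : (1 + |x|)^s f ∈ L²}`. -/
def MemWeightedL2 {n : ℕ} (s : ℝ) (f : Rn n → ℂ) : Prop :=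
  MemLp (fun x => (1 + ‖x‖) ^ s • f x) 2 volume

/-- Membership in `W_σ(ℝⁿ) = ⋂_{s > σ} L²_{-s}(ℝⁿ)`. -/
def MemW {n : ℕ} (σ : ℝ) (f : Rn n → ℂ) : Prop :=
  ∀ s : ℝ, σ < s → MemWeightedL2 (-s) f

/-- `(-Δ)^m` on smooth functions. -/
def negLaplacianPow {n : ℕ} (m : ℕ) (f : Rn n → ℂ) : Rn n → ℂ :=
  (fun g : Rn n → ℂ => -Laplacian.laplacian g)^[m] f

/-- `((-Δ)^m + V) ψ = 0` in the sense of distributions: the function `ψ` is locally integrable and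
the pairing with every test function in `C_c^∞(ℝⁿ)` vanishes. -/
def IsDistribSolution {n : ℕ} (m : ℕ) (V : Rn n → ℝ) (ψ : Rn n → ℂ) : Prop :=
  LocallyIntegrable ψ volume ∧
    ∀ χ : Rn n → ℂ, ContDiff ℝ ∞ χ → HasCompactSupport χ →
      ∫ x, ψ x * (negLaplacianPow m χ x + (V x : ℂ) * χ x) = 0

/-- `v = |V|^{1/2}`. -/
def vPot {n : ℕ} (V : Rn n → ℝ) (x : Rn n) : ℝ := √|V x|

/-- `U = sign V`, with the value `1` on `{V = 0}`, so that multiplication by `U` is invertible. -/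
def uSign {n : ℕ} (V : Rn n → ℝ) (x : Rn n) : ℝ := if 0 ≤ V x then 1 else -1

/-- `T` is the bounded operator on `L²(ℝⁿ)` given by
`(T f)(x) = a(x) f(x) + ∫ K(x, y) f(y) dy`, the integral converging absolutely for a.e. `x`. -/
def RepresentedBy {n : ℕ} (a : Rn n → ℝ) (K : Rn n → Rn n → ℝ) (T : L2 n →L[ℂ] L2 n) : Prop :=
  ∀ f : L2 n, ∀ᵐ x : Rn n,
    Integrable (fun y => (K x y : ℂ) * f y) volume ∧
      T f x = (a x : ℂ) * f x + ∫ y, (K x y : ℂ) * f y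

/-- There is at most one such operator. -/
theorem RepresentedBy.unique {n : ℕ} {a : Rn n → ℝ} {K : Rn n → Rn n → ℝ}
    {T T' : L2 n →L[ℂ] L2 n} (h : RepresentedBy a K T) (h' : RepresentedBy a K T') : T = T' := by
  ext1 f
  apply Lp.ext
  filter_upwards [h f, h' f] with x hx hx'
  rw [hx.2, hx'.2]

open scoped Classical in
/-- The bounded operator with multiplier `a` and integral kernel `K`
(`0` if these do not define a bounded operator on `L²`). -/
def opOf {n : ℕ} (a : Rn n → ℝ) (K : Rn n → Rn n → ℝ) : L2 n →L[ℂ] L2 n :=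
  if h : ∃ T, RepresentedBy a K T then h.choose else 0

theorem RepresentedBy.opOf_eq {n : ℕ} {a : Rn n → ℝ} {K : Rn n → Rn n → ℝ}
    {T : L2 n →L[ℂ] L2 n} (h : RepresentedBy a K T) : opOf a K = T := by
  have hex : ∃ T, RepresentedBy a K T := ⟨T, h⟩
  rw [opOf, dif_pos hex]
  exact hex.choose_spec.unique h

/-- The constant `d₀ = Γ(n/2 - m) / (4^m π^{n/2} Γ(m))` of the Riesz potential:
for `0 < 2m < n`, `(-Δ)^{-m}` is convolution with `d₀ |x|^{2m-n}`. -/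
def rieszConst (n m : ℕ) : ℝ :=
  Real.Gamma ((n : ℝ) / 2 - m) / (4 ^ m * Real.pi ^ ((n : ℝ) / 2) * Real.Gamma m)

/-- The kernels `G₀(x, y) = d₀ |x - y|^{2m-n}` and `G_j(x, y) = |x - y|^{2j-2}`, `j ≥ 1`. -/
def G (n m : ℕ) : ℕ → Rn n → Rn n → ℝ
  | 0 => fun x y => rieszConst n m * ‖x - y‖ ^ (2 * (m : ℝ) - n)
  | j + 1 => fun x y => ‖x - y‖ ^ (2 * j)

/-- The kernel `v(x) G_j(x, y) v(y)` of `v G_j v`. -/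
def vGv {n : ℕ} (m : ℕ) (V : Rn n → ℝ) (j : ℕ) (x y : Rn n) : ℝ :=
  vPot V x * G n m j x y * vPot V y

/-- `T₀ = U + v G₀ v`. -/
def T0 {n : ℕ} (m : ℕ) (V : Rn n → ℝ) : L2 n →L[ℂ] L2 n :=
  opOf (uSign V) (vGv m V 0)

/-- The orthogonal projection `P = ‖v‖⁻² v ⟨v, ·⟩` onto the span of `v`. -/
def P {n : ℕ} (V : Rn n → ℝ) : L2 n →L[ℂ] L2 n :=
  opOf 0 (fun x y => vPot V x * vPot V y / ∫ z, vPot V z ^ 2)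

/-- The operators `A_j` that are compressed to `S_j L²` in the inversion process:
`A₀ = T₀`, `A₁ = P` and `A_j = v G_j v` for `j ≥ 2`. -/
def A {n : ℕ} (m : ℕ) (V : Rn n → ℝ) : ℕ → (L2 n →L[ℂ] L2 n)
  | 0 => T0 m V
  | 1 => P V
  | j + 2 => opOf 0 (vGv m V (j + 2))

/-- For a projection `S`, the subspace `{φ ∈ S L² : S B S φ = 0}`, i.e. the kernel of
`S B S` as an operator on `S L²`. -/
def compressedKer {n : ℕ} (S B : L2 n →L[ℂ] L2 n) : Submodule ℂ (L2 n) :=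
  ((1 - S).prod (S ∘L B ∘L S)).ker

theorem mem_compressedKer {n : ℕ} {S B : L2 n →L[ℂ] L2 n} {φ : L2 n} :
    φ ∈ compressedKer S B ↔ S φ = φ ∧ S (B (S φ)) = 0 := by
  have h : (1 - S) φ = 0 ↔ S φ = φ := by
    rw [sub_apply, sub_eq_zero, eq_comm]; rfl
  rw [← h]
  simp [compressedKer]

instance {n : ℕ} (S B : L2 n →L[ℂ] L2 n) : CompleteSpace (compressedKer S B) :=
  inferInstanceAs (CompleteSpace (((1 - S).prod (S ∘L B ∘L S)).ker))

/-- The projections `S_j`. With `S₀ = I` and `T_j = S_j A_j S_j` (so that `T₀ = U + v G₀ v`,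
`T₁ = S₁ P S₁` and `T_j = S_j v G_j v S_j` for `j ≥ 2`), `S_{j+1}` is the projection of `L²` onto
the kernel of the operator `T_j` on `S_j L²`. The `T_j` are self-adjoint, so that the Riesz
projection onto the kernel is the orthogonal one. -/
def S {n : ℕ} (m : ℕ) (V : Rn n → ℝ) : ℕ → (L2 n →L[ℂ] L2 n)
  | 0 => 1
  | j + 1 => (compressedKer (S m V j) (A m V j)).starProjection

/-- The subspace `S_j L²(ℝⁿ)`. -/
def SL2 {n : ℕ} (m : ℕ) (V : Rn n → ℝ) (j : ℕ) : Submodule ℂ (L2 n) :=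
  (S m V j).range

/-- `φ = U v ψ` for a function `ψ` that is not a.e. zero, belongs to the class `X`, and solves
`((-Δ)^m + V) ψ = 0` in the sense of distributions. -/
def ComesFromSolutionIn {n : ℕ} (m : ℕ) (V : Rn n → ℝ) (X : (Rn n → ℂ) → Prop)
    (φ : L2 n) : Prop :=
  ∃ ψ : Rn n → ℂ, X ψ ∧ ¬ (ψ =ᵐ[volume] 0) ∧ IsDistribSolution m V ψ ∧
    φ =ᵐ[volume] fun x => (uSign V x : ℂ) * (vPot V x : ℂ) * ψ x

end

end PolyharmonicSchrodinger

/-!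
Write `n = 2m + 2q` with `q = m + 1 - k ≥ 1`, so that `G₀` is convolution with `d₀ |x|^{-2q}` and
`2m - n/2 = k - 1`. The correspondence between `φ` and `ψ` is `φ = Uvψ`, `ψ = -G₀ v φ`; the function
`f = vφ = Vψ` has integrable moments up to degree `2k`, because `V` decays fast. Both sides of each
equivalence amount to `T₀ φ = 0` together with the vanishing of the moments of `f` of low degree.

* On the side of the operators, `φ ∈ S_{j+1} L²` if and only if `T₀ φ = 0` and the moments of `vφ` of
  degree `< j` vanish (`mem_SL2_iff`). Expanding `|x - y|^{2l}` into monomials writes the form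
  `⟨φ, v |x - y|^{2l} v φ⟩` as a sum of products of two moments whose degrees add up to `2l`
  (`inner_eq_sum_moment`). If the moments of degree `< l` vanish, then only the squares of the moments
  of degree `l` are left, all with the sign `(-1)^l`, so that a zero of the form kills the moments of
  degree `l` (`VanishingMoments.succ_of_inner_eq_zero`).

* From `φ` to `ψ`: if the moments of `f` of degree `< l` vanish, then the expansion of `|x - y|^{-2q}`
  at infinity gives `ψ = O(|x|^{-2q-l})` up to an `L²` function
  (`VanishingMoments.rieszPotential_bound`), which puts `ψ` into the desired weighted space. That `ψ`
  solves the equation is the statement that `d₀ |x|^{-2q}` is a fundamental solution of `(-Δ)^m`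
  (`rieszConst_mul_integral_negLaplacianPow`); it is proved by writing both the kernel and the symbol
  of `(-Δ)^{-m}` as superpositions of Gaussians.

* From `ψ` to `φ`: the function `ψ + G₀ V ψ` satisfies `(-Δ)^m u = 0` and lies in `L²_{-s}` for some
  `s < n/2`, so that it vanishes by a Liouville theorem (`ae_eq_zero_of_polyharmonic`); hence
  `T₀ φ = 0`. The moments of `Vψ` are found by testing the equation with homogeneous polynomials of
  degree `< 2m`, which are polyharmonic, cut off at distance `R → ∞`; the error terms live where
  `R ≤ |x| ≤ 2R` and are controlled by the decay of `ψ` (`integral_monomialFn_mul_eq_zero`).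
-/

namespace PolyharmonicSchrodinger

section

open scoped ENNReal

/-! ### Integral operators on `L²` -/

/-- The integral operator with the nonnegative kernel `κ` is bounded on `L²`, the square of its norm
being at most `A`. -/
def L2BoundedKernel {n : ℕ} (κ : Rn n → Rn n → ℝ≥0∞) (A : ℝ≥0∞) : Prop :=
  ∀ f : Rn n → ℝ≥0∞, AEMeasurable f → ∫⁻ x, (∫⁻ y, κ x y * f y) ^ 2 ≤ A * ∫⁻ y, f y ^ 2

/-- The Cauchy-Schwarz inequality, squared. -/
theorem sq_lintegral_mul_le {α : Type*} [MeasurableSpace α] {μ : Measure α} {f g : α → ℝ≥0∞}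
    (hf : AEMeasurable f μ) (hg : AEMeasurable g μ) :
    (∫⁻ x, f x * g x ∂μ) ^ 2 ≤ (∫⁻ x, f x ^ 2 ∂μ) * ∫⁻ x, g x ^ 2 ∂μ := by
  have h := ENNReal.lintegral_mul_le_Lp_mul_Lq μ (Real.HolderConjugate.two_two) hf hg
  have h2 := pow_le_pow_left' h 2
  refine h2.trans_eq ?_
  rw [mul_pow, ← ENNReal.rpow_natCast, ← ENNReal.rpow_natCast, ← ENNReal.rpow_mul,
    ← ENNReal.rpow_mul]
  norm_num

namespace L2BoundedKernel

variable {n : ℕ} {κ κ' : Rn n → Rn n → ℝ≥0∞} {A A' : ℝ≥0∞}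

theorem mono (h : L2BoundedKernel κ' A) (hle : ∀ᵐ x, ∀ᵐ y, κ x y ≤ κ' x y) :
    L2BoundedKernel κ A := by
  intro f hf
  refine le_trans (lintegral_mono_ae ?_) (h f hf)
  filter_upwards [hle] with x hx
  refine pow_le_pow_left' (lintegral_mono_ae ?_) 2
  filter_upwards [hx] with y hy
  gcongr

theorem add (hκ : AEMeasurable (Function.uncurry κ) (volume.prod volume))
    (h : L2BoundedKernel κ A) (h' : L2BoundedKernel κ' A') :
    L2BoundedKernel (fun x y => κ x y + κ' x y) (2 * A + 2 * A') := by
  intro f hf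
  have hm : AEMeasurable (fun p : Rn n × Rn n => κ p.1 p.2 * f p.2) (volume.prod volume) :=
    hκ.mul hf.comp_snd
  calc ∫⁻ x, (∫⁻ y, (κ x y + κ' x y) * f y) ^ 2
      = ∫⁻ x, (∫⁻ y, κ x y * f y + κ' x y * f y) ^ 2 := by simp_rw [add_mul]
    _ ≤ ∫⁻ x, (2 * (∫⁻ y, κ x y * f y) ^ 2 + 2 * (∫⁻ y, κ' x y * f y) ^ 2) := by
        apply lintegral_mono_ae
        filter_upwards [hm.aestronglyMeasurable.prodMk_left] with x hx
        rw [lintegral_add_left' hx.aemeasurable]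
        have h2 := ENNReal.rpow_add_le_mul_rpow_add_rpow (∫⁻ y, κ x y * f y)
          (∫⁻ y, κ' x y * f y) (p := 2) (by norm_num)
        norm_num at h2
        rw [← mul_add]
        exact h2
    _ = 2 * (∫⁻ x, (∫⁻ y, κ x y * f y) ^ 2) + 2 * ∫⁻ x, (∫⁻ y, κ' x y * f y) ^ 2 := by
        rw [lintegral_add_left' ((hm.lintegral_prod_right'.pow_const 2).const_mul 2),
          lintegral_const_mul' _ _ (by norm_num), lintegral_const_mul' _ _ (by norm_num)]
    _ ≤ 2 * (A * ∫⁻ y, f y ^ 2) + 2 * (A' * ∫⁻ y, f y ^ 2) := by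
        gcongr
        · exact h f hf
        · exact h' f hf
    _ = _ := by ring

/-- A form of Young's inequality: convolution with an integrable function is bounded on `L²`. -/
theorem convolution {g : Rn n → ℝ≥0∞} (hg : Measurable g) :
    L2BoundedKernel (fun x y => g (x - y)) ((∫⁻ z, g z) ^ 2) := by
  intro f hf
  have hsq (a : ℝ≥0∞) : a ^ (1 / 2 : ℝ) * a ^ (1 / 2 : ℝ) = a := by
    rw [← ENNReal.rpow_add_of_nonneg _ _ (by norm_num) (by norm_num)]; norm_num
  have hcs (x : Rn n) : (∫⁻ y, g (x - y) * f y) ^ 2 ≤ (∫⁻ z, g z) * ∫⁻ y, g (x - y) * f y ^ 2 := by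
    have hgx : AEMeasurable (fun y => g (x - y) ^ (1 / 2 : ℝ)) volume := by
      fun_prop
    have h := sq_lintegral_mul_le hgx (hgx.mul hf)
    simp only [Pi.mul_apply, ← mul_assoc, hsq, mul_pow, sq (_ ^ (1 / 2 : ℝ))] at h
    rwa [lintegral_sub_left_eq_self g x] at h
  have hm : AEMeasurable (fun p : Rn n × Rn n => g (p.1 - p.2) * f p.2 ^ 2)
      (volume.prod volume) := by
    have : Measurable (fun p : Rn n × Rn n => g (p.1 - p.2)) := by fun_prop
    exact this.aemeasurable.mul (hf.comp_snd.pow_const 2)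
  calc ∫⁻ x, (∫⁻ y, g (x - y) * f y) ^ 2
      ≤ ∫⁻ x, (∫⁻ z, g z) * ∫⁻ y, g (x - y) * f y ^ 2 := lintegral_mono hcs
    _ = (∫⁻ z, g z) * ∫⁻ x, ∫⁻ y, g (x - y) * f y ^ 2 := by
        rw [lintegral_const_mul'' _ hm.lintegral_prod_right']
    _ = (∫⁻ z, g z) * ∫⁻ y, ∫⁻ x, g (x - y) * f y ^ 2 := by
        rw [lintegral_lintegral_swap hm]
    _ = (∫⁻ z, g z) * ∫⁻ y, (∫⁻ z, g z) * f y ^ 2 := by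
        congr 1
        refine lintegral_congr fun y => ?_
        rw [lintegral_mul_const _ (by fun_prop), lintegral_sub_right_eq_self g y]
    _ = _ := by rw [lintegral_const_mul'' _ (hf.pow_const 2), ← mul_assoc, sq]

theorem rankOne {a b : Rn n → ℝ≥0∞} (ha : AEMeasurable a) (hb : AEMeasurable b) :
    L2BoundedKernel (fun x y => a x * b y) ((∫⁻ x, a x ^ 2) * ∫⁻ y, b y ^ 2) := by
  intro f hf
  simp_rw [mul_assoc]
  calc ∫⁻ x, (∫⁻ y, a x * (b y * f y)) ^ 2
      = ∫⁻ x, a x ^ 2 * (∫⁻ y, b y * f y) ^ 2 := by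
        refine lintegral_congr fun x => ?_
        rw [lintegral_const_mul'' (a x) (f := fun y => b y * f y) (hb.mul hf), mul_pow]
    _ = (∫⁻ x, a x ^ 2) * (∫⁻ y, b y * f y) ^ 2 := lintegral_mul_const'' _ (ha.pow_const 2)
    _ ≤ _ := by gcongr; exact sq_lintegral_mul_le hb hf

theorem const_mul (h : L2BoundedKernel κ A) {c : ℝ≥0∞} (hc : c ≠ ⊤) :
    L2BoundedKernel (fun x y => c * κ x y) (c ^ 2 * A) := by
  intro f hf
  simp_rw [mul_assoc, lintegral_const_mul' c _ hc, mul_pow]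
  rw [lintegral_const_mul' _ _ (by finiteness)]
  gcongr
  exact h f hf

end L2BoundedKernel

theorem enorm_complex_ofReal (r : ℝ) : ‖(r : ℂ)‖ₑ = ‖r‖ₑ := by
  rw [← ofReal_norm, ← ofReal_norm, Complex.norm_real]

theorem sq_eLpNorm_two {α E : Type*} [MeasurableSpace α] [NormedAddCommGroup E] {μ : Measure α}
    (f : α → E) : eLpNorm f 2 μ ^ 2 = ∫⁻ x, ‖f x‖ₑ ^ 2 ∂μ := by
  have := eLpNorm_nnreal_pow_eq_lintegral (f := f) (μ := μ) (p := 2) (by norm_num)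
  simpa using this

theorem MemLp.lintegral_sq_ne_top {α E : Type*} [MeasurableSpace α] [NormedAddCommGroup E]
    {μ : Measure α} {f : α → E} (hf : MemLp f 2 μ) : ∫⁻ x, ‖f x‖ₑ ^ 2 ∂μ ≠ ⊤ := by
  rw [← sq_eLpNorm_two]
  exact ENNReal.pow_ne_top hf.2.ne

section IntegralOperator

variable {n : ℕ} {K : Rn n → Rn n → ℝ} {A : ℝ≥0∞}

theorem aestronglyMeasurable_kernel_mul
    (hK : AEStronglyMeasurable (Function.uncurry K) (volume.prod volume)) {f : Rn n → ℂ}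
    (hf : AEStronglyMeasurable f volume) :
    AEStronglyMeasurable (fun p : Rn n × Rn n => (K p.1 p.2 : ℂ) * f p.2)
      (volume.prod volume) :=
  (Complex.continuous_ofReal.comp_aestronglyMeasurable hK).mul hf.comp_snd

theorem L2BoundedKernel.ae_integrable
    (hK : AEStronglyMeasurable (Function.uncurry K) (volume.prod volume))
    (h : L2BoundedKernel (fun x y => ‖K x y‖ₑ) A) (hA : A ≠ ⊤) {f : Rn n → ℂ}
    (hf : MemLp f 2 volume) : ∀ᵐ x, Integrable (fun y => (K x y : ℂ) * f y) volume := by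
  have hm := aestronglyMeasurable_kernel_mul hK hf.1
  have h1 := h (fun y => ‖f y‖ₑ) hf.1.enorm
  have h2 : ∫⁻ x, (∫⁻ y, ‖(K x y : ℂ) * f y‖ₑ) ^ 2 ≠ ⊤ := by
    simp_rw [enorm_mul, enorm_complex_ofReal]
    exact ne_top_of_le_ne_top (ENNReal.mul_ne_top hA (MemLp.lintegral_sq_ne_top hf)) h1
  have h3 := ae_lt_top' (hm.enorm.lintegral_prod_right'.pow_const 2) h2
  filter_upwards [h3, hm.prodMk_left] with x hx hx'
  refine ⟨hx', ?_⟩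
  by_contra hc
  rw [HasFiniteIntegral, not_lt, top_le_iff] at hc
  rw [hc] at hx
  simp at hx

theorem L2BoundedKernel.eLpNorm_integral_le
    (h : L2BoundedKernel (fun x y => ‖K x y‖ₑ) A) {f : Rn n → ℂ} (hf : MemLp f 2 volume) :
    eLpNorm (fun x => ∫ y, (K x y : ℂ) * f y) 2 volume
      ≤ A ^ (1 / 2 : ℝ) * eLpNorm f 2 volume := by
  rw [← ENNReal.pow_le_pow_left_iff two_ne_zero, mul_pow, sq_eLpNorm_two, sq_eLpNorm_two,
    ← ENNReal.rpow_natCast, ← ENNReal.rpow_mul]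
  norm_num
  refine le_trans (lintegral_mono fun x => ?_) (h (fun y => ‖f y‖ₑ) hf.1.enorm)
  refine pow_le_pow_left' ((enorm_integral_le_lintegral_enorm _).trans_eq ?_) 2
  simp_rw [enorm_mul, enorm_complex_ofReal]

/-- A measurable kernel that is dominated by a bounded one, together with a bounded multiplier,
defines a bounded operator. -/
theorem L2BoundedKernel.representedBy_opOf {a : Rn n → ℝ} (ha : AEStronglyMeasurable a volume)
    (ha1 : ∀ x, |a x| ≤ 1)
    (hK : AEStronglyMeasurable (Function.uncurry K) (volume.prod volume))
    (h : L2BoundedKernel (fun x y => ‖K x y‖ₑ) A) (hA : A ≠ ⊤) :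
    RepresentedBy a K (opOf a K) := by
  have hint {f : Rn n → ℂ} (hf : MemLp f 2 volume) := h.ae_integrable hK hA hf
  have hmul {f : Rn n → ℂ} (hf : MemLp f 2 volume) :
      MemLp (fun x => (a x : ℂ) * f x) 2 volume := by
    refine hf.mono ((Complex.continuous_ofReal.comp_aestronglyMeasurable ha).mul hf.1) ?_
    refine .of_forall fun x => ?_
    rw [norm_mul, Complex.norm_real, Real.norm_eq_abs]
    exact mul_le_of_le_one_left (norm_nonneg _) (ha1 x)
  have hI {f : Rn n → ℂ} (hf : MemLp f 2 volume) :
      MemLp (fun x => ∫ y, (K x y : ℂ) * f y) 2 volume :=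
    ⟨(aestronglyMeasurable_kernel_mul hK hf.1).integral_prod_right',
      (h.eLpNorm_integral_le hf).trans_lt
        (ENNReal.mul_lt_top (ENNReal.rpow_lt_top_of_nonneg (by norm_num) hA) hf.2)⟩
  have hmem (f : L2 n) := (hmul (Lp.memLp f)).add (hI (Lp.memLp f))
  let T₀ : L2 n →ₗ[ℂ] L2 n :=
    { toFun := fun f => (hmem f).toLp _
      map_add' := by
        intro f g
        rw [← MemLp.toLp_add]
        refine MemLp.toLp_congr _ _ ?_
        filter_upwards [Lp.coeFn_add f g, hint (Lp.memLp f), hint (Lp.memLp g)] with x hx h1 h2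
        have : (fun y => (K x y : ℂ) * (f + g : L2 n) y)
            =ᵐ[volume] fun y => (K x y : ℂ) * f y + (K x y : ℂ) * g y := by
          filter_upwards [Lp.coeFn_add f g] with y hy
          rw [hy, Pi.add_apply, mul_add]
        simp only [Pi.add_apply]
        rw [integral_congr_ae this, integral_add h1 h2, hx, Pi.add_apply]
        ring
      map_smul' := by
        intro c f
        rw [RingHom.id_apply, ← MemLp.toLp_const_smul]
        refine MemLp.toLp_congr _ _ ?_
        filter_upwards [Lp.coeFn_smul c f] with x hx
        have : (fun y => (K x y : ℂ) * (c • f : L2 n) y)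
            =ᵐ[volume] fun y => c * ((K x y : ℂ) * f y) := by
          filter_upwards [Lp.coeFn_smul c f] with y hy
          rw [hy, Pi.smul_apply, smul_eq_mul]
          ring
        simp only [Pi.add_apply, Pi.smul_apply, smul_eq_mul]
        rw [integral_congr_ae this, integral_const_mul, hx, Pi.smul_apply, smul_eq_mul]
        ring }
  have hbound (f : L2 n) : ‖T₀ f‖ ≤ (1 + (A ^ (1 / 2 : ℝ)).toReal) * ‖f‖ := by
    change ‖(hmem f).toLp _‖ ≤ _
    rw [Lp.norm_toLp, Lp.norm_def]
    have hA' : A ^ (1 / 2 : ℝ) ≠ ⊤ := (ENNReal.rpow_lt_top_of_nonneg (by norm_num) hA).ne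
    have hsum : 1 + (A ^ (1 / 2 : ℝ)).toReal = (1 + A ^ (1 / 2 : ℝ)).toReal := by
      rw [ENNReal.toReal_add (by norm_num) hA', ENNReal.toReal_one]
    rw [hsum, ← ENNReal.toReal_mul]
    refine ENNReal.toReal_mono (ENNReal.mul_ne_top (by finiteness) (Lp.eLpNorm_ne_top f)) ?_
    refine (eLpNorm_add_le (hmul (Lp.memLp f)).1 (hI (Lp.memLp f)).1 (by norm_num)).trans ?_
    rw [add_mul, one_mul]
    refine add_le_add (eLpNorm_mono fun x => ?_) (h.eLpNorm_integral_le (Lp.memLp f))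
    rw [norm_mul, Complex.norm_real, Real.norm_eq_abs]
    exact mul_le_of_le_one_left (norm_nonneg _) (ha1 x)
  have hT : RepresentedBy a K (T₀.mkContinuous _ hbound) := by
    intro f
    filter_upwards [hint (Lp.memLp f), (hmem f).coeFn_toLp] with x hx hx'
    exact ⟨hx, hx'⟩
  rw [hT.opOf_eq]
  exact hT

end IntegralOperator

end

section

open scoped ENNReal RealInnerProductSpace

/-! ### The Riesz kernel and its expansion at infinity -/

/-- The function `|z|^{-2q}` on `ℝⁿ`, with the value `0` at the origin if `q ≥ 1`. -/
noncomputable def rieszKernel {n : ℕ} (q : ℕ) (z : Rn n) : ℝ := (‖z‖ ^ (2 * q))⁻¹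

/-- The function `|z|^{-2q} (1 + |z|)^{-2m-1}`; it is integrable on `ℝⁿ` for `n = 2m + 2q`. -/
noncomputable def truncatedKernel {n : ℕ} (m q : ℕ) (z : Rn n) : ℝ :=
  rieszKernel q z * ((1 + ‖z‖) ^ (2 * m + 1))⁻¹

variable {n m q : ℕ}

theorem rieszKernel_nonneg (z : Rn n) : 0 ≤ rieszKernel q z := by
  unfold rieszKernel; positivity

theorem truncatedKernel_nonneg (z : Rn n) : 0 ≤ truncatedKernel m q z := by
  unfold truncatedKernel rieszKernel; positivity

theorem rieszKernel_neg (z : Rn n) : rieszKernel q (-z) = rieszKernel q z := by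
  simp [rieszKernel]

@[fun_prop]
theorem measurable_rieszKernel : Measurable (rieszKernel q : Rn n → ℝ) := by
  unfold rieszKernel; fun_prop

@[fun_prop]
theorem measurable_truncatedKernel : Measurable (truncatedKernel m q : Rn n → ℝ) := by
  unfold truncatedKernel; fun_prop

theorem G_zero_eq (hn : n = 2 * m + 2 * q) (x y : Rn n) :
    G n m 0 x y = rieszConst n m * rieszKernel q (x - y) := by
  have : 2 * (m : ℝ) - n = -((2 * q : ℕ) : ℝ) := by
    rw [hn]; push_cast; ring
  simp only [G]
  rw [this, Real.rpow_neg (norm_nonneg _), Real.rpow_natCast, rieszKernel]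

theorem integrable_truncatedKernel (hm : 1 ≤ m) (hn : n = 2 * m + 2 * q) :
    Integrable (truncatedKernel m q : Rn n → ℝ) := by
  have : Nontrivial (Rn n) := by
    have : Nonempty (Fin n) := ⟨⟨0, by omega⟩⟩
    infer_instance
  have h := integrable_fun_norm_addHaar (volume : Measure (Rn n))
    (f := fun r : ℝ => (r ^ (2 * q))⁻¹ * ((1 + r) ^ (2 * m + 1))⁻¹)
  refine h.2 ?_
  have h2 : IntegrableOn (fun r : ℝ => (1 + r) ^ (-2 : ℝ)) (Set.Ioi 0) := by
    have := integrable_one_add_norm (E := ℝ) (μ := volume) (r := 2) (by simp)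
    refine this.integrableOn.congr_fun (fun r hr => ?_) measurableSet_Ioi
    simp [abs_of_pos (Set.mem_Ioi.1 hr)]
  refine h2.mono' (by fun_prop) ?_
  filter_upwards [ae_restrict_mem measurableSet_Ioi] with r hr
  have hr : 0 < r := hr
  have hdim : Module.finrank ℝ (Rn n) - 1 = 2 * q + (2 * m - 1) := by
    rw [finrank_euclideanSpace_fin]; omega
  rw [hdim, smul_eq_mul, Real.norm_of_nonneg (by positivity), Real.rpow_neg (by positivity),
    pow_add]
  have h3 : r ^ (2 * m - 1) ≤ (1 + r) ^ (2 * m - 1) := by gcongr; linarith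
  have h4 : (1 + r) ^ (2 * m + 1) = (1 + r) ^ (2 * m - 1) * (1 + r) ^ 2 := by
    rw [← pow_add]; congr 1; omega
  rw [h4]
  norm_cast
  calc r ^ (2 * q) * r ^ (2 * m - 1) * ((r ^ (2 * q))⁻¹ * ((1 + r) ^ (2 * m - 1) * (1 + r) ^ 2)⁻¹)
      = r ^ (2 * m - 1) / (1 + r) ^ (2 * m - 1) * ((1 + r) ^ 2)⁻¹ := by field_simp
    _ ≤ 1 * ((1 + r) ^ 2)⁻¹ := by
        gcongr
        exact (div_le_one (by positivity)).2 h3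
    _ = _ := one_mul _

/-- Where `|x - y| ≲ 1 + |y|`, the Riesz kernel is controlled by the integrable truncated one at the
expense of a weight in `y`. -/
theorem rieszKernel_le_of_near {x y : Rn n} (h : 1 + ‖x - y‖ ≤ 2 * (1 + ‖y‖)) :
    rieszKernel q (x - y)
      ≤ 2 ^ (2 * m + 1) * (truncatedKernel m q (x - y) * (1 + ‖y‖) ^ (2 * m + 1)) := by
  have h1 : (1 + ‖x - y‖) ^ (2 * m + 1) ≤ 2 ^ (2 * m + 1) * (1 + ‖y‖) ^ (2 * m + 1) := by
    rw [← mul_pow]; gcongr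
  have h0 := rieszKernel_nonneg (q := q) (x - y)
  calc rieszKernel q (x - y)
      = truncatedKernel m q (x - y) * (1 + ‖x - y‖) ^ (2 * m + 1) := by
        unfold truncatedKernel
        rw [mul_assoc, inv_mul_cancel₀ (by positivity), mul_one]
    _ ≤ truncatedKernel m q (x - y) * (2 ^ (2 * m + 1) * (1 + ‖y‖) ^ (2 * m + 1)) := by
        gcongr
        exact truncatedKernel_nonneg _
    _ = _ := by ring

/-- The Riesz kernel is integrable in `x - y` against a weight in `y`, up to a bounded term. -/
theorem rieszKernel_le (x y : Rn n) :
    rieszKernel q (x - y)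
      ≤ 2 ^ (2 * m + 1) * (truncatedKernel m q (x - y) * (1 + ‖y‖) ^ (2 * m + 1)) + 1 := by
  have h0 := truncatedKernel_nonneg (m := m) (q := q) (x - y)
  rcases le_total (1 + ‖x - y‖) (2 * (1 + ‖y‖)) with h | h
  · have := rieszKernel_le_of_near (m := m) (q := q) h
    linarith
  · have h1 : 1 ≤ ‖x - y‖ := by linarith [norm_nonneg y]
    have : rieszKernel q (x - y) ≤ 1 := inv_le_one_of_one_le₀ (one_le_pow₀ h1)
    have : 0 ≤ 2 ^ (2 * m + 1) * (truncatedKernel m q (x - y) * (1 + ‖y‖) ^ (2 * m + 1)) := by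
      positivity
    linarith

/-- Taylor expansion of `(1 - t)^{-q}` at `0`, with a remainder that is uniform away from `t = 1`. -/
theorem exists_taylor_inv_one_sub_pow (q l : ℕ) :
    ∃ (c : ℕ → ℝ) (C : ℝ), 0 ≤ C ∧ ∀ t : ℝ, 1 / 4 ≤ 1 - t →
      |((1 - t) ^ q)⁻¹ - ∑ i ∈ Finset.range l, c i * t ^ i| ≤ C * |t| ^ l := by
  induction q with
  | zero =>
    refine ⟨fun i => if i = 0 then 1 else 0, 1, zero_le_one, fun t _ => ?_⟩
    rcases Nat.eq_zero_or_pos l with rfl | hl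
    · simp
    · simp [Finset.sum_ite_eq', hl]
  | succ q ih =>
    obtain ⟨c, C, hC, h⟩ := ih
    -- dividing by `1 - t` replaces the coefficients by their partial sums
    set s : ℕ → ℝ := fun j => ∑ i ∈ Finset.range j, c i with hs
    have htel (t : ℝ) (j : ℕ) : (∑ i ∈ Finset.range j, s (i + 1) * t ^ i) * (1 - t)
        = ∑ i ∈ Finset.range j, c i * t ^ i - s j * t ^ j := by
      induction j with
      | zero => simp [hs]
      | succ j ih =>
        rw [Finset.sum_range_succ, Finset.sum_range_succ, add_mul, ih]
        have : s (j + 1) = s j + c j := Finset.sum_range_succ _ _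
        rw [this]; ring
    refine ⟨fun i => s (i + 1), (C + |s l|) * 4, by positivity, fun t ht => ?_⟩
    have hpos : 0 < 1 - t := by linarith
    have key : ((1 - t) ^ (q + 1))⁻¹ - ∑ i ∈ Finset.range l, s (i + 1) * t ^ i
        = (((1 - t) ^ q)⁻¹ - ∑ i ∈ Finset.range l, c i * t ^ i + s l * t ^ l) * (1 - t)⁻¹ := by
      rw [eq_mul_inv_iff_mul_eq₀ hpos.ne', sub_mul, htel, pow_succ]
      field_simp
      ring
    rw [key, abs_mul, abs_of_pos (inv_pos.2 hpos)]
    have h4 : (1 - t)⁻¹ ≤ 4 := by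
      rw [inv_le_comm₀ hpos (by norm_num)]; linarith
    calc _ ≤ (C * |t| ^ l + |s l| * |t| ^ l) * 4 := by
          gcongr
          refine (abs_add_le _ _).trans (add_le_add (h t ht) ?_)
          rw [abs_mul, abs_pow]
      _ = _ := by ring

/-- The term `c (2⟨x, y⟩)^{i-b} (-|y|²)^b |x|^{-2q-2i}` of degree `i + b` in `y` of the expansion of
`|x - y|^{-2q}` at infinity, where `c` is `cᵢ` times a binomial coefficient. -/
noncomputable def expansionTerm (q : ℕ) (c : ℕ → ℝ) (i b : ℕ) (x y : Rn n) : ℝ :=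
  c i * i.choose b * 2 ^ (i - b) * (-1) ^ b * (‖x‖ ^ (2 * q + 2 * i))⁻¹ *
    (⟪x, y⟫ ^ (i - b) * ‖y‖ ^ (2 * b))

/-- The part of degree `< l` in `y` of the expansion of `|x - y|^{-2q}` at infinity. -/
noncomputable def lowExpansion (q : ℕ) (c : ℕ → ℝ) (l : ℕ) (x y : Rn n) : ℝ :=
  ∑ i ∈ Finset.range l, ∑ b ∈ Finset.range (i + 1),
    if i + b < l then expansionTerm q c i b x y else 0

theorem abs_expansionTerm_le (c : ℕ → ℝ) {i b : ℕ} (hb : b ≤ i) {x y : Rn n} (hx : 0 < ‖x‖) :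
    |expansionTerm q c i b x y|
      ≤ |c i| * i.choose b * 2 ^ i * (‖y‖ ^ (i + b) * (‖x‖ ^ (2 * q + (i + b)))⁻¹) := by
  unfold expansionTerm
  simp only [abs_mul, abs_pow, abs_inv, abs_norm, abs_neg, abs_one, one_pow, mul_one, Nat.abs_cast,
    abs_two]
  have h1 : |⟪x, y⟫| ^ (i - b) ≤ (‖x‖ * ‖y‖) ^ (i - b) := by
    gcongr; exact abs_real_inner_le_norm x y
  have h2 : (2 : ℝ) ^ (i - b) ≤ 2 ^ i := pow_le_pow_right₀ (by norm_num) (by omega)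
  calc |c i| * i.choose b * 2 ^ (i - b) * (‖x‖ ^ (2 * q + 2 * i))⁻¹
        * (|⟪x, y⟫| ^ (i - b) * ‖y‖ ^ (2 * b))
      ≤ |c i| * i.choose b * 2 ^ i * (‖x‖ ^ (2 * q + 2 * i))⁻¹
        * ((‖x‖ * ‖y‖) ^ (i - b) * ‖y‖ ^ (2 * b)) := by gcongr
    _ = _ := by
        have e1 : 2 * q + 2 * i = (2 * q + (i + b)) + (i - b) := by omega
        have e2 : i + b = (i - b) + 2 * b := by omega
        rw [mul_pow, e1, pow_add ‖x‖ _ (i - b), e2, pow_add ‖y‖]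
        field_simp

/-- Up to terms that are integrable in `x` against a weight in `y`, the Riesz kernel is given by the
terms of degree `< l` in `y` of its expansion at infinity. -/
theorem exists_rieszKernel_expansion (m q l : ℕ) :
    ∃ (c : ℕ → ℝ) (C : ℝ), 0 ≤ C ∧ ∀ x y : Rn n, 1 ≤ ‖x‖ →
      |rieszKernel q (x - y) - lowExpansion q c l x y|
        ≤ C * (truncatedKernel m q (x - y) * (1 + ‖y‖) ^ (2 * m + 1)
          + (1 + ‖y‖) ^ (2 * l) * (‖x‖ ^ (2 * q + l))⁻¹) := by
  obtain ⟨c, C₁, hC₁, hc⟩ := exists_taylor_inv_one_sub_pow q l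
  set B : ℝ := ∑ i ∈ Finset.range l, ∑ b ∈ Finset.range (i + 1), |c i| * i.choose b * 2 ^ i
  have hB : 0 ≤ B := by positivity
  refine ⟨c, 2 ^ (2 * m + 1) + C₁ + 3 ^ l * B, by positivity, fun x y hx => ?_⟩
  have hx0 : 0 < ‖x‖ := by linarith
  have hy0 := norm_nonneg y
  set X : ℝ := (1 + ‖y‖) ^ (2 * l) * (‖x‖ ^ (2 * q + l))⁻¹ with hX
  have hX0 : 0 ≤ X := by positivity
  set N : ℝ := truncatedKernel m q (x - y) * (1 + ‖y‖) ^ (2 * m + 1)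
  have hN0 : 0 ≤ N := mul_nonneg (truncatedKernel_nonneg _) (by positivity)
  rcases le_total (1 + ‖x - y‖) (2 * (1 + ‖y‖)) with h | h
  · -- near the diagonal both the kernel and the expansion are small
    have hxy : ‖x‖ ≤ 3 * (1 + ‖y‖) := by
      have := norm_le_norm_add_norm_sub' x y
      linarith
    have hlow : |lowExpansion q c l x y| ≤ 3 ^ l * B * X := by
      rw [mul_comm (3 ^ l) B, mul_assoc, Finset.sum_mul]
      refine (Finset.abs_sum_le_sum_abs _ _).trans (Finset.sum_le_sum fun i _ => ?_)
      rw [Finset.sum_mul]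
      refine (Finset.abs_sum_le_sum_abs _ _).trans (Finset.sum_le_sum fun b hb => ?_)
      split_ifs with hib
      · refine (abs_expansionTerm_le c (by grind) hx0).trans ?_
        refine mul_le_mul_of_nonneg_left ?_ (by positivity)
        obtain ⟨e, he⟩ := Nat.exists_eq_add_of_lt hib
        have he' : l = (i + b) + (e + 1) := by omega
        have h1 : ‖x‖ ^ (e + 1) ≤ 3 ^ l * (1 + ‖y‖) ^ (e + 1) := by
          calc ‖x‖ ^ (e + 1) ≤ (3 * (1 + ‖y‖)) ^ (e + 1) := by gcongr
            _ = 3 ^ (e + 1) * (1 + ‖y‖) ^ (e + 1) := mul_pow _ _ _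
            _ ≤ _ := by
              gcongr
              · norm_num
              · omega
        have h2 : ‖y‖ ^ (i + b) ≤ (1 + ‖y‖) ^ (i + b) := by gcongr; linarith
        have h3 : (1 + ‖y‖) ^ (i + b) * (1 + ‖y‖) ^ (e + 1) ≤ (1 + ‖y‖) ^ (2 * l) := by
          rw [← pow_add]
          exact pow_le_pow_right₀ (by linarith) (by omega)
        calc ‖y‖ ^ (i + b) * (‖x‖ ^ (2 * q + (i + b)))⁻¹
            = ‖y‖ ^ (i + b) * ‖x‖ ^ (e + 1) * (‖x‖ ^ (2 * q + l))⁻¹ := by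
              conv_rhs => rw [he', ← add_assoc, pow_add ‖x‖ _ (e + 1)]
              field_simp
          _ ≤ (1 + ‖y‖) ^ (i + b) * (3 ^ l * (1 + ‖y‖) ^ (e + 1)) * (‖x‖ ^ (2 * q + l))⁻¹ := by
              gcongr
          _ = 3 ^ l * (((1 + ‖y‖) ^ (i + b) * (1 + ‖y‖) ^ (e + 1)) * (‖x‖ ^ (2 * q + l))⁻¹) := by
              ring
          _ ≤ 3 ^ l * X := by rw [hX]; gcongr
      · rw [abs_zero]; positivity
    have hk := rieszKernel_le_of_near (m := m) (q := q) h
    calc |rieszKernel q (x - y) - lowExpansion q c l x y|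
        ≤ |rieszKernel q (x - y)| + |lowExpansion q c l x y| := abs_sub _ _
      _ ≤ 2 ^ (2 * m + 1) * N + 3 ^ l * B * X := by
          rw [abs_of_nonneg (rieszKernel_nonneg _)]
          exact add_le_add hk hlow
      _ ≤ _ := by
          have : 0 ≤ (C₁ + 3 ^ l * B) * N := by positivity
          have : 0 ≤ (2 ^ (2 * m + 1) + C₁) * X := by positivity
          nlinarith
  · -- away from the diagonal the expansion converges
    set t : ℝ := (2 * ⟪x, y⟫ - ‖y‖ ^ 2) / ‖x‖ ^ 2 with ht
    have h1t : 1 - t = ‖x - y‖ ^ 2 / ‖x‖ ^ 2 := by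
      rw [norm_sub_sq_real, ht]; field_simp; ring
    have hfar : ‖x‖ ≤ 2 * ‖x - y‖ := by
      have := norm_le_norm_add_norm_sub' x y
      linarith
    have ht4 : 1 / 4 ≤ 1 - t := by
      rw [h1t, le_div_iff₀ (by positivity)]
      nlinarith
    have hkt : rieszKernel q (x - y) = (‖x‖ ^ (2 * q))⁻¹ * ((1 - t) ^ q)⁻¹ := by
      rw [h1t, rieszKernel, div_pow, ← pow_mul, ← pow_mul, inv_div]
      field_simp
    have hpow (i : ℕ) : (‖x‖ ^ (2 * q))⁻¹ * (c i * t ^ i)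
        = ∑ b ∈ Finset.range (i + 1), expansionTerm q c i b x y := by
      have : t ^ i = (‖x‖ ^ (2 * i))⁻¹ * ∑ b ∈ Finset.range (i + 1),
          i.choose b * (2 ^ (i - b) * (-1) ^ b * (⟪x, y⟫ ^ (i - b) * ‖y‖ ^ (2 * b))) := by
        rw [ht, div_pow, ← pow_mul, div_eq_inv_mul, sub_eq_add_neg, add_comm, add_pow]
        congr 1
        refine Finset.sum_congr rfl fun b _ => ?_
        rw [neg_pow, mul_pow, ← pow_mul]; ring
      rw [this, Finset.mul_sum, Finset.mul_sum, Finset.mul_sum]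
      refine Finset.sum_congr rfl fun b _ => ?_
      rw [expansionTerm, pow_add, mul_inv]; ring
    have htl : |t| ≤ (1 + ‖y‖) ^ 2 * ‖x‖⁻¹ := by
      have h1 : |2 * ⟪x, y⟫ - ‖y‖ ^ 2| ≤ (1 + ‖y‖) ^ 2 * ‖x‖ := by
        have h2 := abs_real_inner_le_norm x y
        have h3 : |2 * ⟪x, y⟫ - ‖y‖ ^ 2| ≤ 2 * |⟪x, y⟫| + ‖y‖ ^ 2 := by
          refine (abs_sub _ _).trans ?_
          rw [abs_mul, abs_two, abs_of_nonneg (sq_nonneg ‖y‖)]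
        have h4 : ‖y‖ ^ 2 ≤ ‖y‖ ^ 2 * ‖x‖ := le_mul_of_one_le_right (sq_nonneg _) hx
        nlinarith
      rw [ht, abs_div, abs_of_pos (by positivity : 0 < ‖x‖ ^ 2), div_le_iff₀ (by positivity)]
      calc _ ≤ _ := h1
        _ = _ := by field_simp
    have htay : |rieszKernel q (x - y) - ∑ i ∈ Finset.range l, ∑ b ∈ Finset.range (i + 1),
        expansionTerm q c i b x y| ≤ C₁ * X := by
      rw [← Finset.sum_congr rfl fun i _ => hpow i, ← Finset.mul_sum, hkt, ← mul_sub, abs_mul,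
        abs_of_nonneg (by positivity : 0 ≤ (‖x‖ ^ (2 * q))⁻¹)]
      calc _ ≤ (‖x‖ ^ (2 * q))⁻¹ * (C₁ * ((1 + ‖y‖) ^ 2 * ‖x‖⁻¹) ^ l) := by
            gcongr
            exact (hc t ht4).trans (by gcongr)
        _ = C₁ * X := by
            rw [hX, mul_pow, ← pow_mul, pow_add, mul_inv, inv_pow]; ring
    have hhigh : |∑ i ∈ Finset.range l, ∑ b ∈ Finset.range (i + 1),
        expansionTerm q c i b x y - lowExpansion q c l x y| ≤ B * X := by
      rw [lowExpansion, ← Finset.sum_sub_distrib, Finset.sum_mul]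
      refine (Finset.abs_sum_le_sum_abs _ _).trans (Finset.sum_le_sum fun i hi => ?_)
      rw [← Finset.sum_sub_distrib, Finset.sum_mul]
      refine (Finset.abs_sum_le_sum_abs _ _).trans (Finset.sum_le_sum fun b hb => ?_)
      split_ifs with hib
      · rw [sub_self, abs_zero]; positivity
      · rw [sub_zero]
        refine (abs_expansionTerm_le c (by grind) hx0).trans ?_
        have hi' := Finset.mem_range.1 hi
        have hb' := Finset.mem_range.1 hb
        gcongr
        rw [hX]
        gcongr
        · calc ‖y‖ ^ (i + b) ≤ (1 + ‖y‖) ^ (i + b) := by gcongr; linarith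
            _ ≤ _ := pow_le_pow_right₀ (by linarith) (by omega)
        · omega
    have h3 : (1 : ℝ) ≤ 3 ^ l := one_le_pow₀ (by norm_num)
    calc |rieszKernel q (x - y) - lowExpansion q c l x y|
        ≤ C₁ * X + B * X := (abs_sub_le _ _ _).trans (add_le_add htay hhigh)
      _ ≤ _ := by
          have : 0 ≤ (2 ^ (2 * m + 1) + C₁ + 3 ^ l * B) * N := by positivity
          have : 0 ≤ (2 ^ (2 * m + 1)) * X := by positivity
          have : B * X ≤ 3 ^ l * B * X := by
            rw [mul_assoc]
            exact le_mul_of_one_le_left (by positivity) h3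
          nlinarith

end

section

open scoped ENNReal RealInnerProductSpace

variable {n m q : ℕ}

/-! ### Moments and the decay of Riesz potentials -/

/-- The polynomial `|y|^{2a} y_{i(1)} ⋯ y_{i(c)}`, homogeneous of degree `2a + c`. -/
noncomputable def monomialFn (a : ℕ) {c : ℕ} (i : Fin c → Fin n) (y : Rn n) : ℝ :=
  ‖y‖ ^ (2 * a) * ∏ t, y (i t)

/-- All moments of `f` of degree `< l` vanish. The factors `|y|^{2a}` are redundant, but this is the
form in which moments occur in expansions of functions of `|x - y|`. -/
def VanishingMoments (l : ℕ) (f : Rn n → ℂ) : Prop :=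
  ∀ (a c : ℕ) (i : Fin c → Fin n), 2 * a + c < l → ∫ y, (monomialFn a i y : ℂ) * f y = 0

@[fun_prop]
theorem continuous_monomialFn (a : ℕ) {c : ℕ} (i : Fin c → Fin n) :
    Continuous (monomialFn a i) := by
  unfold monomialFn; fun_prop

theorem abs_monomialFn_le (a : ℕ) {c : ℕ} (i : Fin c → Fin n) (y : Rn n) :
    |monomialFn a i y| ≤ ‖y‖ ^ (2 * a + c) := by
  rw [monomialFn, abs_mul, abs_pow, abs_norm, pow_add, Finset.abs_prod]
  gcongr
  calc ∏ t, |y (i t)| ≤ ∏ _t : Fin c, ‖y‖ := by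
        gcongr with t
        exact PiLp.norm_apply_le y (i t)
    _ = ‖y‖ ^ c := by simp

/-- The expansion of `⟨x, y⟩^c |y|^{2b}` into monomials in `y`. -/
theorem inner_pow_mul_norm_pow (b c : ℕ) (x y : Rn n) :
    ⟪x, y⟫ ^ c * ‖y‖ ^ (2 * b)
      = ∑ i : Fin c → Fin n, (∏ t, x (i t)) * monomialFn b i y := by
  have : ⟪x, y⟫ = ∑ j, x j * y j := by
    simp [PiLp.inner_apply, mul_comm]
  rw [this, Fintype.sum_pow, Finset.sum_mul]
  refine Finset.sum_congr rfl fun i _ => ?_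
  rw [Finset.prod_mul_distrib, monomialFn]; ring

section Weighted

variable {f : Rn n → ℂ} {l : ℕ}

theorem integrable_of_le_weight {L : ℕ} (hfm : AEStronglyMeasurable f volume)
    (hf : Integrable (fun y => (1 + ‖y‖) ^ L * ‖f y‖)) {p : Rn n → ℝ} (hp : Continuous p) {B : ℝ}
    (hpB : ∀ y, |p y| ≤ B * (1 + ‖y‖) ^ L) : Integrable (fun y => (p y : ℂ) * f y) := by
  refine (hf.const_mul B).mono'
    ((Complex.continuous_ofReal.comp hp).aestronglyMeasurable.mul hfm) (.of_forall fun y => ?_)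
  rw [norm_mul, Complex.norm_real, Real.norm_eq_abs, ← mul_assoc]
  gcongr
  exact hpB y

theorem integrable_monomialFn_mul {L : ℕ} (hfm : AEStronglyMeasurable f volume)
    (hf : Integrable (fun y => (1 + ‖y‖) ^ L * ‖f y‖)) {a c : ℕ} (i : Fin c → Fin n)
    (hac : 2 * a + c ≤ L) : Integrable (fun y => (monomialFn a i y : ℂ) * f y) := by
  refine integrable_of_le_weight hfm hf (continuous_monomialFn a i) (B := 1) fun y => ?_
  rw [one_mul]
  calc _ ≤ _ := abs_monomialFn_le a i y
    _ ≤ (1 + ‖y‖) ^ (2 * a + c) := by gcongr; linarith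
    _ ≤ _ := pow_le_pow_right₀ (by linarith [norm_nonneg y]) hac

/-- The terms of degree `< l` in `y` of the expansion at infinity only see moments of degree `< l`. -/
theorem VanishingMoments.integral_lowExpansion_mul (hl : VanishingMoments l f) {L : ℕ} (hL : l ≤ L)
    (hfm : AEStronglyMeasurable f volume)
    (hf : Integrable (fun y => (1 + ‖y‖) ^ L * ‖f y‖)) (c : ℕ → ℝ) (x : Rn n) :
    Integrable (fun y => (lowExpansion q c l x y : ℂ) * f y) ∧
      ∫ y, (lowExpansion q c l x y : ℂ) * f y = 0 := by
  have hterm (i b : ℕ) (hb : b ≤ i) (hib : i + b < l) :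
      Integrable (fun y => (expansionTerm q c i b x y : ℂ) * f y) ∧
        ∫ y, (expansionTerm q c i b x y : ℂ) * f y = 0 := by
    have heq (y : Rn n) : (expansionTerm q c i b x y : ℂ) * f y
        = ∑ s : Fin (i - b) → Fin n,
          ((c i * i.choose b * 2 ^ (i - b) * (-1) ^ b * (‖x‖ ^ (2 * q + 2 * i))⁻¹ *
            ∏ t, x (s t) : ℝ) : ℂ) * ((monomialFn b s y : ℂ) * f y) := by
      rw [expansionTerm, inner_pow_mul_norm_pow, Finset.mul_sum, Complex.ofReal_sum,
        Finset.sum_mul]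
      refine Finset.sum_congr rfl fun s _ => ?_
      push_cast; ring
    have hint (s : Fin (i - b) → Fin n) := integrable_monomialFn_mul hfm hf (a := b) s (by omega)
    simp_rw [heq]
    refine ⟨integrable_finsetSum _ fun s _ => (hint s).const_mul _, ?_⟩
    rw [integral_finsetSum _ fun s _ => (hint s).const_mul _]
    refine Finset.sum_eq_zero fun s _ => ?_
    rw [integral_const_mul, hl b _ s (by omega), mul_zero]
  have hterm' (i b : ℕ) (hb : b ≤ i) :
      Integrable (fun y => ((if i + b < l then expansionTerm q c i b x y else 0 : ℝ) : ℂ) * f y) ∧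
        ∫ y, ((if i + b < l then expansionTerm q c i b x y else 0 : ℝ) : ℂ) * f y = 0 := by
    split_ifs with h
    · exact hterm i b hb h
    · simp
  unfold lowExpansion
  simp_rw [Complex.ofReal_sum, Finset.sum_mul]
  have hint : ∀ i ∈ Finset.range l, Integrable (fun y => ∑ b ∈ Finset.range (i + 1),
      ((if i + b < l then expansionTerm q c i b x y else 0 : ℝ) : ℂ) * f y) :=
    fun i _ => integrable_finsetSum _ fun b hb => (hterm' i b (by grind)).1
  refine ⟨integrable_finsetSum _ hint, ?_⟩
  rw [integral_finsetSum _ hint]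
  refine Finset.sum_eq_zero fun i _ => ?_
  rw [integral_finsetSum _ fun b hb => (hterm' i b (by grind)).1]
  exact Finset.sum_eq_zero fun b hb => (hterm' i b (by grind)).2

/-- The potential `∫ |x - y|^{-2q} f(y) dy`. -/
noncomputable def rieszPotential (q : ℕ) (f : Rn n → ℂ) (x : Rn n) : ℂ :=
  ∫ y, (rieszKernel q (x - y) : ℂ) * f y

theorem measurable_rieszKernel_sub :
    Measurable (fun p : Rn n × Rn n => rieszKernel q (p.1 - p.2)) := by
  fun_prop

theorem l2BoundedKernel_truncatedKernel :
    L2BoundedKernel (fun x y : Rn n => ‖truncatedKernel m q (x - y)‖ₑ)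
      ((∫⁻ z : Rn n, ‖truncatedKernel m q z‖ₑ) ^ 2) :=
  L2BoundedKernel.convolution (g := fun z => ‖truncatedKernel m q z‖ₑ)
    (by fun_prop)

/-- If the moments of `f` of degree `< l` vanish, then the Riesz potential of `f` decays like
`|x|^{-2q-l}`, up to a square integrable function. -/
theorem VanishingMoments.rieszPotential_bound (hl : VanishingMoments l f) (hm : 1 ≤ m)
    (hn : n = 2 * m + 2 * q) (hfm : AEStronglyMeasurable f volume)
    (hf : Integrable (fun y => (1 + ‖y‖) ^ (2 * l) * ‖f y‖))
    (hf2 : MemLp (fun y => (1 + ‖y‖) ^ (2 * m + 1) * ‖f y‖) 2 volume) :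
    ∃ (F : Rn n → ℝ) (C : ℝ), MemLp F 2 volume ∧ ∀ᵐ x,
      Integrable (fun y => (rieszKernel q (x - y) : ℂ) * f y) ∧
        ‖rieszPotential q f x‖ ≤ F x + C * ((1 + ‖x‖) ^ (2 * q + l))⁻¹ := by
  obtain ⟨c, C, hC, hexp⟩ := exists_rieszKernel_expansion (n := n) m q l
  set h : Rn n → ℂ := fun y => (((1 + ‖y‖) ^ (2 * m + 1) * ‖f y‖ : ℝ) : ℂ) with hh
  have hh2 : MemLp h 2 volume := hf2.ofReal
  have hA : (∫⁻ z : Rn n, ‖truncatedKernel m q z‖ₑ) ^ 2 ≠ ⊤ :=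
    ENNReal.pow_ne_top (integrable_truncatedKernel hm hn).2.ne
  have hKm : AEStronglyMeasurable (Function.uncurry fun x y : Rn n => truncatedKernel m q (x - y))
      (volume.prod volume) := by
    have : Measurable (fun p : Rn n × Rn n => truncatedKernel m q (p.1 - p.2)) := by fun_prop
    exact this.aestronglyMeasurable
  have hbd := l2BoundedKernel_truncatedKernel (n := n) (m := m) (q := q)
  have hF : MemLp (fun x => ∫ y, (truncatedKernel m q (x - y) : ℂ) * h y) 2 volume :=
    ⟨(aestronglyMeasurable_kernel_mul hKm hh2.1).integral_prod_right',
      (hbd.eLpNorm_integral_le hh2).trans_lt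
        (ENNReal.mul_lt_top (ENNReal.rpow_lt_top_of_nonneg (by norm_num) hA) hh2.2)⟩
  have hf0 : Integrable (fun y => ‖f y‖) := by
    refine hf.mono' hfm.norm (.of_forall fun y => ?_)
    rw [norm_norm]
    exact le_mul_of_one_le_left (norm_nonneg _)
      (one_le_pow₀ (by linarith [norm_nonneg y]))
  set M : ℝ := ∫ y, (1 + ‖y‖) ^ (2 * l) * ‖f y‖ with hM
  have hM0 : 0 ≤ M := integral_nonneg fun y => by positivity
  have hfM : ∫ y, ‖f y‖ ≤ M := by
    refine integral_mono hf0 hf fun y => ?_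
    exact le_mul_of_one_le_left (norm_nonneg _)
      (one_le_pow₀ (by linarith [norm_nonneg y]))
  refine ⟨fun x => (C + 2 ^ (2 * m + 1)) * ‖∫ y, (truncatedKernel m q (x - y) : ℂ) * h y‖,
    (C + 1) * M * 2 ^ (2 * q + l), hF.norm.const_mul _, ?_⟩
  filter_upwards [hbd.ae_integrable hKm hA hh2] with x hx
  -- the contribution of the truncated kernel, in real-valued form
  have hT : Integrable (fun y => truncatedKernel m q (x - y) * (1 + ‖y‖) ^ (2 * m + 1) * ‖f y‖) := by
    refine hx.norm.congr (.of_forall fun y => ?_)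
    simp only [hh, norm_mul, Complex.norm_real, Real.norm_eq_abs]
    rw [abs_of_nonneg (truncatedKernel_nonneg _), abs_of_nonneg (by positivity), mul_assoc, abs_norm]
  have hTint : ∫ y, truncatedKernel m q (x - y) * (1 + ‖y‖) ^ (2 * m + 1) * ‖f y‖
      = ‖∫ y, (truncatedKernel m q (x - y) : ℂ) * h y‖ := by
    have : ∫ y, (truncatedKernel m q (x - y) : ℂ) * h y = ((∫ y, truncatedKernel m q (x - y)
        * (1 + ‖y‖) ^ (2 * m + 1) * ‖f y‖ : ℝ) : ℂ) := by
      rw [← integral_complex_ofReal]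
      refine integral_congr_ae (.of_forall fun y => ?_)
      simp only [hh]; push_cast; ring
    rw [this, Complex.norm_real, Real.norm_of_nonneg]
    refine integral_nonneg fun y => ?_
    have := truncatedKernel_nonneg (m := m) (q := q) (x - y)
    positivity
  have hKf : AEStronglyMeasurable (fun y => (rieszKernel q (x - y) : ℂ) * f y) volume := by
    have : Measurable (fun y : Rn n => rieszKernel q (x - y)) := by fun_prop
    exact (Complex.continuous_ofReal.measurable.comp this).aestronglyMeasurable.mul hfm
  have hK1 (y : Rn n) : ‖(rieszKernel q (x - y) : ℂ) * f y‖ ≤ 2 ^ (2 * m + 1) *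
      (truncatedKernel m q (x - y) * (1 + ‖y‖) ^ (2 * m + 1) * ‖f y‖) + ‖f y‖ := by
    rw [norm_mul, Complex.norm_real, Real.norm_of_nonneg (rieszKernel_nonneg _)]
    calc _ ≤ (2 ^ (2 * m + 1) * (truncatedKernel m q (x - y) * (1 + ‖y‖) ^ (2 * m + 1)) + 1)
          * ‖f y‖ := by gcongr; exact rieszKernel_le x y
      _ = _ := by ring
  have hint : Integrable (fun y => (rieszKernel q (x - y) : ℂ) * f y) :=
    ((hT.const_mul _).add hf0).mono' hKf (.of_forall hK1)
  refine ⟨hint, ?_⟩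
  rw [← hTint]
  set I : ℝ := ∫ y, truncatedKernel m q (x - y) * (1 + ‖y‖) ^ (2 * m + 1) * ‖f y‖ with hI
  have hI0 : 0 ≤ I := by rw [hTint]; positivity
  clear_value I M
  rcases le_total 1 ‖x‖ with h1 | h1
  · have hlow := hl.integral_lowExpansion_mul (q := q) (L := 2 * l) (by omega) hfm hf c x
    have heq : rieszPotential q f x
        = ∫ y, ((rieszKernel q (x - y) : ℂ) * f y - (lowExpansion q c l x y : ℂ) * f y) := by
      rw [integral_sub hint hlow.1, hlow.2, sub_zero, rieszPotential]
    have hpt (y : Rn n) : ‖(rieszKernel q (x - y) : ℂ) * f y - (lowExpansion q c l x y : ℂ) * f y‖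
        ≤ C * (truncatedKernel m q (x - y) * (1 + ‖y‖) ^ (2 * m + 1) * ‖f y‖)
          + C * (‖x‖ ^ (2 * q + l))⁻¹ * ((1 + ‖y‖) ^ (2 * l) * ‖f y‖) := by
      rw [← sub_mul, norm_mul, ← Complex.ofReal_sub, Complex.norm_real, Real.norm_eq_abs]
      calc _ ≤ _ := mul_le_mul_of_nonneg_right (hexp x y h1) (norm_nonneg _)
        _ = _ := by ring
    have hle : ‖rieszPotential q f x‖ ≤ C * I + C * (‖x‖ ^ (2 * q + l))⁻¹ * M := by
      rw [heq]
      refine (norm_integral_le_of_norm_le ((hT.const_mul C).add (hf.const_mul _))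
        (.of_forall hpt)).trans_eq ?_
      simp only [Pi.add_apply]
      rw [integral_add (hT.const_mul C) (hf.const_mul _), integral_const_mul, integral_const_mul,
        hI, hM]
    have hx2 : (‖x‖ ^ (2 * q + l))⁻¹ ≤ 2 ^ (2 * q + l) * ((1 + ‖x‖) ^ (2 * q + l))⁻¹ := by
      rw [← inv_inv (2 ^ (2 * q + l) : ℝ), ← mul_inv]
      gcongr
      rw [inv_mul_le_iff₀ (by positivity), ← mul_pow]
      gcongr
      linarith
    have hx3 := mul_le_mul_of_nonneg_left hx2 (mul_nonneg hC hM0)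
    have a1 : 0 ≤ 2 ^ (2 * m + 1) * I := by positivity
    have a2 : 0 ≤ M * 2 ^ (2 * q + l) * ((1 + ‖x‖) ^ (2 * q + l))⁻¹ := by positivity
    linarith
  · have hle : ‖rieszPotential q f x‖ ≤ 2 ^ (2 * m + 1) * I + ∫ y, ‖f y‖ := by
      refine (norm_integral_le_of_norm_le ((hT.const_mul _).add hf0) (.of_forall hK1)).trans_eq ?_
      simp only [Pi.add_apply]
      rw [integral_add (hT.const_mul _) hf0, integral_const_mul, hI]
    have hx2 : 1 ≤ 2 ^ (2 * q + l) * ((1 + ‖x‖) ^ (2 * q + l))⁻¹ := by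
      rw [← div_eq_mul_inv, one_le_div (by positivity)]
      gcongr
      linarith
    have a1 : 0 ≤ C * I := by positivity
    have a2 : 0 ≤ C * M * 2 ^ (2 * q + l) * ((1 + ‖x‖) ^ (2 * q + l))⁻¹ := by positivity
    have a3 : M ≤ M * (2 ^ (2 * q + l) * ((1 + ‖x‖) ^ (2 * q + l))⁻¹) :=
      le_mul_of_one_le_right hM0 hx2
    linarith

end Weighted

end

section

open scoped ENNReal RealInnerProductSpace FourierTransform SchwartzMap Laplacian

variable {n m q : ℕ}

/-! ### The fundamental solution of `(-Δ)^m` -/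

theorem negLaplacianPow_succ (m : ℕ) (f : Rn n → ℂ) :
    negLaplacianPow (m + 1) f = fun x => -(Δ (negLaplacianPow m f)) x := by
  unfold negLaplacianPow
  rw [Function.iterate_succ_apply']
  rfl

/-- On Schwartz functions, `(-Δ)^m` is the Fourier multiplier `(2π|ξ|)^{2m}`. -/
theorem exists_schwartz_negLaplacianPow (m : ℕ) (f : 𝓢(Rn n, ℂ)) :
    ∃ g : 𝓢(Rn n, ℂ), (∀ x, g x = negLaplacianPow m f x) ∧
      ∀ ξ, 𝓕 g ξ = (((2 * Real.pi * ‖ξ‖) ^ 2) ^ m : ℝ) * 𝓕 f ξ := by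
  induction m with
  | zero => exact ⟨f, fun x => rfl, fun ξ => by simp⟩
  | succ m ih =>
    obtain ⟨g, hg, hgF⟩ := ih
    refine ⟨-Δ g, fun x => ?_, fun ξ => ?_⟩
    · have : (g : Rn n → ℂ) = negLaplacianPow m f := funext hg
      rw [negLaplacianPow_succ, ← this, neg_apply, SchwartzMap.laplacian_apply]
    · have h : 𝓕 (-Δ g) = (2 * Real.pi) ^ 2 •
          SchwartzMap.smulLeftCLM ℂ (fun x : Rn n => ‖x‖ ^ 2) (𝓕 g) := by
        rw [SchwartzMap.laplacian_eq_fourierMultiplierCLM,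
          SchwartzMap.fourierMultiplierCLM_apply, ← neg_smul, neg_neg,
          FourierTransform.fourier_smul, FourierTransform.fourier_fourierInv_eq]
      rw [h, smul_apply, SchwartzMap.smulLeftCLM_apply_apply (by fun_prop), hgF]
      simp only [Complex.real_smul, pow_succ, mul_pow]
      push_cast; ring

/-- `r^{-q}` as a superposition of the exponentials `e^{-rl}`. -/
theorem integral_pow_mul_exp_neg_mul {q : ℕ} (hq : 1 ≤ q) {r : ℝ} (hr : 0 < r) :
    ∫ l in Set.Ioi (0 : ℝ), l ^ (q - 1) * Real.exp (-(r * l)) = (r ^ q)⁻¹ * Real.Gamma q := by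
  have h := Real.integral_rpow_mul_exp_neg_mul_Ioi (a := q) (by positivity) hr
  rw [one_div, Real.rpow_natCast, inv_pow] at h
  rw [← h]
  refine setIntegral_congr_fun measurableSet_Ioi fun l hl => ?_
  have h1 : (q : ℝ) - 1 = ((q - 1 : ℕ) : ℝ) := by rw [Nat.cast_sub hq, Nat.cast_one]
  simp only [h1, Real.rpow_natCast]

/-- `r^{-m}` as a superposition of the exponentials `e^{-r/l}`, by the substitution `l ↦ 1/l`. -/
theorem integral_inv_pow_mul_exp_neg_div {m : ℕ} (hm : 1 ≤ m) {r : ℝ} (hr : 0 < r) :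
    ∫ l in Set.Ioi (0 : ℝ), (l ^ (m + 1))⁻¹ * Real.exp (-(r / l)) = (r ^ m)⁻¹ * Real.Gamma m := by
  rw [← integral_pow_mul_exp_neg_mul hm hr, ← integral_comp_rpow_Ioi
    (fun l => l ^ (m - 1) * Real.exp (-(r * l))) (p := -1) (by norm_num)]
  refine setIntegral_congr_fun measurableSet_Ioi fun l hl => ?_
  have hl : 0 < l := hl
  have h2 : l ^ ((-1 : ℝ) - 1) = (l ^ 2)⁻¹ := by
    rw [show (-1 : ℝ) - 1 = -((2 : ℕ) : ℝ) by norm_num, Real.rpow_neg hl.le, Real.rpow_natCast]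
  simp only [abs_neg, abs_one, one_mul, smul_eq_mul, Real.rpow_neg_one, h2]
  rw [show m + 1 = 2 + (m - 1) by omega, pow_add, mul_inv, inv_pow, div_eq_mul_inv]
  ring

theorem integrable_of_integral_pos {α : Type*} [MeasurableSpace α] {μ : Measure α} {f : α → ℝ}
    (h : 0 < ∫ x, f x ∂μ) : Integrable f μ := by
  by_contra hc
  rw [integral_undef hc] at h
  exact lt_irrefl _ h

/-- Parseval's identity for `g` and a translated Gaussian. -/
theorem integral_gaussian_mul (hn : n = 2 * m + 2 * q) (g : 𝓢(Rn n, ℂ)) (x : Rn n) {l : ℝ}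
    (hl : 0 < l) :
    ∫ y, (Real.exp (-(‖x - y‖ ^ 2 * l)) : ℂ) * g y
      = ((Real.pi / l) ^ (m + q) : ℝ) * ∫ v, (Real.exp (-(Real.pi ^ 2 * ‖v‖ ^ 2 / l)) : ℂ) *
        (Complex.exp (2 * Real.pi * Complex.I * ⟪x, v⟫) * 𝓕 g v) := by
  have hpi := Real.pi_pos
  have hb : 0 < (((Real.pi ^ 2 / l : ℝ)) : ℂ).re := by
    rw [Complex.ofReal_re]; positivity
  have hint := GaussianFourier.integrable_cexp_neg_mul_sq_norm_add (V := Rn n) hb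
    (2 * Real.pi * Complex.I) x
  have hF := fun w => fourier_gaussian_innerProductSpace' (V := Rn n) hb x w
  have key : ∫ w, 𝓕 (fun v : Rn n => Complex.exp (-((Real.pi ^ 2 / l : ℝ) : ℂ) * ‖v‖ ^ 2
      + 2 * Real.pi * Complex.I * ⟪x, v⟫)) w • g w
      = ∫ v, Complex.exp (-((Real.pi ^ 2 / l : ℝ) : ℂ) * ‖v‖ ^ 2
      + 2 * Real.pi * Complex.I * ⟪x, v⟫) • 𝓕 (g : Rn n → ℂ) v := by
    simpa using! (VectorFourier.integral_fourierIntegral_smul_eq_flip (L := innerₗ (Rn n))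
      Real.continuous_fourierChar continuous_inner hint g.integrable)
  have hdim : ((Module.finrank ℝ (Rn n) : ℂ) / 2) = ((m + q : ℕ) : ℂ) := by
    rw [finrank_euclideanSpace_fin, hn]; push_cast; ring
  have hF' (w : Rn n) : 𝓕 (fun v : Rn n => Complex.exp (-((Real.pi ^ 2 / l : ℝ) : ℂ) * ‖v‖ ^ 2
      + 2 * Real.pi * Complex.I * ⟪x, v⟫)) w
      = ((l / Real.pi) ^ (m + q) : ℝ) * (Real.exp (-(‖x - w‖ ^ 2 * l)) : ℂ) := by
    rw [hF w, hdim, Complex.cpow_natCast, Complex.ofReal_exp]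
    congr 1
    · push_cast; congr 1; field_simp
    · congr 1; push_cast; field_simp
  have hv (v : Rn n) : Complex.exp (-((Real.pi ^ 2 / l : ℝ) : ℂ) * ‖v‖ ^ 2
      + 2 * Real.pi * Complex.I * ⟪x, v⟫) • 𝓕 (g : Rn n → ℂ) v
      = (Real.exp (-(Real.pi ^ 2 * ‖v‖ ^ 2 / l)) : ℂ) *
        (Complex.exp (2 * Real.pi * Complex.I * ⟪x, v⟫) * 𝓕 g v) := by
    rw [SchwartzMap.fourier_coe, Complex.exp_add, smul_eq_mul, mul_assoc, Complex.ofReal_exp]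
    congr 2
    push_cast; ring
  have hw (w : Rn n) : 𝓕 (fun v : Rn n => Complex.exp (-((Real.pi ^ 2 / l : ℝ) : ℂ) * ‖v‖ ^ 2
      + 2 * Real.pi * Complex.I * ⟪x, v⟫)) w • g w
      = ((l / Real.pi) ^ (m + q) : ℝ) * ((Real.exp (-(‖x - w‖ ^ 2 * l)) : ℂ) * g w) := by
    rw [hF', smul_eq_mul, mul_assoc]
  simp_rw [hw, hv] at key
  rw [integral_const_mul] at key
  rw [← key, ← mul_assoc, ← Complex.ofReal_mul, ← mul_pow]
  have h1 : Real.pi / l * (l / Real.pi) = 1 := by field_simp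
  rw [h1, one_pow, Complex.ofReal_one, one_mul]

/-- `d₀ |x|^{-2q}`, with `n = 2m + 2q`, is a fundamental solution of `(-Δ)^m`. The kernel `|x|^{-2q}`
is a superposition of the Gaussians `e^{-l|x|²}`; after Parseval's identity, the Gaussians
`e^{-π²|ξ|²/l}` add up to a multiple of `|ξ|^{-2m}`, which cancels the symbol of `(-Δ)^m`. -/
theorem rieszConst_mul_integral_negLaplacianPow (hm : 1 ≤ m) (hq : 1 ≤ q) (hn : n = 2 * m + 2 * q)
    {χ : Rn n → ℂ} (hχ : ContDiff ℝ ∞ χ) (hχc : HasCompactSupport χ) (x : Rn n) :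
    rieszConst n m * ∫ y, (rieszKernel q (x - y) : ℂ) * negLaplacianPow m χ y = χ x := by
  have hpi := Real.pi_pos
  have hΓq : 0 < Real.Gamma q := Real.Gamma_pos_of_pos (by positivity)
  have hΓm : 0 < Real.Gamma m := Real.Gamma_pos_of_pos (by positivity)
  have : Nontrivial (Rn n) := by
    have : Nonempty (Fin n) := ⟨⟨0, by omega⟩⟩
    infer_instance
  set f : 𝓢(Rn n, ℂ) := hχc.toSchwartzMap hχ with hf
  obtain ⟨g, hg, hgF⟩ := exists_schwartz_negLaplacianPow m f
  set μ₀ : Measure ℝ := volume.restrict (Set.Ioi 0) with hμ₀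
  have hpos : ∀ᵐ l ∂μ₀, 0 < l := ae_restrict_mem measurableSet_Ioi
  -- the kernel as a superposition of Gaussians
  have hker (y : Rn n) (hy : x - y ≠ 0) : ∫ l, l ^ (q - 1) * Real.exp (-(‖x - y‖ ^ 2 * l)) ∂μ₀
      = rieszKernel q (x - y) * Real.Gamma q := by
    have := norm_pos_iff.2 hy
    rw [hμ₀, integral_pow_mul_exp_neg_mul hq (by positivity), rieszKernel, pow_mul]
  have hne : ∀ᵐ y : Rn n, x - y ≠ 0 := by
    filter_upwards [Measure.ae_ne volume x] with y hy
    exact sub_ne_zero.2 hy.symm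
  have hrg : Integrable (fun y => (rieszKernel q (x - y) : ℂ) * g y) := by
    obtain ⟨C, hC⟩ : ∃ C, ∀ y, (1 + ‖y‖) ^ (2 * m + 1) * ‖g y‖ ≤ C := by
      refine ⟨2 ^ (2 * m + 1) * (Finset.Iic (2 * m + 1, 0)).sup
        (fun p => SchwartzMap.seminorm ℝ p.1 p.2) g, fun y => ?_⟩
      have := SchwartzMap.one_add_le_sup_seminorm_apply (𝕜 := ℝ) (m := (2 * m + 1, 0)) le_rfl
        le_rfl g y
      rwa [norm_iteratedFDeriv_zero] at this
    have hT : Integrable (fun y => truncatedKernel m q (x - y)) :=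
      (integrable_truncatedKernel hm hn).comp_sub_left x
    have hm1 : Measurable (fun y : Rn n => rieszKernel q (x - y)) := by fun_prop
    refine ((hT.const_mul (2 ^ (2 * m + 1) * C)).add g.integrable.norm).mono'
      ((Complex.continuous_ofReal.measurable.comp hm1).aestronglyMeasurable.mul
        g.continuous.aestronglyMeasurable) (.of_forall fun y => ?_)
    rw [norm_mul, Complex.norm_real, Real.norm_of_nonneg (rieszKernel_nonneg _)]
    calc _ ≤ (2 ^ (2 * m + 1) * (truncatedKernel m q (x - y) * (1 + ‖y‖) ^ (2 * m + 1)) + 1)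
          * ‖g y‖ := by gcongr; exact rieszKernel_le x y
      _ = 2 ^ (2 * m + 1) * truncatedKernel m q (x - y) * ((1 + ‖y‖) ^ (2 * m + 1) * ‖g y‖)
          + ‖g y‖ := by ring
      _ ≤ 2 ^ (2 * m + 1) * truncatedKernel m q (x - y) * C + ‖g y‖ := by
          gcongr
          · exact mul_nonneg (by positivity) (truncatedKernel_nonneg _)
          · exact hC y
      _ = _ := by simp only [Pi.add_apply]; ring
  have hfub1 : Integrable (fun p : Rn n × ℝ => ((p.2 ^ (q - 1) *
      Real.exp (-(‖x - p.1‖ ^ 2 * p.2)) : ℝ) : ℂ) * g p.1) (volume.prod μ₀) := by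
    rw [integrable_prod_iff (by
      refine Continuous.aestronglyMeasurable ?_
      have := g.continuous
      fun_prop)]
    refine ⟨?_, ?_⟩
    · filter_upwards [hne] with y hy
      have h1 : Integrable (fun l => l ^ (q - 1) * Real.exp (-(‖x - y‖ ^ 2 * l))) μ₀ := by
        apply integrable_of_integral_pos
        rw [hker y hy]
        have := norm_pos_iff.2 hy
        unfold rieszKernel; positivity
      exact h1.ofReal.mul_const _
    · refine (hrg.norm.const_mul (Real.Gamma q)).congr ?_
      filter_upwards [hne] with y hy
      have h1 : ∀ᵐ l ∂μ₀, ‖((l ^ (q - 1) * Real.exp (-(‖x - y‖ ^ 2 * l)) : ℝ) : ℂ) * g y‖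
          = l ^ (q - 1) * Real.exp (-(‖x - y‖ ^ 2 * l)) * ‖g y‖ := by
        filter_upwards [hpos] with l hl
        rw [norm_mul, Complex.norm_real, Real.norm_of_nonneg (by positivity)]
      rw [integral_congr_ae h1, integral_mul_const, hker y hy, norm_mul, Complex.norm_real,
        Real.norm_of_nonneg (rieszKernel_nonneg _)]
      ring
  -- the Fourier multiplier as a superposition of Gaussians
  have hmul (v : Rn n) (hv : v ≠ 0) :
      ∫ l, (l ^ (m + 1))⁻¹ * Real.exp (-(Real.pi ^ 2 * ‖v‖ ^ 2 / l)) ∂μ₀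
        = ((Real.pi ^ 2 * ‖v‖ ^ 2) ^ m)⁻¹ * Real.Gamma m := by
    have := norm_pos_iff.2 hv
    exact integral_inv_pow_mul_exp_neg_div hm (by positivity)
  have hne0 : ∀ᵐ v : Rn n, v ≠ 0 := Measure.ae_ne volume 0
  have hcancel (v : Rn n) (hv : v ≠ 0) :
      ((Real.pi ^ 2 * ‖v‖ ^ 2) ^ m)⁻¹ * ((2 * Real.pi * ‖v‖) ^ 2) ^ m = 4 ^ m := by
    have := norm_pos_iff.2 hv
    rw [inv_mul_eq_div, ← div_pow]
    congr 1
    field_simp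
    norm_num
  have hexp (v : Rn n) : ‖Complex.exp (2 * Real.pi * Complex.I * ⟪x, v⟫)‖ = 1 := by
    rw [show (2 * Real.pi * Complex.I * (⟪x, v⟫ : ℂ)) = ((2 * Real.pi * ⟪x, v⟫ : ℝ) : ℂ) * Complex.I
      by push_cast; ring]
    exact Complex.norm_exp_ofReal_mul_I _
  have hfub2 : Integrable (fun p : Rn n × ℝ => (((p.2 ^ (m + 1))⁻¹ *
      Real.exp (-(Real.pi ^ 2 * ‖p.1‖ ^ 2 / p.2)) : ℝ) : ℂ) *
        (Complex.exp (2 * Real.pi * Complex.I * ⟪x, p.1⟫) * 𝓕 g p.1)) (volume.prod μ₀) := by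
    rw [integrable_prod_iff (by
      have := (𝓕 g).continuous
      have h1 : Measurable (fun p : Rn n × ℝ => (((p.2 ^ (m + 1))⁻¹ *
        Real.exp (-(Real.pi ^ 2 * ‖p.1‖ ^ 2 / p.2)) : ℝ) : ℂ)) := by fun_prop
      have h2 : Continuous (fun p : Rn n × ℝ =>
        Complex.exp (2 * Real.pi * Complex.I * ⟪x, p.1⟫) * 𝓕 g p.1) := by fun_prop
      exact h1.aestronglyMeasurable.mul h2.aestronglyMeasurable)]
    refine ⟨?_, ?_⟩
    · filter_upwards [hne0] with v hv
      have h1 : Integrable (fun l => (l ^ (m + 1))⁻¹ *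
          Real.exp (-(Real.pi ^ 2 * ‖v‖ ^ 2 / l))) μ₀ := by
        apply integrable_of_integral_pos
        rw [hmul v hv]
        have := norm_pos_iff.2 hv
        positivity
      exact h1.ofReal.mul_const _
    · refine ((𝓕 f).integrable.norm.const_mul (Real.Gamma m * 4 ^ m)).congr ?_
      filter_upwards [hne0] with v hv
      have h1 : ∀ᵐ l ∂μ₀, ‖(((l ^ (m + 1))⁻¹ * Real.exp (-(Real.pi ^ 2 * ‖v‖ ^ 2 / l)) : ℝ) : ℂ) *
          (Complex.exp (2 * Real.pi * Complex.I * ⟪x, v⟫) * 𝓕 g v)‖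
          = (l ^ (m + 1))⁻¹ * Real.exp (-(Real.pi ^ 2 * ‖v‖ ^ 2 / l)) * ‖𝓕 g v‖ := by
        filter_upwards [hpos] with l hl
        rw [norm_mul, norm_mul, hexp, one_mul, Complex.norm_real,
          Real.norm_of_nonneg (by positivity)]
      rw [integral_congr_ae h1, integral_mul_const, hmul v hv, hgF, norm_mul, Complex.norm_real,
        Real.norm_of_nonneg (by positivity), ← hcancel v hv]
      ring
  have hinv : ∫ v, Complex.exp (2 * Real.pi * Complex.I * ⟪x, v⟫) * 𝓕 f v = χ x := by
    have h1 : 𝓕⁻ (𝓕 f) x = f x := by rw [FourierTransform.fourierInv_fourier_eq]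
    rw [SchwartzMap.fourierInv_coe, Real.fourierInv_eq'] at h1
    refine Eq.trans (integral_congr_ae (.of_forall fun v => ?_)) h1
    simp only [smul_eq_mul]
    rw [real_inner_comm x v]
    congr 2
    push_cast; ring
  have hmain : (Real.Gamma q : ℂ) * ∫ y, (rieszKernel q (x - y) : ℂ) * g y
      = (Real.pi ^ (m + q) * Real.Gamma m * 4 ^ m : ℝ) * χ x := by
    calc (Real.Gamma q : ℂ) * ∫ y, (rieszKernel q (x - y) : ℂ) * g y
        = ∫ y : Rn n, ∫ l : ℝ, ((l ^ (q - 1) * Real.exp (-(‖x - y‖ ^ 2 * l)) : ℝ) : ℂ) * g y ∂μ₀ := by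
          rw [← integral_const_mul]
          refine integral_congr_ae ?_
          filter_upwards [hne] with y hy
          rw [integral_mul_const, integral_complex_ofReal, hker y hy]
          push_cast; ring
      _ = ∫ l : ℝ, (∫ y : Rn n,
          ((l ^ (q - 1) * Real.exp (-(‖x - y‖ ^ 2 * l)) : ℝ) : ℂ) * g y) ∂μ₀ :=
          integral_integral_swap hfub1
      _ = ∫ l : ℝ, (∫ v : Rn n, (Real.pi ^ (m + q) : ℝ) * ((((l ^ (m + 1))⁻¹ *
          Real.exp (-(Real.pi ^ 2 * ‖v‖ ^ 2 / l)) : ℝ) : ℂ) *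
          (Complex.exp (2 * Real.pi * Complex.I * ⟪x, v⟫) * 𝓕 g v))) ∂μ₀ := by
          refine integral_congr_ae ?_
          filter_upwards [hpos] with l hl
          have h1 (y : Rn n) : ((l ^ (q - 1) * Real.exp (-(‖x - y‖ ^ 2 * l)) : ℝ) : ℂ) * g y
              = ((l ^ (q - 1) : ℝ) : ℂ) * ((Real.exp (-(‖x - y‖ ^ 2 * l)) : ℂ) * g y) := by
            rw [Complex.ofReal_mul, mul_assoc]
          have h2 (v : Rn n) : (Real.pi ^ (m + q) : ℝ) * ((((l ^ (m + 1))⁻¹ *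
              Real.exp (-(Real.pi ^ 2 * ‖v‖ ^ 2 / l)) : ℝ) : ℂ) *
              (Complex.exp (2 * Real.pi * Complex.I * ⟪x, v⟫) * 𝓕 g v))
              = ((Real.pi ^ (m + q) * (l ^ (m + 1))⁻¹ : ℝ) : ℂ) *
                ((Real.exp (-(Real.pi ^ 2 * ‖v‖ ^ 2 / l)) : ℂ) *
                  (Complex.exp (2 * Real.pi * Complex.I * ⟪x, v⟫) * 𝓕 g v)) := by
            push_cast; ring
          rw [integral_congr_ae (.of_forall h1), integral_congr_ae (.of_forall h2),
            integral_const_mul, integral_gaussian_mul hn g x hl, integral_const_mul,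
            ← mul_assoc, ← Complex.ofReal_mul]
          congr 2
          rw [div_pow, show m + q = (q - 1) + (m + 1) by omega, pow_add l]
          field_simp
      _ = (Real.pi ^ (m + q) : ℝ) * ∫ v : Rn n, ∫ l : ℝ, (((l ^ (m + 1))⁻¹ *
          Real.exp (-(Real.pi ^ 2 * ‖v‖ ^ 2 / l)) : ℝ) : ℂ) *
          (Complex.exp (2 * Real.pi * Complex.I * ⟪x, v⟫) * 𝓕 g v) ∂μ₀ := by
          refine Eq.trans ?_ (congrArg _ (integral_integral_swap hfub2).symm)
          rw [← integral_const_mul]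
          exact integral_congr_ae (.of_forall fun l => integral_const_mul _ _)
      _ = (Real.pi ^ (m + q) : ℝ) * ∫ v, (Real.Gamma m * 4 ^ m : ℝ) *
          (Complex.exp (2 * Real.pi * Complex.I * ⟪x, v⟫) * 𝓕 f v) := by
          congr 1
          refine integral_congr_ae ?_
          filter_upwards [hne0] with v hv
          rw [integral_mul_const, integral_complex_ofReal, hmul v hv, hgF, ← hcancel v hv]
          push_cast; ring
      _ = _ := by
          rw [integral_const_mul, hinv]; push_cast; ring
  have hconst : rieszConst n m = Real.Gamma q / (Real.pi ^ (m + q) * Real.Gamma m * 4 ^ m) := by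
    have h1 : (n : ℝ) / 2 - m = q := by rw [hn]; push_cast; ring
    have h2 : (n : ℝ) / 2 = ((m + q : ℕ) : ℝ) := by rw [hn]; push_cast; ring
    rw [rieszConst, h1, h2, Real.rpow_natCast]
    ring
  simp_rw [hg] at hmain
  rw [hconst, Complex.ofReal_div, div_mul_eq_mul_div]
  change _ * ∫ y, (rieszKernel q (x - y) : ℂ) * negLaplacianPow m χ y = _ at hmain
  rw [hmain, mul_div_cancel_left₀]
  rw [Complex.ofReal_ne_zero]
  positivity

end

section

open scoped ENNReal RealInnerProductSpace SchwartzMap Laplacian Topology Convolution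

variable {n m q : ℕ}

/-! ### Calculus of `(-Δ)^m` -/

theorem laplacian_eq_sum_fderiv (f : Rn n → ℂ) (x : Rn n) :
    (Δ f) x = ∑ i, fderiv ℝ (fderiv ℝ f) x (EuclideanSpace.basisFun (Fin n) ℝ i)
      (EuclideanSpace.basisFun (Fin n) ℝ i) := by
  rw [InnerProductSpace.laplacian_eq_iteratedFDeriv_orthonormalBasis f
    (EuclideanSpace.basisFun (Fin n) ℝ)]
  simp [iteratedFDeriv_two_apply]

theorem contDiff_laplacian {f : Rn n → ℂ} (hf : ContDiff ℝ ∞ f) : ContDiff ℝ ∞ (Δ f) := by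
  have : Δ f = fun x => ∑ i, fderiv ℝ (fderiv ℝ f) x (EuclideanSpace.basisFun (Fin n) ℝ i)
      (EuclideanSpace.basisFun (Fin n) ℝ i) := funext (laplacian_eq_sum_fderiv f)
  rw [this]
  have h1 : ContDiff ℝ ∞ (fderiv ℝ f) := hf.fderiv_right (by simp)
  have h2 : ContDiff ℝ ∞ (fderiv ℝ (fderiv ℝ f)) := h1.fderiv_right (by simp)
  fun_prop

theorem contDiff_negLaplacianPow {f : Rn n → ℂ} (hf : ContDiff ℝ ∞ f) (m : ℕ) :
    ContDiff ℝ ∞ (negLaplacianPow m f) := by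
  induction m with
  | zero => exact hf
  | succ m ih =>
    rw [negLaplacianPow_succ]
    exact (contDiff_laplacian ih).neg

theorem negLaplacianPow_congr_nhds {f g : Rn n → ℂ} {x : Rn n} (h : f =ᶠ[𝓝 x] g) (m : ℕ) :
    negLaplacianPow m f =ᶠ[𝓝 x] negLaplacianPow m g := by
  induction m with
  | zero => exact h
  | succ m ih =>
    rw [negLaplacianPow_succ, negLaplacianPow_succ]
    filter_upwards [InnerProductSpace.laplacian_congr_nhds ih] with y hy
    rw [hy]

theorem negLaplacianPow_zero_fun (m : ℕ) : negLaplacianPow m (fun _ : Rn n => (0 : ℂ)) = 0 := by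
  induction m with
  | zero => rfl
  | succ m ih =>
    rw [negLaplacianPow_succ, ih]
    ext x
    have : (0 : Rn n → ℂ) = fun _ => 0 := rfl
    rw [this, InnerProductSpace.laplacian_const]
    simp

theorem negLaplacianPow_eq_zero {f : Rn n → ℂ} {x : Rn n} (h : x ∉ tsupport f) (m : ℕ) :
    negLaplacianPow m f x = 0 := by
  have := (negLaplacianPow_congr_nhds (notMem_tsupport_iff_eventuallyEq.1 h) m).self_of_nhds
  rw [this]
  exact congrFun (negLaplacianPow_zero_fun m) x

theorem hasCompactSupport_negLaplacianPow {f : Rn n → ℂ} (hf : HasCompactSupport f) (m : ℕ) :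
    HasCompactSupport (negLaplacianPow m f) :=
  HasCompactSupport.intro hf fun _ hx => negLaplacianPow_eq_zero hx m

theorem laplacian_const_smul (c : ℝ) (f : Rn n → ℂ) (x : Rn n) :
    (Δ (fun y => c • f y)) x = c • (Δ f) x := by
  have h1 : fderiv ℝ (fun y => c • f y) = fun y => c • fderiv ℝ f y :=
    fderiv_const_smul_field (f := f) c
  have h2 (x : Rn n) : fderiv ℝ (fun y => c • fderiv ℝ f y) x = c • fderiv ℝ (fderiv ℝ f) x :=
    congrFun (fderiv_const_smul_field (f := fderiv ℝ f) c) x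
  rw [laplacian_eq_sum_fderiv, laplacian_eq_sum_fderiv, h1, h2, Finset.smul_sum]
  rfl

theorem negLaplacianPow_const_smul (c : ℝ) (f : Rn n → ℂ) (m : ℕ) :
    negLaplacianPow m (fun y => c • f y) = fun y => c • negLaplacianPow m f y := by
  induction m with
  | zero => rfl
  | succ m ih =>
    ext x
    rw [negLaplacianPow_succ, negLaplacianPow_succ, ih]
    simp only
    rw [laplacian_const_smul, smul_neg]

theorem laplacian_comp_affine (f : Rn n → ℂ) (a : Rn n) (r : ℝ) (x : Rn n) :
    (Δ (fun y => f (a + r • y))) x = r ^ 2 • (Δ f) (a + r • x) := by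
  have h1 {F : Type} [NormedAddCommGroup F] [NormedSpace ℝ F] (f : Rn n → F) :
      fderiv ℝ (fun y => f (a + r • y)) = fun y => r • fderiv ℝ f (a + r • y) := by
    ext1 y
    have := fderiv_comp_smul (𝕜 := ℝ) (f := fun z => f (a + z)) (x := y) r
    rw [this, fderiv_comp_add_left]
  have h2 : fderiv ℝ (fun y => r • fderiv ℝ f (a + r • y)) x
      = r • fderiv ℝ (fun y => fderiv ℝ f (a + r • y)) x :=
    congrFun (fderiv_const_smul_field (f := fun y => fderiv ℝ f (a + r • y)) r) x
  rw [laplacian_eq_sum_fderiv, laplacian_eq_sum_fderiv, h1, h2, h1, Finset.smul_sum]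
  simp [smul_smul, sq]

/-- `(-Δ)^m` is homogeneous of degree `2m` under dilations. -/
theorem negLaplacianPow_comp_affine (f : Rn n → ℂ) (a : Rn n) (r : ℝ) (m : ℕ) :
    negLaplacianPow m (fun y => f (a + r • y))
      = fun x => r ^ (2 * m) • negLaplacianPow m f (a + r • x) := by
  induction m with
  | zero => simp [negLaplacianPow]
  | succ m ih =>
    ext x
    rw [negLaplacianPow_succ, negLaplacianPow_succ, ih]
    simp only
    rw [laplacian_const_smul, laplacian_comp_affine, smul_neg, smul_smul]
    ring_nf

theorem exists_cutoff (r : ℝ) (hr : 0 ≤ r) :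
    ∃ ρ : Rn n → ℝ, ContDiff ℝ ∞ ρ ∧ HasCompactSupport ρ ∧ ∀ x, ‖x‖ < r + 1 → ρ x = 1 := by
  let b : ContDiffBump (0 : Rn n) := ⟨r + 1, r + 2, by linarith, by linarith⟩
  refine ⟨b, b.contDiff, b.hasCompactSupport, fun x hx => b.one_of_mem_closedBall ?_⟩
  simpa [b] using hx.le

/-- Integration by parts. The factor `w` need not decay: it may be cut off outside of the support of
`χ`, which reduces the claim to Schwartz functions. -/
theorem integral_mul_laplacian {w χ : Rn n → ℂ} (hw : ContDiff ℝ ∞ w) (hχ : ContDiff ℝ ∞ χ)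
    (hχc : HasCompactSupport χ) : ∫ x, w x * (Δ χ) x = ∫ x, (Δ w) x * χ x := by
  obtain ⟨r, hr0, hr⟩ : ∃ r : ℝ, 0 ≤ r ∧ tsupport χ ⊆ Metric.closedBall 0 r := by
    obtain ⟨r, hr⟩ := hχc.isBounded.subset_closedBall 0
    exact ⟨max r 0, le_max_right _ _, hr.trans (Metric.closedBall_subset_closedBall (le_max_left _ _))⟩
  obtain ⟨ρ, hρ, hρc, hρ1⟩ := exists_cutoff (n := n) r hr0
  have hs : ContDiff ℝ ∞ (fun x => (ρ x : ℂ) * w x) :=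
    (Complex.ofRealCLM.contDiff.comp hρ).mul hw
  have hsc : HasCompactSupport (fun x => (ρ x : ℂ) * w x) := by
    have : HasCompactSupport (fun x => (ρ x : ℂ)) := hρc.comp_left (g := Complex.ofReal) rfl
    exact this.mul_right
  have key := SchwartzMap.integral_mul_laplacian_right_eq_left (μ := volume) (hsc.toSchwartzMap hs)
    (hχc.toSchwartzMap hχ)
  simp only [SchwartzMap.laplacian_apply] at key
  have hzero (x : Rn n) (hx : x ∉ tsupport χ) : χ x = 0 ∧ (Δ χ) x = 0 := by
    refine ⟨image_eq_zero_of_notMem_tsupport hx, ?_⟩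
    have := negLaplacianPow_eq_zero hx 1
    rw [negLaplacianPow_succ] at this
    simpa [negLaplacianPow] using this
  have hnear (x : Rn n) (hx : x ∈ tsupport χ) : (fun y => (ρ y : ℂ) * w y) =ᶠ[𝓝 x] w := by
    have : ‖x‖ < r + 1 := by
      have := hr hx
      rw [mem_closedBall_zero_iff] at this
      linarith
    filter_upwards [continuous_norm.continuousAt.eventually_lt continuousAt_const this] with y hy
    rw [hρ1 y hy]; simp
  refine Eq.trans ?_ (key.trans ?_)
  · refine integral_congr_ae (.of_forall fun x => ?_)
    by_cases hx : x ∈ tsupport χ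
    · have h1 : (ρ x : ℂ) * w x = w x := (hnear x hx).self_of_nhds
      change _ = ((ρ x : ℂ) * w x) * (Δ χ) x
      rw [h1]
    · change _ = _ * (Δ χ) x
      simp only [(hzero x hx).2, mul_zero]
  · refine integral_congr_ae (.of_forall fun x => ?_)
    by_cases hx : x ∈ tsupport χ
    · change (Δ (fun y => (ρ y : ℂ) * w y)) x * χ x = _
      rw [(InnerProductSpace.laplacian_congr_nhds (hnear x hx)).self_of_nhds]
    · change _ * χ x = _
      simp only [(hzero x hx).1, mul_zero]

theorem integral_mul_negLaplacianPow {w χ : Rn n → ℂ} (hw : ContDiff ℝ ∞ w)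
    (hχ : ContDiff ℝ ∞ χ) (hχc : HasCompactSupport χ) (m : ℕ) :
    ∫ x, w x * negLaplacianPow m χ x = ∫ x, negLaplacianPow m w x * χ x := by
  induction m generalizing χ with
  | zero => rfl
  | succ m ih =>
    have h1 : negLaplacianPow (m + 1) χ = negLaplacianPow m (fun x => -(Δ χ) x) := rfl
    have h2 : HasCompactSupport (fun x => -(Δ χ) x) := by
      have := hasCompactSupport_negLaplacianPow hχc 1
      rwa [negLaplacianPow_succ] at this
    rw [h1, ih (contDiff_laplacian hχ).neg h2, negLaplacianPow_succ]
    simp only [mul_neg, neg_mul, integral_neg]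
    rw [integral_mul_laplacian (contDiff_negLaplacianPow hw m) hχ hχc]

theorem laplacian_eq_sum_fderiv_fderiv {f : Rn n → ℂ} (hf : ContDiff ℝ ∞ f) (x : Rn n) :
    (Δ f) x = ∑ i, fderiv ℝ (fun y => fderiv ℝ f y (EuclideanSpace.basisFun (Fin n) ℝ i)) x
      (EuclideanSpace.basisFun (Fin n) ℝ i) := by
  rw [laplacian_eq_sum_fderiv]
  refine Finset.sum_congr rfl fun i _ => ?_
  have h1 : ContDiff ℝ ∞ (fderiv ℝ f) := hf.fderiv_right (by simp)
  rw [fderiv_clm_apply (h1.differentiable (by simp) x) (differentiableAt_const _)]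
  simp

theorem fderiv_convolution_apply {κ : Rn n → ℝ} (hκ : LocallyIntegrable κ) {χ : Rn n → ℂ}
    (hχ : ContDiff ℝ ∞ χ) (hχc : HasCompactSupport χ) (v : Rn n) :
    (fun x => fderiv ℝ (κ ⋆[ContinuousLinearMap.lsmul ℝ ℝ, volume] χ) x v)
      = κ ⋆[ContinuousLinearMap.lsmul ℝ ℝ, volume] fun x => fderiv ℝ χ x v := by
  ext1 x
  have h1 : ContDiff ℝ ∞ (fderiv ℝ χ) := hχ.fderiv_right (by simp)
  rw [(hχc.hasFDerivAt_convolution_right (ContinuousLinearMap.lsmul ℝ ℝ) hκ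
    (hχ.of_le (by simp)) x).fderiv,
    convolution_precompR_apply _ hκ (hχc.fderiv ℝ) h1.continuous]

theorem laplacian_convolution {κ : Rn n → ℝ} (hκ : LocallyIntegrable κ) {χ : Rn n → ℂ}
    (hχ : ContDiff ℝ ∞ χ) (hχc : HasCompactSupport χ) :
    Δ (κ ⋆[ContinuousLinearMap.lsmul ℝ ℝ, volume] χ)
      = κ ⋆[ContinuousLinearMap.lsmul ℝ ℝ, volume] (Δ χ) := by
  have h1 (v : Rn n) : ContDiff ℝ ∞ (fun x => fderiv ℝ χ x v) :=
    (hχ.fderiv_right (by simp)).clm_apply contDiff_const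
  have c1 (v : Rn n) : HasCompactSupport (fun x => fderiv ℝ χ x v) := hχc.fderiv_apply ℝ v
  have h2 (v : Rn n) : ContDiff ℝ ∞ (fun x => fderiv ℝ (fun y => fderiv ℝ χ y v) x v) :=
    ((h1 v).fderiv_right (by simp)).clm_apply contDiff_const
  have c2 (v : Rn n) : HasCompactSupport (fun x => fderiv ℝ (fun y => fderiv ℝ χ y v) x v) :=
    (c1 v).fderiv_apply ℝ v
  ext x
  rw [laplacian_eq_sum_fderiv_fderiv
    (hχc.contDiff_convolution_right (ContinuousLinearMap.lsmul ℝ ℝ) hκ hχ)]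
  have h3 (v : Rn n) : fderiv ℝ
      (fun y => fderiv ℝ (κ ⋆[ContinuousLinearMap.lsmul ℝ ℝ, volume] χ) y v) x v
      = ∫ t, κ t • fderiv ℝ (fun y => fderiv ℝ χ y v) (x - t) v := by
    rw [fderiv_convolution_apply hκ hχ hχc]
    exact congrFun (fderiv_convolution_apply hκ (h1 v) (c1 v) v) x
  simp_rw [h3]
  rw [← integral_finsetSum]
  · refine integral_congr_ae (.of_forall fun t => ?_)
    change _ = κ t • (Δ χ) (x - t)
    rw [laplacian_eq_sum_fderiv_fderiv hχ, Finset.smul_sum]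
  · intro i _
    exact (c2 _).convolutionExists_right (ContinuousLinearMap.lsmul ℝ ℝ) hκ (h2 _).continuous x

theorem negLaplacianPow_convolution {κ : Rn n → ℝ} (hκ : LocallyIntegrable κ) {χ : Rn n → ℂ}
    (hχ : ContDiff ℝ ∞ χ) (hχc : HasCompactSupport χ) (m : ℕ) :
    negLaplacianPow m (κ ⋆[ContinuousLinearMap.lsmul ℝ ℝ, volume] χ)
      = κ ⋆[ContinuousLinearMap.lsmul ℝ ℝ, volume] (negLaplacianPow m χ) := by
  induction m with
  | zero => rfl
  | succ m ih =>
    ext x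
    rw [negLaplacianPow_succ, ih, laplacian_convolution hκ (contDiff_negLaplacianPow hχ m)
      (hasCompactSupport_negLaplacianPow hχc m), negLaplacianPow_succ]
    simp [convolution, integral_neg]

end

section

open scoped ENNReal Topology

variable {n m q : ℕ}

/-! ### Moments of `Vψ` for decaying solutions -/

theorem monomialFn_smul (a : ℕ) {c : ℕ} (i : Fin c → Fin n) (r : ℝ) (x : Rn n) :
    monomialFn a i (r • x) = r ^ (2 * a + c) * monomialFn a i x := by
  simp only [monomialFn, norm_smul, mul_pow, PiLp.smul_apply, smul_eq_mul, Finset.prod_mul_distrib,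
    Finset.prod_const, Finset.card_univ, Fintype.card_fin, Real.norm_eq_abs]
  rw [pow_mul |r|, sq_abs, ← pow_mul, pow_add]
  ring

theorem contDiff_monomialFn (a : ℕ) {c : ℕ} (i : Fin c → Fin n) :
    ContDiff ℝ ∞ (monomialFn a i) := by
  have : monomialFn a i = fun y : Rn n => (‖y‖ ^ 2) ^ a * ∏ t, y (i t) := by
    ext y; rw [monomialFn, pow_mul]
  rw [this]
  refine ((contDiff_norm_sq ℝ).pow a).mul (contDiff_prod fun t _ => ?_)
  exact (EuclideanSpace.proj (𝕜 := ℝ) (i t)).contDiff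

/-- A homogeneous polynomial of degree `d < 2m` is polyharmonic: `(-Δ)^m` of it is homogeneous of
negative degree `d - 2m` and continuous at the origin. -/
theorem negLaplacianPow_monomialFn {a c : ℕ} (i : Fin c → Fin n) (h : 2 * a + c < 2 * m) :
    negLaplacianPow m (fun y => (monomialFn a i y : ℂ)) = 0 := by
  set p : Rn n → ℂ := fun y => (monomialFn a i y : ℂ) with hp
  have hps : ContDiff ℝ ∞ p := Complex.ofRealCLM.contDiff.comp (contDiff_monomialFn a i)
  have hcont := (contDiff_negLaplacianPow hps m).continuous
  ext x
  have hr (r : ℝ) (hr : r ≠ 0) :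
      r ^ (2 * m - (2 * a + c)) • negLaplacianPow m p (r • x) = negLaplacianPow m p x := by
    have h1 : (fun y => p (0 + r • y)) = fun y => r ^ (2 * a + c) • p y := by
      ext y
      simp only [hp, zero_add, monomialFn_smul, Complex.real_smul]
      push_cast; ring
    have h2 := congrFun (negLaplacianPow_comp_affine p 0 r m) x
    rw [h1, negLaplacianPow_const_smul] at h2
    simp only [zero_add] at h2
    have h3 : r ^ (2 * m) = r ^ (2 * a + c) * r ^ (2 * m - (2 * a + c)) := by
      rw [← pow_add]; congr 1; omega
    rw [h3, mul_smul] at h2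
    exact (smul_right_injective ℂ (pow_ne_zero _ hr) h2).symm
  have hlim : Tendsto (fun r : ℝ => r ^ (2 * m - (2 * a + c)) • negLaplacianPow m p (r • x))
      (𝓝[≠] 0) (𝓝 0) := by
    have h1 : Continuous
        (fun r : ℝ => r ^ (2 * m - (2 * a + c)) • negLaplacianPow m p (r • x)) := by fun_prop
    have h2 := h1.tendsto 0
    rw [zero_pow (by omega), zero_smul] at h2
    exact h2.mono_left nhdsWithin_le_nhds
  refine tendsto_nhds_unique (tendsto_const_nhds.congr' ?_) hlim
  filter_upwards [self_mem_nhdsWithin] with r hr'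
  exact (hr r hr').symm

/-- Integrals are limits of their smooth truncations `∫ φ(x/R) f(x) dx`, `R = 1, 2, 3, …`. -/
theorem tendsto_integral_cutoff {φ : Rn n → ℝ} (hφ : Continuous φ) (hφ0 : φ 0 = 1)
    (hφ1 : ∀ x, |φ x| ≤ 1) {f : Rn n → ℂ} (hf : Integrable f) :
    Tendsto (fun j : ℕ => ∫ x, (φ (((j : ℝ) + 1)⁻¹ • x) : ℂ) * f x) atTop (𝓝 (∫ x, f x)) := by
  refine tendsto_integral_of_dominated_convergence (fun x => ‖f x‖) (fun j => ?_) hf.norm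
    (fun j => .of_forall fun x => ?_) (.of_forall fun x => ?_)
  · exact (by fun_prop : Continuous fun x => (φ (((j : ℝ) + 1)⁻¹ • x) : ℂ)).aestronglyMeasurable.mul
      hf.1
  · rw [norm_mul, Complex.norm_real, Real.norm_eq_abs]
    exact mul_le_of_le_one_left (norm_nonneg _) (hφ1 _)
  · have h1 : Tendsto (fun j : ℕ => ((j : ℝ) + 1)⁻¹) atTop (𝓝 0) := by
      simpa using tendsto_one_div_add_atTop_nhds_zero_nat (𝕜 := ℝ)
    have h2 : Continuous fun t : ℝ => (φ (t • x) : ℂ) * f x := by fun_prop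
    have h3 := (h2.tendsto 0).comp h1
    simpa [hφ0, Function.comp_def] using h3

/-- If `ψ ∈ L²_{-s}`, then the pairing of `ψ` with `R^{d-2m} g(x/R)`, where `g` lives on the annulus
`1 ≤ |x| ≤ 2`, tends to zero, provided that `n/2 + s + d ≤ 2m`. -/
theorem tendsto_integral_annulus {s : ℝ} (hs : 0 ≤ s) {d : ℕ}
    (hd : (m : ℝ) + q + s + d ≤ 2 * m) (hn : n = 2 * m + 2 * q) {ψ : Rn n → ℂ}
    (hψ : MemWeightedL2 (-s) ψ) {g : Rn n → ℂ} (hg : Continuous g)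
    (hg1 : ∀ x, ‖x‖ < 1 → g x = 0) (hg2 : ∀ x, 2 < ‖x‖ → g x = 0) :
    Tendsto (fun j : ℕ => ∫ x, ψ x *
      ((((j : ℝ) + 1) ^ d * (((j : ℝ) + 1) ^ (2 * m))⁻¹) • g (((j : ℝ) + 1)⁻¹ • x)))
      atTop (𝓝 0) := by
  obtain ⟨M, hM⟩ : ∃ M, ∀ x, ‖g x‖ ≤ M := by
    refine hg.bounded_above_of_compact_support (HasCompactSupport.intro
      (isCompact_closedBall (0 : Rn n) 2) fun x hx => hg2 x ?_)
    simpa using hx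
  have hM0 : 0 ≤ M := (norm_nonneg _).trans (hM 0)
  set h : Rn n → ℂ := fun x => (1 + ‖x‖) ^ (-s) • ψ x with hh
  have hh2 : MemLp h 2 volume := hψ
  have hhfin := MemLp.lintegral_sq_ne_top hh2
  -- the mass of `h` outside of large balls
  set ε : ℕ → ℝ≥0∞ := fun j =>
    ∫⁻ x, Set.indicator {x : Rn n | (j : ℝ) + 1 ≤ ‖x‖} (fun x => ‖h x‖ₑ ^ 2) x with hε
  have hSm (j : ℕ) : MeasurableSet {x : Rn n | (j : ℝ) + 1 ≤ ‖x‖} :=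
    measurableSet_le measurable_const measurable_norm
  have hεlim : Tendsto ε atTop (𝓝 0) := by
    have := tendsto_lintegral_of_dominated_convergence' (μ := (volume : Measure (Rn n)))
      (F := fun j : ℕ => Set.indicator {x : Rn n | (j : ℝ) + 1 ≤ ‖x‖} (fun x => ‖h x‖ₑ ^ 2))
      (f := fun _ => 0) (fun x => ‖h x‖ₑ ^ 2)
      (fun j => (hh2.1.enorm.pow_const 2).indicator (hSm j))
      (fun j => .of_forall fun x => Set.indicator_le_self _ _ x) hhfin
      (.of_forall fun x => by
        refine tendsto_const_nhds.congr' ?_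
        obtain ⟨N, hN⟩ := exists_nat_gt ‖x‖
        filter_upwards [eventually_ge_atTop N] with j hj
        rw [Set.indicator_of_notMem]
        simp only [Set.mem_ofPred_eq, not_le]
        have : (N : ℝ) ≤ j := by exact_mod_cast hj
        linarith)
    simpa using this
  set C : ℝ≥0∞ := ENNReal.ofReal ((M * 3 ^ s) ^ 2 * 2 ^ n) * volume (Metric.ball (0 : Rn n) 1)
    with hC
  have hCfin : C ≠ ⊤ := ENNReal.mul_ne_top ENNReal.ofReal_ne_top measure_ball_lt_top.ne
  have hbound (j : ℕ) : ‖∫ x, ψ x *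
      ((((j : ℝ) + 1) ^ d * (((j : ℝ) + 1) ^ (2 * m))⁻¹) • g (((j : ℝ) + 1)⁻¹ • x))‖ₑ ^ 2
      ≤ ε j * C := by
    set R : ℝ := (j : ℝ) + 1 with hR
    have hR1 : 1 ≤ R := by rw [hR]; linarith [Nat.cast_nonneg (α := ℝ) j]
    have hR0 : 0 < R := by linarith
    set b : ℝ := M * (3 * R) ^ s * (R ^ d * (R ^ (2 * m))⁻¹) with hb
    have hpt (x : Rn n) : ‖ψ x * ((R ^ d * (R ^ (2 * m))⁻¹) • g (R⁻¹ • x))‖ₑ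
        ≤ Set.indicator {x : Rn n | R ≤ ‖x‖} (fun x => ‖h x‖ₑ) x *
          Set.indicator (Metric.closedBall (0 : Rn n) (2 * R)) (fun _ => ENNReal.ofReal b) x := by
      have hnx : ‖R⁻¹ • x‖ = R⁻¹ * ‖x‖ := by
        rw [norm_smul, Real.norm_of_nonneg (inv_nonneg.2 hR0.le)]
      by_cases h1 : R ≤ ‖x‖
      · by_cases h2 : ‖x‖ ≤ 2 * R
        · rw [Set.indicator_of_mem (by exact h1), Set.indicator_of_mem (by simpa using h2),
            ← ofReal_norm, ← ofReal_norm, ← ENNReal.ofReal_mul (norm_nonneg _)]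
          refine ENNReal.ofReal_le_ofReal ?_
          have hw : (1 + ‖x‖) ^ s ≤ (3 * R) ^ s := by
            gcongr
            linarith
          have hψh : ‖ψ x‖ = ‖h x‖ * (1 + ‖x‖) ^ s := by
            rw [hh, norm_smul, Real.norm_of_nonneg (by positivity), Real.rpow_neg (by positivity)]
            field_simp
          rw [norm_mul, norm_smul, Real.norm_of_nonneg (by positivity), hψh, hb]
          calc ‖h x‖ * (1 + ‖x‖) ^ s * (R ^ d * (R ^ (2 * m))⁻¹ * ‖g (R⁻¹ • x)‖)
              ≤ ‖h x‖ * (3 * R) ^ s * (R ^ d * (R ^ (2 * m))⁻¹ * M) := by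
                gcongr
                exact hM _
            _ = _ := by ring
        · rw [hg2 _ (by rw [hnx, inv_mul_eq_div, lt_div_iff₀ hR0]; linarith)]
          simp
      · rw [hg1 _ (by rw [hnx, inv_mul_eq_div, div_lt_one hR0]; linarith)]
        simp
    have hmeas : AEMeasurable (Set.indicator {x : Rn n | R ≤ ‖x‖} (fun x => ‖h x‖ₑ)) :=
      hh2.1.enorm.indicator (hSm j)
    have hmeas2 : AEMeasurable (Set.indicator (Metric.closedBall (0 : Rn n) (2 * R))
        (fun _ => ENNReal.ofReal b)) :=
      (measurable_const.indicator Metric.isClosed_closedBall.measurableSet).aemeasurable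
    have hsecond : ∫⁻ x, Set.indicator (Metric.closedBall (0 : Rn n) (2 * R))
        (fun _ => ENNReal.ofReal b) x ^ 2 ≤ C := by
      have h1 (x : Rn n) : Set.indicator (Metric.closedBall (0 : Rn n) (2 * R))
          (fun _ => ENNReal.ofReal b) x ^ 2 = Set.indicator (Metric.closedBall (0 : Rn n) (2 * R))
          (fun _ => ENNReal.ofReal b ^ 2) x := by
        by_cases hx : x ∈ Metric.closedBall (0 : Rn n) (2 * R)
        · simp only [Set.indicator_of_mem hx]
        · simp only [Set.indicator_of_notMem hx]; simp
      simp_rw [h1]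
      rw [lintegral_indicator Metric.isClosed_closedBall.measurableSet, setLIntegral_const,
        Measure.addHaar_closedBall _ _ (by positivity), finrank_euclideanSpace_fin, ← mul_assoc,
        ← ENNReal.ofReal_pow (by positivity), ← ENNReal.ofReal_mul (by positivity), hC]
      refine mul_le_mul' (ENNReal.ofReal_le_ofReal ?_) le_rfl
      have h2 : R ^ s * R ^ d * R ^ (m + q) ≤ R ^ (2 * m) := by
        rw [← Real.rpow_natCast R d, ← Real.rpow_natCast R (m + q), ← Real.rpow_natCast R (2 * m),
          ← Real.rpow_add hR0, ← Real.rpow_add hR0]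
        refine Real.rpow_le_rpow_of_exponent_le hR1 ?_
        push_cast
        linarith
      have h3 : R ^ s * R ^ d * R ^ (m + q) * (R ^ (2 * m))⁻¹ ≤ 1 := by
        rw [← div_eq_mul_inv, div_le_one (by positivity)]
        exact h2
      have h4 : (R ^ s * R ^ d * R ^ (m + q) * (R ^ (2 * m))⁻¹) ^ 2 ≤ 1 :=
        pow_le_one₀ (by positivity) h3
      calc b ^ 2 * (2 * R) ^ n
          = (M * 3 ^ s) ^ 2 * 2 ^ n *
            (R ^ s * R ^ d * R ^ (m + q) * (R ^ (2 * m))⁻¹) ^ 2 := by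
            have : R ^ n = (R ^ (m + q)) ^ 2 := by
              rw [← pow_mul, hn]; congr 1; ring
            rw [hb, Real.mul_rpow (by norm_num) hR0.le, mul_pow 2 R n, this]
            ring
        _ ≤ (M * 3 ^ s) ^ 2 * 2 ^ n * 1 := by gcongr
        _ = _ := mul_one _
    calc _ ≤ (∫⁻ x, Set.indicator {x : Rn n | R ≤ ‖x‖} (fun x => ‖h x‖ₑ) x *
          Set.indicator (Metric.closedBall (0 : Rn n) (2 * R))
            (fun _ => ENNReal.ofReal b) x) ^ 2 := by
          gcongr
          exact (enorm_integral_le_lintegral_enorm _).trans (lintegral_mono hpt)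
      _ ≤ _ := sq_lintegral_mul_le hmeas hmeas2
      _ ≤ ε j * C := by
          gcongr
          rw [hε]
          refine lintegral_mono fun x => ?_
          by_cases hx : R ≤ ‖x‖
          · rw [Set.indicator_of_mem (by exact hx), Set.indicator_of_mem (by exact hx)]
          · rw [Set.indicator_of_notMem (by exact hx)]; simp
  have hlim : Tendsto (fun j => ε j * C) atTop (𝓝 0) := by
    simpa using ENNReal.Tendsto.mul_const hεlim (Or.inr hCfin)
  have hsq := tendsto_of_tendsto_of_tendsto_of_le_of_le tendsto_const_nhds hlim
    (fun _ => zero_le) hbound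
  have hroot := ((ENNReal.continuous_rpow_const (y := (1 / 2 : ℝ))).tendsto 0).comp hsq
  rw [ENNReal.zero_rpow_of_pos (by norm_num)] at hroot
  rw [tendsto_zero_iff_norm_tendsto_zero]
  have h1 : Tendsto (fun j : ℕ => ‖∫ x, ψ x *
      ((((j : ℝ) + 1) ^ d * (((j : ℝ) + 1) ^ (2 * m))⁻¹) • g (((j : ℝ) + 1)⁻¹ • x))‖ₑ)
      atTop (𝓝 0) := by
    refine hroot.congr fun j => ?_
    simp only [Function.comp_apply]
    rw [← ENNReal.rpow_natCast, ← ENNReal.rpow_mul]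
    norm_num
  have h2 := (ENNReal.tendsto_toReal ENNReal.zero_ne_top).comp h1
  simpa [Function.comp_def] using h2

/-- If a solution `ψ` of `((-Δ)^m + V) ψ = 0` lies in `L²_{-s}`, then the moments of `Vψ` of the
degrees `d ≤ m - q - s` vanish: test the equation with homogeneous polynomials, which are
polyharmonic, cut off at distance `R → ∞`. -/
theorem integral_monomialFn_mul_eq_zero (hm : 1 ≤ m) (hq : 1 ≤ q) (hn : n = 2 * m + 2 * q)
    {V : Rn n → ℝ} {ψ : Rn n → ℂ} (hψ : IsDistribSolution m V ψ) {s : ℝ} (hs : 0 ≤ s)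
    (hψs : MemWeightedL2 (-s) ψ) {a c : ℕ} (i : Fin c → Fin n)
    (hd : (q : ℝ) + s + (2 * a + c : ℕ) ≤ m)
    (hint : Integrable (fun x => (monomialFn a i x : ℂ) * ((V x : ℂ) * ψ x))) :
    ∫ x, (monomialFn a i x : ℂ) * ((V x : ℂ) * ψ x) = 0 := by
  have hdm : 2 * a + c < 2 * m := by
    have h1 : (1 : ℝ) ≤ q := by exact_mod_cast hq
    have : ((2 * a + c : ℕ) : ℝ) < m := by linarith
    have : 2 * a + c < m := by exact_mod_cast this
    omega
  let φ : ContDiffBump (0 : Rn n) := ⟨1, 2, by norm_num, by norm_num⟩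
  set p : Rn n → ℂ := fun y => (monomialFn a i y : ℂ) with hp
  have hps : ContDiff ℝ ∞ p := Complex.ofRealCLM.contDiff.comp (contDiff_monomialFn a i)
  set Q : Rn n → ℂ := fun y => (φ y : ℂ) * p y with hQ
  have hQs : ContDiff ℝ ∞ Q := (Complex.ofRealCLM.contDiff.comp φ.contDiff).mul hps
  have hφsupp : tsupport (φ : Rn n → ℝ) = Metric.closedBall 0 2 := φ.tsupport_eq
  have hQsupp : tsupport Q ⊆ Metric.closedBall 0 2 := by
    rw [← hφsupp]
    refine closure_mono fun x hx hx0 => hx ?_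
    simp [hQ, hx0]
  have hQc : HasCompactSupport Q :=
    (isCompact_closedBall (0 : Rn n) 2).of_isClosed_subset (isClosed_tsupport _) hQsupp
  set g := negLaplacianPow m Q with hg
  have hg1 (x : Rn n) (hx : ‖x‖ < 1) : g x = 0 := by
    have h1 : Q =ᶠ[𝓝 x] p := by
      filter_upwards [continuous_norm.continuousAt.eventually_lt continuousAt_const hx] with y hy
      have : φ y = 1 := φ.one_of_mem_closedBall (by simpa using hy.le)
      simp [hQ, this]
    rw [hg, (negLaplacianPow_congr_nhds h1 m).self_of_nhds, negLaplacianPow_monomialFn i hdm]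
    rfl
  have hg2 (x : Rn n) (hx : 2 < ‖x‖) : g x = 0 := by
    refine negLaplacianPow_eq_zero (fun h => ?_) m
    have := hQsupp h
    rw [mem_closedBall_zero_iff] at this
    linarith
  have hgc : Continuous g := (contDiff_negLaplacianPow hQs m).continuous
  have hA := tendsto_integral_annulus (m := m) (q := q) hs (d := 2 * a + c) (by linarith) hn hψs hgc
    hg1 hg2
  have hB := tendsto_integral_cutoff φ.continuous
    (φ.one_of_mem_closedBall (Metric.mem_closedBall_self (by norm_num [φ])))
    (fun x => by rw [abs_of_nonneg φ.nonneg]; exact φ.le_one) hint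
  have hsum (j : ℕ) : (∫ x, ψ x * ((((j : ℝ) + 1) ^ (2 * a + c) * (((j : ℝ) + 1) ^ (2 * m))⁻¹) •
      g (((j : ℝ) + 1)⁻¹ • x))) + ∫ x, (φ (((j : ℝ) + 1)⁻¹ • x) : ℂ) *
        (p x * ((V x : ℂ) * ψ x)) = 0 := by
    set R : ℝ := (j : ℝ) + 1 with hR
    have hR0 : 0 < R := by positivity
    set χ : Rn n → ℂ := fun x => R ^ (2 * a + c) • Q (0 + R⁻¹ • x) with hχ
    have hχs : ContDiff ℝ ∞ χ := by
      have h1 : ContDiff ℝ ∞ (fun x : Rn n => (0 : Rn n) + R⁻¹ • x) := by fun_prop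
      exact (hQs.comp h1).const_smul _
    have hχc : HasCompactSupport χ := by
      refine HasCompactSupport.intro (isCompact_closedBall (0 : Rn n) (2 * R)) fun x hx => ?_
      have : R⁻¹ • x ∉ tsupport Q := fun h => by
        have := hQsupp h
        rw [mem_closedBall_zero_iff, norm_smul, Real.norm_of_nonneg (inv_nonneg.2 hR0.le),
          inv_mul_eq_div, div_le_iff₀ hR0] at this
        simp at hx
        linarith
      simp [hχ, image_eq_zero_of_notMem_tsupport this]
    have hχL : negLaplacianPow m χ
        = fun x => (R ^ (2 * a + c) * (R ^ (2 * m))⁻¹) • g (R⁻¹ • x) := by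
      rw [hχ, negLaplacianPow_const_smul, negLaplacianPow_comp_affine]
      ext x
      simp only [zero_add, smul_smul, inv_pow, ← hg]
    have hχval (x : Rn n) : χ x = (φ (R⁻¹ • x) : ℂ) * p x := by
      have : monomialFn a i x = R ^ (2 * a + c) * monomialFn a i (R⁻¹ • x) := by
        rw [← monomialFn_smul, smul_smul, mul_inv_cancel₀ hR0.ne', one_smul]
      simp only [hχ, hQ, hp, zero_add, Complex.real_smul, this]
      push_cast; ring
    have heq := hψ.2 χ hχs hχc
    have hi1 : Integrable (fun x => ψ x * negLaplacianPow m χ x) := by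
      have := hψ.1.integrable_smul_right_of_hasCompactSupport
        (contDiff_negLaplacianPow hχs m).continuous (hasCompactSupport_negLaplacianPow hχc m)
      simpa using this
    have hi2 : Integrable (fun x => (φ (R⁻¹ • x) : ℂ) * (p x * ((V x : ℂ) * ψ x))) := by
      refine hint.bdd_mul (c := 1) (Continuous.aestronglyMeasurable ?_) (.of_forall fun x => ?_)
      · have := φ.continuous
        fun_prop
      · rw [Complex.norm_real, Real.norm_of_nonneg φ.nonneg]
        exact φ.le_one
    rw [hχL] at hi1 heq
    rw [← integral_add hi1 hi2, ← heq]
    refine integral_congr_ae (.of_forall fun x => ?_)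
    change _ = ψ x * ((R ^ (2 * a + c) * (R ^ (2 * m))⁻¹) • g (R⁻¹ • x) + V x * χ x)
    rw [hχval]
    ring
  have hlim := (hA.add hB).congr hsum
  rw [zero_add] at hlim
  exact (tendsto_nhds_unique hlim tendsto_const_nhds)

end

section

open scoped ENNReal Topology Convolution

variable {n m q : ℕ}

/-! ### A Liouville theorem for `(-Δ)^m` in weighted `L²` -/

theorem memLp_two_one_add_norm_rpow {t : ℝ} (ht : (n : ℝ) < 2 * t) :
    MemLp (fun x : Rn n => (1 + ‖x‖) ^ (-t)) 2 volume := by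
  have hc : Continuous fun x : Rn n => (1 + ‖x‖) ^ (-t) :=
    (by fun_prop : Continuous fun x : Rn n => 1 + ‖x‖).rpow_const
      fun x => Or.inl (by positivity)
  rw [memLp_two_iff_integrable_sq hc.aestronglyMeasurable]
  have h : Integrable (fun x : Rn n => (1 + ‖x‖) ^ (-(2 * t))) :=
    integrable_one_add_norm (by simpa using ht)
  refine h.congr (.of_forall fun x => ?_)
  simp only
  rw [← Real.rpow_natCast, ← Real.rpow_mul (by positivity)]
  congr 1
  push_cast; ring

theorem integrable_mul_one_add_norm_rpow {u : Rn n → ℂ} {s t : ℝ} (hu : MemWeightedL2 (-s) u)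
    (hst : (n : ℝ) < 2 * (t - s)) : Integrable (fun x => ‖u x‖ * (1 + ‖x‖) ^ (-t)) := by
  have h := (memLp_two_one_add_norm_rpow hst).integrable_mul hu.norm
  refine h.congr (.of_forall fun x => ?_)
  have hx : (0 : ℝ) < 1 + ‖x‖ := by positivity
  simp only [Pi.mul_apply, norm_smul, Real.norm_of_nonneg (Real.rpow_nonneg hx.le _)]
  rw [← mul_assoc, ← Real.rpow_add hx, mul_comm]
  congr 2
  ring

theorem integrable_rieszKernel_smul {E : Type*} [NormedAddCommGroup E] [NormedSpace ℝ E]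
    (hm : 1 ≤ m) (hn : n = 2 * m + 2 * q) {g : Rn n → E} (hg : Continuous g)
    (hgc : HasCompactSupport g) : Integrable (fun z => rieszKernel q z • g z) := by
  have h := (integrable_truncatedKernel (q := q) hm hn).locallyIntegrable
    |>.integrable_smul_right_of_hasCompactSupport
    (g := fun z => (1 + ‖z‖) ^ (2 * m + 1) • g z) (by fun_prop) hgc.smul_left
  refine h.congr (.of_forall fun z => ?_)
  simp only [truncatedKernel, smul_smul]
  congr 1
  have : (1 + ‖z‖) ^ (2 * m + 1) ≠ 0 := by positivity
  field_simp

theorem rieszKernel_smul (r : ℝ) (z : Rn n) :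
    rieszKernel q (r • z) = (r ^ (2 * q))⁻¹ * rieszKernel q z := by
  rw [rieszKernel, rieszKernel, norm_smul, mul_pow, mul_inv, Real.norm_eq_abs, pow_mul |r|, sq_abs,
    ← pow_mul]

theorem contDiffAt_rieszKernel {z : Rn n} (hz : z ≠ 0) : ContDiffAt ℝ ∞ (rieszKernel q) z := by
  have : (rieszKernel q : Rn n → ℝ) = fun z => ((‖z‖ ^ 2) ^ q)⁻¹ := by
    ext z; rw [rieszKernel, pow_mul]
  rw [this]
  exact ((contDiff_norm_sq ℝ).contDiffAt.pow q).inv (by positivity)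

/-- The Riesz kernel with its singularity at the origin cut out. -/
noncomputable def smoothedRieszKernel (q : ℕ) (φ : Rn n → ℝ) (z : Rn n) : ℂ :=
  (rieszKernel q z * (1 - φ z) : ℝ)

theorem contDiff_smoothedRieszKernel (q : ℕ) {φ : Rn n → ℝ} (hφ : ContDiff ℝ ∞ φ)
    (hφ1 : φ =ᶠ[𝓝 0] fun _ => 1) : ContDiff ℝ ∞ (smoothedRieszKernel q φ) := by
  refine Complex.ofRealCLM.contDiff.comp (contDiff_iff_contDiffAt.2 fun z => ?_)
  rcases eq_or_ne z 0 with rfl | hz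
  · refine (contDiffAt_const (c := (0 : ℝ))).congr_of_eventuallyEq ?_
    filter_upwards [hφ1] with z hz
    rw [hz, sub_self]
    exact mul_zero _
  · exact (contDiffAt_rieszKernel hz).mul (contDiffAt_const.sub hφ.contDiffAt)

/-- `(-Δ)^m` of the smoothed Riesz kernel decays like `|z|^{-n}`, because it is homogeneous of
degree `-2q-2m` away from the cutoff. -/
theorem exists_negLaplacianPow_smoothedRieszKernel_le (hn : n = 2 * m + 2 * q) {φ : Rn n → ℝ}
    (hφ : ContDiff ℝ ∞ φ) (hφ1 : φ =ᶠ[𝓝 0] fun _ => 1) (hφ0 : ∀ z, 2 < ‖z‖ → φ z = 0) :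
    ∃ C, ∀ z, ‖negLaplacianPow m (smoothedRieszKernel q φ) z‖ ≤ C * ((1 + ‖z‖) ^ n)⁻¹ := by
  set w := smoothedRieszKernel q φ with hw
  set h := negLaplacianPow m w with hh
  have hc : Continuous h :=
    (contDiff_negLaplacianPow (contDiff_smoothedRieszKernel q hφ hφ1) m).continuous
  obtain ⟨M, hM⟩ := (isCompact_closedBall (0 : Rn n) 3).exists_bound_of_continuousOn hc.continuousOn
  have hM0 : 0 ≤ M := (norm_nonneg _).trans (hM 0 (by simp))
  have hscale (r : ℝ) (hr : 1 ≤ r) (y : Rn n) (hy : 2 < ‖y‖) : h (r • y) = (r ^ n)⁻¹ • h y := by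
    have hr0 : 0 < r := by linarith
    have h1 : (fun y => w (0 + r • y)) =ᶠ[𝓝 y] fun y => (r ^ (2 * q))⁻¹ • w y := by
      filter_upwards [continuous_norm.continuousAt.eventually_const_lt hy] with y hy
      have h2 : 2 < ‖r • y‖ := by
        rw [norm_smul, Real.norm_of_nonneg hr0.le]
        nlinarith
      rw [zero_add, hw, smoothedRieszKernel, smoothedRieszKernel, hφ0 _ hy, hφ0 _ h2,
        rieszKernel_smul, Complex.real_smul]
      push_cast; ring
    have h3 := (negLaplacianPow_congr_nhds h1 m).self_of_nhds
    rw [negLaplacianPow_comp_affine, negLaplacianPow_const_smul] at h3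
    simp only [zero_add] at h3
    have h4 : (r ^ n)⁻¹ = (r ^ (2 * m))⁻¹ * (r ^ (2 * q))⁻¹ := by
      rw [← mul_inv, ← pow_add, ← hn]
    rw [h4, mul_smul, ← h3, smul_smul, inv_mul_cancel₀ (by positivity), one_smul]
  refine ⟨M * 4 ^ n, fun z => ?_⟩
  rw [mul_assoc, ← inv_inv ((4 : ℝ) ^ n), ← mul_inv, ← inv_pow, ← mul_pow]
  rcases le_total ‖z‖ 3 with hz | hz
  · refine (hM z (by simpa using hz)).trans (le_mul_of_one_le_right hM0 ?_)
    refine one_le_inv_iff₀.2 ⟨by positivity, pow_le_one₀ (by positivity) ?_⟩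
    linarith
  · set r := ‖z‖ / 3 with hr
    have hr1 : 1 ≤ r := by rw [hr]; linarith
    have hr0 : 0 < r := by linarith
    have hz2 : z = r • (r⁻¹ • z) := by rw [smul_smul, mul_inv_cancel₀ hr0.ne', one_smul]
    have hy : ‖r⁻¹ • z‖ = 3 := by
      rw [norm_smul, Real.norm_of_nonneg (by positivity), hr]
      field_simp
    rw [hz2, hscale r hr1 _ (by rw [hy]; norm_num), ← hz2, norm_smul,
      Real.norm_of_nonneg (by positivity), mul_comm]
    gcongr
    · exact hM _ (by simp [hy])
    · rw [hr]; linarith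

/-- The error that arises when the fundamental solution is replaced by its product with a cutoff
function `φ`. -/
theorem sub_negLaplacianPow_convolution (hm : 1 ≤ m) (hq : 1 ≤ q) (hn : n = 2 * m + 2 * q)
    {φ : Rn n → ℝ} (hφ : ContDiff ℝ ∞ φ) (hφc : HasCompactSupport φ)
    (hφ1 : φ =ᶠ[𝓝 0] fun _ => 1) {η : Rn n → ℂ} (hη : ContDiff ℝ ∞ η) (hηc : HasCompactSupport η)
    (x : Rn n) :
    η x - negLaplacianPow m (fun x => rieszConst n m •
      ((fun z => rieszKernel q z * φ z) ⋆[ContinuousLinearMap.lsmul ℝ ℝ, volume] η) x) x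
      = rieszConst n m *
        ∫ z, negLaplacianPow m (smoothedRieszKernel q φ) z * η (x - z) := by
  have hκ : LocallyIntegrable (fun z : Rn n => rieszKernel q z * φ z) :=
    (integrable_rieszKernel_smul hm hn hφ.continuous hφc).locallyIntegrable
  have hws := contDiff_smoothedRieszKernel q hφ hφ1
  have hLs : ContDiff ℝ ∞ (negLaplacianPow m η) := contDiff_negLaplacianPow hη m
  have hLc : HasCompactSupport (negLaplacianPow m η) := hasCompactSupport_negLaplacianPow hηc m
  have hηx : (fun z => η (x - z)) = fun z => η (x + (-1 : ℝ) • z) := by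
    ext z; simp [sub_eq_add_neg]
  have hLx : negLaplacianPow m (fun z => η (x - z)) = fun z => negLaplacianPow m η (x - z) := by
    rw [hηx, negLaplacianPow_comp_affine]
    ext z
    simp [pow_mul, sub_eq_add_neg]
  rw [← integral_mul_negLaplacianPow hws (χ := fun z => η (x - z)) (hη.comp (by fun_prop))
    (hηc.comp_homeomorph (Homeomorph.subLeft x)), hLx, negLaplacianPow_const_smul]
  simp only
  rw [negLaplacianPow_convolution hκ hη hηc, Complex.real_smul, convolution_def,
    ← rieszConst_mul_integral_negLaplacianPow hm hq hn hη hηc x]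
  generalize negLaplacianPow m η = L at hLs hLc ⊢
  have hLc' : HasCompactSupport (fun z => L (x - z)) :=
    hLc.comp_homeomorph (Homeomorph.subLeft x)
  have hLs' : Continuous (fun z => L (x - z)) := by
    have := hLs.continuous
    fun_prop
  have hint1 : Integrable (fun z => (rieszKernel q z * φ z) • L (x - z)) := by
    have h1 := integrable_rieszKernel_smul (q := q) hm hn (g := fun z => φ z • L (x - z))
      (hφ.continuous.smul hLs') (HasCompactSupport.smul_left (f := φ) hLc')
    simpa only [smul_smul] using h1
  have hint2 : Integrable (fun z => smoothedRieszKernel q φ z * L (x - z)) :=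
    (hws.continuous.mul hLs').integrable_of_hasCompactSupport
      (HasCompactSupport.mul_left (f := smoothedRieszKernel q φ) hLc')
  rw [← mul_sub]
  congr 1
  rw [← integral_sub_left_eq_self (fun y => (rieszKernel q (x - y) : ℂ) * L y) volume x,
    sub_eq_iff_eq_add, add_comm]
  simp only [sub_sub_cancel, ContinuousLinearMap.lsmul_apply]
  rw [← integral_add hint1 hint2]
  refine integral_congr_ae (.of_forall fun z => ?_)
  simp only [smoothedRieszKernel, Complex.real_smul]
  push_cast
  ring

/-- Cutting off the fundamental solution at distance `R`, where `R` runs through `1, 2, 3, …`, and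
convolving with `η` gives test functions whose images under `(-Δ)^m` approximate `η`. -/
theorem exists_negLaplacianPow_approx (hm : 1 ≤ m) (hq : 1 ≤ q) (hn : n = 2 * m + 2 * q)
    {η : Rn n → ℂ} (hη : ContDiff ℝ ∞ η) (hηc : HasCompactSupport η) :
    ∃ (T : ℕ → Rn n → ℂ) (D : ℝ), (∀ j, ContDiff ℝ ∞ (T j) ∧ HasCompactSupport (T j)) ∧
      ∀ᶠ j : ℕ in atTop, ∀ x, ‖η x - negLaplacianPow m (T j) x‖
        ≤ D * (((j : ℝ) + 1 + ‖x‖) ^ n)⁻¹ := by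
  let φ : ContDiffBump (0 : Rn n) := ⟨1, 2, by norm_num, by norm_num⟩
  have hφ1 : (φ : Rn n → ℝ) =ᶠ[𝓝 0] fun _ => 1 := φ.eventuallyEq_one
  have hφ0 (z : Rn n) (hz : 2 < ‖z‖) : φ z = 0 :=
    φ.zero_of_le_dist (by simpa [φ] using hz.le)
  obtain ⟨C, hC⟩ := exists_negLaplacianPow_smoothedRieszKernel_le (m := m) (q := q) hn φ.contDiff
    hφ1 hφ0
  have hC0 : 0 ≤ C := by
    have := (norm_nonneg _).trans (hC 0)
    simpa using this
  obtain ⟨ρ, hρ0, hρ⟩ : ∃ r : ℝ, 0 ≤ r ∧ ∀ y, r < ‖y‖ → η y = 0 := by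
    obtain ⟨r, hr⟩ := hηc.isBounded.subset_closedBall 0
    refine ⟨max r 0, le_max_right _ _, fun y hy => image_eq_zero_of_notMem_tsupport fun hy' => ?_⟩
    have := hr hy'
    rw [mem_closedBall_zero_iff] at this
    exact absurd hy (not_lt.2 (this.trans (le_max_left _ _)))
  set φR : ℕ → Rn n → ℝ := fun j z => φ (0 + ((j : ℝ) + 1)⁻¹ • z) with hφR
  have hφRs (j : ℕ) : ContDiff ℝ ∞ (φR j) := φ.contDiff.comp (by fun_prop)
  have hφRc (j : ℕ) : HasCompactSupport (φR j) := by
    refine HasCompactSupport.intro (isCompact_closedBall (0 : Rn n) (2 * ((j : ℝ) + 1)))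
      fun z hz => hφ0 _ ?_
    have hj : (0 : ℝ) < j + 1 := by positivity
    rw [zero_add, norm_smul, Real.norm_of_nonneg (by positivity), inv_mul_eq_div, lt_div_iff₀ hj]
    simpa using hz
  have hφR1 (j : ℕ) : φR j =ᶠ[𝓝 0] fun _ => 1 := by
    have h1 : Continuous fun z : Rn n => 0 + ((j : ℝ) + 1)⁻¹ • z := by fun_prop
    have h2 := h1.tendsto 0
    simp only [smul_zero, add_zero] at h2
    exact h2.eventually hφ1
  have hscale (j : ℕ) (z : Rn n) :
      ‖negLaplacianPow m (smoothedRieszKernel q (φR j)) z‖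
        ≤ C * (((j : ℝ) + 1 + ‖z‖) ^ n)⁻¹ := by
    set R : ℝ := (j : ℝ) + 1 with hR
    have hR0 : 0 < R := by positivity
    have h1 : smoothedRieszKernel q (φR j)
        = fun z => (R⁻¹ ^ (2 * q)) • smoothedRieszKernel q φ (0 + R⁻¹ • z) := by
      ext z
      have h1 : R⁻¹ ^ (2 * q) * (R⁻¹ ^ (2 * q))⁻¹ = 1 := mul_inv_cancel₀ (by positivity)
      simp only [smoothedRieszKernel, hφR, zero_add, rieszKernel_smul, Complex.real_smul,
        ← hR, ← Complex.ofReal_mul]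
      congr 1
      rw [← mul_assoc, ← mul_assoc, h1]
      ring
    have h2 : R⁻¹ ^ n = R⁻¹ ^ (2 * q) * R⁻¹ ^ (2 * m) := by
      rw [← pow_add, add_comm, ← hn]
    rw [h1, negLaplacianPow_const_smul, negLaplacianPow_comp_affine]
    simp only [zero_add, smul_smul, ← h2]
    rw [norm_smul, Real.norm_of_nonneg (by positivity)]
    calc R⁻¹ ^ n * ‖negLaplacianPow m (smoothedRieszKernel q φ) (R⁻¹ • z)‖
        ≤ R⁻¹ ^ n * (C * ((1 + ‖R⁻¹ • z‖) ^ n)⁻¹) := by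
          gcongr
          exact hC _
      _ = C * ((R + ‖z‖) ^ n)⁻¹ := by
          rw [norm_smul, Real.norm_of_nonneg (by positivity), mul_left_comm, inv_pow, ← mul_inv,
            ← mul_pow]
          congr 4
          field_simp
  refine ⟨fun j x => rieszConst n m • ((fun z => rieszKernel q z * φR j z)
      ⋆[ContinuousLinearMap.lsmul ℝ ℝ, volume] η) x,
    |rieszConst n m| * (C * 2 ^ n * ∫ y, ‖η y‖), fun j => ⟨?_, ?_⟩, ?_⟩
  · have hκ : LocallyIntegrable (fun z : Rn n => rieszKernel q z * φR j z) :=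
      (integrable_rieszKernel_smul hm hn (hφRs j).continuous (hφRc j)).locallyIntegrable
    exact (hηc.contDiff_convolution_right _ hκ hη).const_smul _
  · have := ((hφRc j).mul_left (f := rieszKernel q)).convolution
      (L := ContinuousLinearMap.lsmul ℝ ℝ) (μ := volume) hηc
    exact this.smul_left (f := fun _ => rieszConst n m)
  obtain ⟨N, hN⟩ := exists_nat_gt (2 * ρ)
  filter_upwards [eventually_ge_atTop N] with j hj x
  rw [sub_negLaplacianPow_convolution hm hq hn (hφRs j) (hφRc j) (hφR1 j) hη hηc, norm_mul,
    Complex.norm_real, Real.norm_eq_abs, mul_assoc]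
  have hRρ : 2 * ρ ≤ (j : ℝ) + 1 := by
    have : (N : ℝ) ≤ j := by exact_mod_cast hj
    linarith
  gcongr
  have hηi : Integrable (fun z => ‖η (x - z)‖) :=
    ((hη.continuous.integrable_of_hasCompactSupport hηc).comp_sub_left x).norm
  calc ‖∫ z, negLaplacianPow m (smoothedRieszKernel q (φR j)) z * η (x - z)‖
      ≤ ∫ z, (C * 2 ^ n * (((j : ℝ) + 1 + ‖x‖) ^ n)⁻¹) * ‖η (x - z)‖ := by
        refine norm_integral_le_of_norm_le (hηi.const_mul _) (.of_forall fun z => ?_)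
        rw [norm_mul]
        by_cases hz : ρ < ‖x - z‖
        · simp [hρ _ hz]
        · gcongr
          refine (hscale j z).trans ?_
          have h1 : ‖x‖ ≤ ρ + ‖z‖ := by
            have h2 := norm_add_le (x - z) z
            rw [sub_add_cancel] at h2
            linarith
          rw [mul_assoc, ← div_eq_mul_inv (2 ^ n), ← div_pow, ← inv_pow]
          gcongr
          rw [inv_le_comm₀ (by positivity) (by positivity), inv_div]
          linarith [norm_nonneg z]
    _ = _ := by
        rw [integral_const_mul, integral_sub_left_eq_self (fun y => ‖η y‖) volume x]; ring

/-- A function in `L²_{-s}` with `2s < n` that satisfies `(-Δ)^m u = 0` vanishes. -/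
theorem ae_eq_zero_of_polyharmonic (hm : 1 ≤ m) (hq : 1 ≤ q) (hn : n = 2 * m + 2 * q)
    {u : Rn n → ℂ} (hu : LocallyIntegrable u) {s : ℝ} (hs : 2 * s < n) (hus : MemWeightedL2 (-s) u)
    (h : ∀ χ : Rn n → ℂ, ContDiff ℝ ∞ χ → HasCompactSupport χ →
      ∫ x, u x * negLaplacianPow m χ x = 0) : u =ᵐ[volume] 0 := by
  refine ae_eq_zero_of_integral_contDiff_smul_eq_zero hu fun g hg hgc => ?_
  set η : Rn n → ℂ := fun x => (g x : ℂ) with hη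
  have hηs : ContDiff ℝ ∞ η := Complex.ofRealCLM.contDiff.comp hg
  have hηc : HasCompactSupport η := hgc.comp_left (g := Complex.ofReal) rfl
  obtain ⟨T, D, hT, hD⟩ := exists_negLaplacianPow_approx hm hq hn hηs hηc
  have hi1 {χ : Rn n → ℂ} (hχ : Continuous χ) (hχc : HasCompactSupport χ) :
      Integrable (fun x => u x * χ x) := by
    simpa using hu.integrable_smul_right_of_hasCompactSupport hχ hχc
  have hc (j : ℕ) : Continuous (negLaplacianPow m (T j)) :=
    (contDiff_negLaplacianPow (hT j).1 m).continuous
  have hdecay : Integrable (fun x => ‖u x‖ * (1 + ‖x‖) ^ (-(n : ℝ))) :=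
    integrable_mul_one_add_norm_rpow hus (by linarith)
  have hlim : Tendsto (fun j => ∫ x, u x * (η x - negLaplacianPow m (T j) x)) atTop (𝓝 0) := by
    have hlim0 : Tendsto (fun j => ∫ x, u x * (η x - negLaplacianPow m (T j) x)) atTop
        (𝓝 (∫ _ : Rn n, (0 : ℂ))) := by
      refine tendsto_integral_filter_of_dominated_convergence
        (fun x => |D| * (‖u x‖ * (1 + ‖x‖) ^ (-(n : ℝ)))) (.of_forall fun j => ?_) ?_
        (hdecay.const_mul _) (.of_forall fun x => ?_)
      · exact hu.aestronglyMeasurable.mul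
          (hηs.continuous.sub (hc j)).aestronglyMeasurable
      · filter_upwards [hD] with j hj
        refine .of_forall fun x => ?_
        rw [norm_mul, mul_left_comm]
        gcongr
        refine (hj x).trans ?_
        rw [Real.rpow_neg (by positivity), Real.rpow_natCast]
        refine mul_le_mul (le_abs_self D) ?_ (by positivity) (abs_nonneg _)
        gcongr
        linarith [Nat.cast_nonneg (α := ℝ) j]
      · rw [← mul_zero (u x)]
        refine tendsto_const_nhds.mul (squeeze_zero_norm' (hD.mono fun j hj => hj x) ?_)
        rw [← mul_zero D]
        refine tendsto_const_nhds.mul (Tendsto.inv_tendsto_atTop ?_)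
        refine (tendsto_pow_atTop (by omega)).comp ?_
        exact tendsto_atTop_add_const_right _ _
          (tendsto_atTop_add_const_right _ _ tendsto_natCast_atTop_atTop)
    simpa using hlim0
  have hconst (j : ℕ) : ∫ x, u x * (η x - negLaplacianPow m (T j) x) = ∫ x, g x • u x := by
    simp_rw [mul_sub]
    rw [integral_sub (hi1 hηs.continuous hηc)
      (hi1 (hc j) (hasCompactSupport_negLaplacianPow (hT j).2 m)), h _ (hT j).1 (hT j).2, sub_zero]
    refine integral_congr_ae (.of_forall fun x => ?_)
    simp [hη, mul_comm]
  exact (tendsto_nhds_unique hlim (tendsto_const_nhds.congr fun j => (hconst j).symm)).symm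

end

section

open scoped ENNReal ComplexConjugate

variable {n m k q : ℕ} {V : Rn n → ℝ}

/-! ### The operators `T₀`, `P` and `vG_jv` -/

/-- The decay of `V` that the argument uses, in terms of `v = |V|^{1/2}`. -/
structure HasDecay (m k : ℕ) (V : Rn n → ℝ) : Prop where
  aestronglyMeasurable : AEStronglyMeasurable V volume
  memLp : MemLp (fun x => (1 + ‖x‖) ^ (2 * k) * vPot V x) 2 volume
  bounded : ∃ B, ∀ᵐ x, (1 + ‖x‖) ^ (2 * m + 1) * vPot V x ≤ B

theorem vPot_nonneg (x : Rn n) : 0 ≤ vPot V x := Real.sqrt_nonneg _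

theorem sq_vPot (x : Rn n) : vPot V x ^ 2 = |V x| := Real.sq_sqrt (abs_nonneg _)

theorem uSign_mul_self (x : Rn n) : uSign V x * uSign V x = 1 := by
  unfold uSign; split_ifs <;> norm_num

theorem abs_uSign (x : Rn n) : |uSign V x| = 1 := by
  unfold uSign; split_ifs <;> norm_num

theorem uSign_mul_abs (x : Rn n) : uSign V x * |V x| = V x := by
  unfold uSign
  split_ifs with h
  · rw [abs_of_nonneg h, one_mul]
  · rw [abs_of_neg (not_le.1 h)]; ring

theorem hasDecay_of_le (hn : n + 2 * k = 4 * m + 2) (hV : AEStronglyMeasurable V volume) {β C : ℝ}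
    (hβ : (n : ℝ) + 4 * k < β) (hdecay : ∀ᵐ x : Rn n, |V x| ≤ C * (1 + ‖x‖) ^ (-β)) :
    HasDecay m k V := by
  have hn' : (n : ℝ) + 2 * k = 4 * m + 2 := by exact_mod_cast hn
  have hvm : AEStronglyMeasurable (vPot V) volume :=
    Real.continuous_sqrt.comp_aestronglyMeasurable (hV.norm)
  have hv : ∀ᵐ x : Rn n, vPot V x ≤ √|C| * (1 + ‖x‖) ^ (-(β / 2)) := by
    filter_upwards [hdecay] with x hx
    have h1 : (0 : ℝ) < 1 + ‖x‖ := by positivity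
    refine Real.sqrt_le_iff.2 ⟨by positivity, hx.trans ?_⟩
    rw [mul_pow, Real.sq_sqrt (abs_nonneg _), ← Real.rpow_natCast, ← Real.rpow_mul h1.le]
    have : -(β / 2) * (2 : ℕ) = -β := by push_cast; ring
    rw [this]
    gcongr
    exact le_abs_self C
  have hweight (N : ℕ) : ∀ᵐ x : Rn n, (1 + ‖x‖) ^ N * vPot V x
      ≤ √|C| * (1 + ‖x‖) ^ (-(β / 2 - N)) := by
    filter_upwards [hv] with x hx
    have h1 : (0 : ℝ) < 1 + ‖x‖ := by positivity
    calc (1 + ‖x‖) ^ N * vPot V x ≤ (1 + ‖x‖) ^ N * (√|C| * (1 + ‖x‖) ^ (-(β / 2))) := by gcongr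
      _ = √|C| * ((1 + ‖x‖) ^ (N : ℝ) * (1 + ‖x‖) ^ (-(β / 2))) := by
          rw [Real.rpow_natCast]; ring
      _ = _ := by
          rw [← Real.rpow_add h1]
          congr 2; ring
  refine ⟨hV, ?_, √|C|, ?_⟩
  · have hk : (n : ℝ) < 2 * (β / 2 - (2 * k : ℕ)) := by push_cast; linarith
    refine ((memLp_two_one_add_norm_rpow hk).const_mul (√|C|)).mono'
      ((by fun_prop : Continuous fun x : Rn n => (1 + ‖x‖) ^ (2 * k)).aestronglyMeasurable.mul
        hvm) ?_
    filter_upwards [hweight (2 * k)] with x hx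
    rwa [Real.norm_of_nonneg (mul_nonneg (by positivity) (vPot_nonneg x))]
  · filter_upwards [hweight (2 * m + 1)] with x hx
    refine hx.trans (mul_le_of_le_one_right (Real.sqrt_nonneg _) ?_)
    refine Real.rpow_le_one_of_one_le_of_nonpos (by linarith [norm_nonneg x]) ?_
    push_cast
    have : (0 : ℝ) ≤ k := by positivity
    linarith

namespace HasDecay

theorem aestronglyMeasurable_vPot (hV : HasDecay m k V) : AEStronglyMeasurable (vPot V) volume :=
  Real.continuous_sqrt.comp_aestronglyMeasurable hV.aestronglyMeasurable.norm

theorem aestronglyMeasurable_uSign (hV : HasDecay m k V) : AEStronglyMeasurable (uSign V) volume := by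
  have h : Measurable fun r : ℝ => if 0 ≤ r then (1 : ℝ) else -1 :=
    Measurable.ite measurableSet_Ici measurable_const measurable_const
  exact (h.comp_aemeasurable hV.aestronglyMeasurable.aemeasurable).aestronglyMeasurable

theorem exists_vPot_le (hV : HasDecay m k V) : ∃ B, 0 ≤ B ∧ ∀ᵐ x, (1 + ‖x‖) ^ (2 * m + 1) * vPot V x ≤ B ∧
    vPot V x ≤ B := by
  obtain ⟨B, hB⟩ := hV.bounded
  refine ⟨|B|, abs_nonneg _, ?_⟩
  filter_upwards [hB] with x hx
  refine ⟨hx.trans (le_abs_self B), le_trans ?_ (hx.trans (le_abs_self B))⟩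
  exact le_mul_of_one_le_left (vPot_nonneg x) (one_le_pow₀ (by linarith [norm_nonneg x]))

theorem memLp_vPot (hV : HasDecay m k V) : MemLp (vPot V) 2 volume := by
  refine hV.memLp.mono hV.aestronglyMeasurable_vPot (.of_forall fun x => ?_)
  rw [norm_mul, Real.norm_of_nonneg (by positivity : (0 : ℝ) ≤ (1 + ‖x‖) ^ (2 * k))]
  exact le_mul_of_one_le_left (norm_nonneg _) (one_le_pow₀ (by linarith [norm_nonneg x]))

theorem aestronglyMeasurable_kernel (hV : HasDecay m k V) {K : Rn n → Rn n → ℝ} (hK : Measurable (Function.uncurry K)) :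
    AEStronglyMeasurable (Function.uncurry fun x y => vPot V x * K x y * vPot V y)
      (volume.prod volume) :=
  (hV.aestronglyMeasurable_vPot.comp_fst.mul hK.aestronglyMeasurable).mul
    hV.aestronglyMeasurable_vPot.comp_snd

/-- `v(x) |x - y|^{2j} v(y)` is dominated by a kernel of rank one. -/
theorem representedBy_opOf_polynomial (hV : HasDecay m k V) {a : Rn n → ℝ} (ha : AEStronglyMeasurable a volume)
    (ha1 : ∀ x, |a x| ≤ 1) (r : ℝ) {j : ℕ} (hj : j ≤ k) :
    RepresentedBy a (fun x y => r * (vPot V x * ‖x - y‖ ^ (2 * j) * vPot V y))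
      (opOf a (fun x y => r * (vPot V x * ‖x - y‖ ^ (2 * j) * vPot V y))) := by
  set w : Rn n → ℝ := fun x => (1 + ‖x‖) ^ (2 * k) * vPot V x with hw
  have hwe : AEMeasurable fun x => ‖w x‖ₑ := hV.memLp.1.enorm
  have hfin := MemLp.lintegral_sq_ne_top hV.memLp
  refine L2BoundedKernel.representedBy_opOf ha ha1
    (A := ‖r‖ₑ ^ 2 * ((∫⁻ x, ‖w x‖ₑ ^ 2) * ∫⁻ x, ‖w x‖ₑ ^ 2)) ?_ ?_ ?_
  · have := hV.aestronglyMeasurable_kernel (K := fun x y => ‖x - y‖ ^ (2 * j))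
      (by unfold Function.uncurry; fun_prop)
    exact this.const_mul r
  · refine L2BoundedKernel.mono ((L2BoundedKernel.rankOne hwe hwe).const_mul
      enorm_ne_top)
      (.of_forall fun x => .of_forall fun y => ?_)
    rw [enorm_mul, ← enorm_mul (w x)]
    gcongr
    rw [← ofReal_norm, ← ofReal_norm]
    refine ENNReal.ofReal_le_ofReal ?_
    have h1 := vPot_nonneg (V := V) x
    have h2 := vPot_nonneg (V := V) y
    rw [Real.norm_of_nonneg (by positivity), Real.norm_of_nonneg (by positivity), hw]
    have h3 : ‖x - y‖ ≤ (1 + ‖x‖) * (1 + ‖y‖) := by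
      have := norm_sub_le x y
      nlinarith [norm_nonneg x, norm_nonneg y]
    have h4 : ‖x - y‖ ^ (2 * j) ≤ (1 + ‖x‖) ^ (2 * k) * (1 + ‖y‖) ^ (2 * k) := by
      rw [← mul_pow]
      calc ‖x - y‖ ^ (2 * j) ≤ ((1 + ‖x‖) * (1 + ‖y‖)) ^ (2 * j) := by gcongr
        _ ≤ _ := by
          refine pow_le_pow_right₀ ?_ (by omega)
          nlinarith [norm_nonneg x, norm_nonneg y]
    calc vPot V x * ‖x - y‖ ^ (2 * j) * vPot V y
        ≤ vPot V x * ((1 + ‖x‖) ^ (2 * k) * (1 + ‖y‖) ^ (2 * k)) * vPot V y := by gcongr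
      _ = _ := by ring
  · exact ENNReal.mul_ne_top (by simp) (ENNReal.mul_ne_top hfin hfin)

/-- `v(x) |x - y|^{-2q} v(y)` is dominated by the sum of an integrable function of `x - y` and a kernel
of rank one. -/
theorem representedBy_T0 (hV : HasDecay m k V) (hm : 1 ≤ m) (hn : n = 2 * m + 2 * q) :
    RepresentedBy (uSign V) (vGv m V 0) (T0 m V) := by
  obtain ⟨B, hB0, hB⟩ := hV.exists_vPot_le
  have hKeq : vGv m V 0 = fun x y =>
      vPot V x * (rieszConst n m * rieszKernel q (x - y)) * vPot V y := by
    ext x y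
    rw [vGv, G_zero_eq hn]
  have hve : AEMeasurable fun x => ‖vPot V x‖ₑ := hV.aestronglyMeasurable_vPot.enorm
  have htfin : (∫⁻ z : Rn n, ‖truncatedKernel m q z‖ₑ) ≠ ⊤ :=
    (integrable_truncatedKernel hm hn).2.ne
  have hvfin := MemLp.lintegral_sq_ne_top hV.memLp_vPot
  have htm : Measurable fun p : Rn n × Rn n => truncatedKernel m q (p.1 - p.2) := by fun_prop
  have hb := (((l2BoundedKernel_truncatedKernel (n := n) (m := m) (q := q)).const_mul
      (enorm_ne_top (x := 2 ^ (2 * m + 1) * B ^ 2))).add (by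
        exact (htm.enorm.const_mul _).aemeasurable) (L2BoundedKernel.rankOne hve hve)).const_mul
      (enorm_ne_top (x := rieszConst n m))
  refine L2BoundedKernel.representedBy_opOf hV.aestronglyMeasurable_uSign
    (fun x => (abs_uSign x).le) ?_ (L2BoundedKernel.mono hb ?_) ?_
  · rw [hKeq]
    refine hV.aestronglyMeasurable_kernel ?_
    exact measurable_rieszKernel_sub.const_mul _
  · filter_upwards [hB] with x hx
    filter_upwards [hB] with y hy
    have h1 := vPot_nonneg (V := V) x
    have h2 := vPot_nonneg (V := V) y
    have h3 := truncatedKernel_nonneg (m := m) (q := q) (x - y)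
    rw [hKeq]
    simp only
    have hK : vPot V x * (rieszConst n m * rieszKernel q (x - y)) * vPot V y
        = rieszConst n m * (vPot V x * (rieszKernel q (x - y) * vPot V y)) := by ring
    rw [hK, enorm_mul, ← enorm_mul (2 ^ (2 * m + 1) * B ^ 2), ← enorm_mul (vPot V x)]
    gcongr
    have h4 := rieszKernel_nonneg (q := q) (x - y)
    rw [← ofReal_norm, ← ofReal_norm, ← ofReal_norm, ← ENNReal.ofReal_add (by positivity)
      (by positivity), Real.norm_of_nonneg (by positivity), Real.norm_of_nonneg (by positivity),
      Real.norm_of_nonneg (by positivity)]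
    refine ENNReal.ofReal_le_ofReal ?_
    calc vPot V x * (rieszKernel q (x - y) * vPot V y)
        ≤ vPot V x * ((2 ^ (2 * m + 1) * (truncatedKernel m q (x - y) * (1 + ‖y‖) ^ (2 * m + 1)) + 1)
            * vPot V y) := by
          gcongr
          exact rieszKernel_le x y
      _ = vPot V x * (2 ^ (2 * m + 1) * truncatedKernel m q (x - y)) *
            ((1 + ‖y‖) ^ (2 * m + 1) * vPot V y) + vPot V x * vPot V y := by ring
      _ ≤ B * (2 ^ (2 * m + 1) * truncatedKernel m q (x - y)) * B + vPot V x * vPot V y := by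
          gcongr
          · exact hx.2
          · exact hy.1
      _ = _ := by ring
  · finiteness

end HasDecay

end

section

open scoped ENNReal ComplexConjugate RealInnerProductSpace

variable {n m k q : ℕ} {V : Rn n → ℝ}

/-! ### The spaces `S_j L²` in terms of moments -/

namespace HasDecay

theorem aestronglyMeasurable_vPot_mul (hV : HasDecay m k V) {φ : Rn n → ℂ}
    (hφ : AEStronglyMeasurable φ volume) :
    AEStronglyMeasurable (fun y => (vPot V y : ℂ) * φ y) volume :=
  (Complex.continuous_ofReal.comp_aestronglyMeasurable hV.aestronglyMeasurable_vPot).mul hφ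

theorem integrable_weight (hV : HasDecay m k V) {φ : Rn n → ℂ} (hφ : MemLp φ 2 volume) :
    Integrable (fun y => (1 + ‖y‖) ^ (2 * k) * ‖(vPot V y : ℂ) * φ y‖) := by
  refine (hV.memLp.integrable_mul hφ.norm).congr (.of_forall fun y => ?_)
  simp only [Pi.mul_apply, norm_mul, Complex.norm_real, Real.norm_of_nonneg (vPot_nonneg y)]
  ring

theorem memLp_weight (hV : HasDecay m k V) {φ : Rn n → ℂ} (hφ : MemLp φ 2 volume) :
    MemLp (fun y => (1 + ‖y‖) ^ (2 * m + 1) * ‖(vPot V y : ℂ) * φ y‖) 2 volume := by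
  obtain ⟨B, -, hB⟩ := hV.exists_vPot_le
  refine (hφ.norm.const_mul B).mono'
    ((by fun_prop : Continuous fun y : Rn n => (1 + ‖y‖) ^ (2 * m + 1)).aestronglyMeasurable.mul
      (hV.aestronglyMeasurable_vPot_mul hφ.1).norm) ?_
  filter_upwards [hB] with y hy
  rw [Real.norm_of_nonneg (by positivity), norm_mul, Complex.norm_real,
    Real.norm_of_nonneg (vPot_nonneg y), ← mul_assoc]
  gcongr
  exact hy.1

end HasDecay

/-- The coefficients in the expansion of `|x - y|^{2l}` into products of monomials. -/
noncomputable def expansionCoeff (l c a : ℕ) : ℝ := (-2) ^ c * l.choose c * (l - c).choose a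

theorem norm_sub_pow_eq_sum (l : ℕ) (x y : Rn n) :
    ‖x - y‖ ^ (2 * l) = ∑ c ∈ Finset.range (l + 1), ∑ a ∈ Finset.range (l - c + 1),
      ∑ i : Fin c → Fin n,
        expansionCoeff l c a * (monomialFn a i x * monomialFn (l - c - a) i y) := by
  have h : ‖x - y‖ ^ 2 = -2 * ⟪x, y⟫ + (‖x‖ ^ 2 + ‖y‖ ^ 2) := by
    rw [norm_sub_sq_real]; ring
  rw [pow_mul, h, add_pow]
  refine Finset.sum_congr rfl fun c _ => ?_
  rw [add_pow, Finset.mul_sum, Finset.sum_mul]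
  refine Finset.sum_congr rfl fun a _ => ?_
  have h1 : ∑ i : Fin c → Fin n,
      expansionCoeff l c a * (monomialFn a i x * monomialFn (l - c - a) i y)
      = expansionCoeff l c a * (‖x‖ ^ (2 * a) * (⟪x, y⟫ ^ c * ‖y‖ ^ (2 * (l - c - a)))) := by
    rw [inner_pow_mul_norm_pow, Finset.mul_sum, Finset.mul_sum]
    refine Finset.sum_congr rfl fun i _ => ?_
    rw [monomialFn]
    ring
  rw [h1, expansionCoeff, mul_pow, pow_mul ‖x‖, pow_mul ‖y‖]
  ring

/-- The moment `∫ |y|^{2a} y_{i(1)} ⋯ y_{i(c)} f(y) dy`. -/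
noncomputable def moment (a : ℕ) {c : ℕ} (i : Fin c → Fin n) (f : Rn n → ℂ) : ℂ :=
  ∫ y, (monomialFn a i y : ℂ) * f y

theorem integral_norm_sub_pow_mul {f : Rn n → ℂ} {l L : ℕ} (hl : 2 * l ≤ L)
    (hfm : AEStronglyMeasurable f volume) (hf : Integrable (fun y => (1 + ‖y‖) ^ L * ‖f y‖))
    (x : Rn n) :
    ∫ y, ((‖x - y‖ ^ (2 * l) : ℝ) : ℂ) * f y
      = ∑ c ∈ Finset.range (l + 1), ∑ a ∈ Finset.range (l - c + 1), ∑ i : Fin c → Fin n,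
        (expansionCoeff l c a * monomialFn a i x : ℝ) * moment (l - c - a) i f := by
  have h1 (y : Rn n) : ((‖x - y‖ ^ (2 * l) : ℝ) : ℂ) * f y
      = ∑ c ∈ Finset.range (l + 1), ∑ a ∈ Finset.range (l - c + 1), ∑ i : Fin c → Fin n,
        (expansionCoeff l c a * monomialFn a i x : ℝ) *
          ((monomialFn (l - c - a) i y : ℂ) * f y) := by
    rw [norm_sub_pow_eq_sum]
    push_cast
    simp_rw [Finset.sum_mul]
    refine Finset.sum_congr rfl fun c _ => Finset.sum_congr rfl fun a _ =>
      Finset.sum_congr rfl fun i _ => by ring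
  have hint {c a : ℕ} (hc : c ∈ Finset.range (l + 1)) (ha : a ∈ Finset.range (l - c + 1))
      (i : Fin c → Fin n) : Integrable (fun y => ((expansionCoeff l c a * monomialFn a i x : ℝ) : ℂ)
        * ((monomialFn (l - c - a) i y : ℂ) * f y)) := by
    refine (integrable_monomialFn_mul hfm hf i ?_).const_mul _
    rw [Finset.mem_range] at hc ha
    omega
  simp_rw [h1]
  rw [integral_finsetSum _ fun c hc => integrable_finsetSum _ fun a ha =>
    integrable_finsetSum _ fun i _ => hint hc ha i]
  refine Finset.sum_congr rfl fun c hc => ?_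
  rw [integral_finsetSum _ fun a ha => integrable_finsetSum _ fun i _ => hint hc ha i]
  refine Finset.sum_congr rfl fun a ha => ?_
  rw [integral_finsetSum _ fun i _ => hint hc ha i]
  refine Finset.sum_congr rfl fun i _ => ?_
  rw [integral_const_mul]
  rfl

/-- The sesquilinear form of an operator with the kernel `r v(x) |x - y|^{2l} v(y)`. -/
theorem inner_eq_sum_moment (hV : HasDecay m k V) {r : ℝ} {l : ℕ} (hl : l ≤ k)
    {T : L2 n →L[ℂ] L2 n}
    (hT : RepresentedBy 0 (fun x y => r * (vPot V x * ‖x - y‖ ^ (2 * l) * vPot V y)) T)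
    (g φ : L2 n) :
    inner ℂ g (T φ) = r * ∑ c ∈ Finset.range (l + 1), ∑ a ∈ Finset.range (l - c + 1),
      ∑ i : Fin c → Fin n, (expansionCoeff l c a : ℂ) *
        (conj (moment a i fun y => (vPot V y : ℂ) * g y) *
          moment (l - c - a) i fun y => (vPot V y : ℂ) * φ y) := by
  set f : Rn n → ℂ := fun y => (vPot V y : ℂ) * φ y with hf
  have hfm := hV.aestronglyMeasurable_vPot_mul (Lp.memLp φ).1
  have hfi := hV.integrable_weight (Lp.memLp φ)
  have hgm := hV.aestronglyMeasurable_vPot_mul (Lp.memLp g).1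
  have hgi := hV.integrable_weight (Lp.memLp g)
  have hl2 : 2 * l ≤ 2 * k := by omega
  have h1 : (fun x => inner ℂ (g x) (T φ x)) =ᵐ[volume] fun x =>
      (r : ℂ) * ∑ c ∈ Finset.range (l + 1), ∑ a ∈ Finset.range (l - c + 1), ∑ i : Fin c → Fin n,
        ((expansionCoeff l c a : ℂ) * moment (l - c - a) i f) *
          conj ((monomialFn a i x : ℂ) * ((vPot V x : ℂ) * g x)) := by
    filter_upwards [hT φ] with x hx
    have h2 : ∫ y, ((r * (vPot V x * ‖x - y‖ ^ (2 * l) * vPot V y) : ℝ) : ℂ) * φ y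
        = r * vPot V x * ∫ y, ((‖x - y‖ ^ (2 * l) : ℝ) : ℂ) * f y := by
      rw [← integral_const_mul]
      refine integral_congr_ae (.of_forall fun y => ?_)
      simp only [hf]
      push_cast; ring
    rw [RCLike.inner_apply, hx.2, h2, integral_norm_sub_pow_mul hl2 hfm hfi]
    simp only [Pi.zero_apply, Complex.ofReal_zero, zero_mul, zero_add, Finset.mul_sum,
      Finset.sum_mul, map_mul, Complex.conj_ofReal]
    refine Finset.sum_congr rfl fun c _ => Finset.sum_congr rfl fun a _ =>
      Finset.sum_congr rfl fun i _ => ?_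
    push_cast; ring
  have hint {c a : ℕ} (hc : c ∈ Finset.range (l + 1)) (ha : a ∈ Finset.range (l - c + 1))
      (i : Fin c → Fin n) : Integrable (fun x =>
        ((expansionCoeff l c a : ℂ) * moment (l - c - a) i f) *
          conj ((monomialFn a i x : ℂ) * ((vPot V x : ℂ) * g x))) := by
    have h3 : Integrable (fun x => (monomialFn a i x : ℂ) * ((vPot V x : ℂ) * g x)) := by
      refine integrable_monomialFn_mul hgm hgi i ?_
      rw [Finset.mem_range] at hc ha
      omega
    refine Integrable.const_mul ?_ _
    exact Complex.conjCLE.toContinuousLinearMap.integrable_comp h3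
  rw [L2.inner_def, integral_congr_ae h1, integral_const_mul]
  congr 1
  rw [integral_finsetSum _ fun c hc => integrable_finsetSum _ fun a ha =>
    integrable_finsetSum _ fun i _ => hint hc ha i]
  refine Finset.sum_congr rfl fun c hc => ?_
  rw [integral_finsetSum _ fun a ha => integrable_finsetSum _ fun i _ => hint hc ha i]
  refine Finset.sum_congr rfl fun a ha => ?_
  rw [integral_finsetSum _ fun i _ => hint hc ha i]
  refine Finset.sum_congr rfl fun i _ => ?_
  rw [integral_const_mul, integral_conj, moment, moment]
  ring

section QuadraticForm

variable {r : ℝ} {l : ℕ} {T : L2 n →L[ℂ] L2 n}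

/-- Each product of moments in `⟨g, v |x - y|^{2l} v φ⟩` has a factor of degree `< l` from `g` or one of
degree `≤ l` from `φ`. -/
theorem inner_eq_zero_of_vanishingMoments (hV : HasDecay m k V) (hl : l ≤ k)
    (hT : RepresentedBy 0 (fun x y => r * (vPot V x * ‖x - y‖ ^ (2 * l) * vPot V y)) T)
    {g φ : L2 n} (hg : VanishingMoments l fun y => (vPot V y : ℂ) * g y)
    (hφ : VanishingMoments (l + 1) fun y => (vPot V y : ℂ) * φ y) : inner ℂ g (T φ) = 0 := by
  rw [inner_eq_sum_moment hV hl hT]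
  refine mul_eq_zero_of_right _ (Finset.sum_eq_zero fun c hc => Finset.sum_eq_zero fun a ha =>
    Finset.sum_eq_zero fun i _ => mul_eq_zero_of_right _ ?_)
  rw [Finset.mem_range] at hc ha
  rcases lt_or_ge (2 * a + c) l with h | h
  · rw [moment, hg a c i h, map_zero, zero_mul]
  · rw [moment, moment, hφ _ c i (by omega), mul_zero]

/-- If the moments of `vφ` of degree `< l` vanish, then only products of moments of degree `l`
contribute to `⟨φ, v |x - y|^{2l} v φ⟩`, and their coefficients have the sign `(-1)^l`. -/
theorem VanishingMoments.succ_of_inner_eq_zero (hV : HasDecay m k V) (hl : l ≤ k) (hr : r ≠ 0)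
    (hT : RepresentedBy 0 (fun x y => r * (vPot V x * ‖x - y‖ ^ (2 * l) * vPot V y)) T)
    {φ : L2 n} (hφ : VanishingMoments l fun y => (vPot V y : ℂ) * φ y)
    (h : inner ℂ φ (T φ) = 0) : VanishingMoments (l + 1) fun y => (vPot V y : ℂ) * φ y := by
  set f : Rn n → ℂ := fun y => (vPot V y : ℂ) * φ y with hf
  rw [inner_eq_sum_moment hV hl hT, mul_eq_zero, Complex.ofReal_eq_zero] at h
  replace h := h.resolve_left hr
  have hterm (c : ℕ) (hc : c ∈ Finset.range (l + 1)) (a : ℕ) (ha : a ∈ Finset.range (l - c + 1))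
      (i : Fin c → Fin n) :
      (expansionCoeff l c a : ℂ) * (conj (moment a i f) * moment (l - c - a) i f)
        = (((-1) ^ l * (|expansionCoeff l c a| *
            if 2 * a + c = l then ‖moment a i f‖ ^ 2 else 0) : ℝ) : ℂ) := by
    rw [Finset.mem_range] at hc ha
    split_ifs with hac
    · have h1 : l - c - a = a := by omega
      have h2 : expansionCoeff l c a = (-1) ^ l * |expansionCoeff l c a| := by
        have h3 : ((-1 : ℝ)) ^ l = (-1) ^ c := by
          rw [← hac, pow_add, pow_mul]; norm_num
        rw [h3, expansionCoeff, abs_mul, abs_mul, abs_pow, abs_neg, abs_two, Nat.abs_cast,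
          Nat.abs_cast, ← mul_assoc, ← mul_assoc, ← mul_pow]
        norm_num
      rw [h1, Complex.conj_mul', ← mul_assoc ((-1) ^ l), ← h2]
      push_cast
      rfl
    · rcases lt_or_ge (2 * a + c) l with hlt | hge
      · have : moment a i f = 0 := hφ a c i hlt
        rw [this]; simp
      · have : moment (l - c - a) i f = 0 := hφ _ c i (by omega)
        rw [this]; simp
  have hsum : ∑ c ∈ Finset.range (l + 1), ∑ a ∈ Finset.range (l - c + 1), ∑ i : Fin c → Fin n,
      (|expansionCoeff l c a| * if 2 * a + c = l then ‖moment a i f‖ ^ 2 else 0) = 0 := by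
    have h1 : (((-1) ^ l * ∑ c ∈ Finset.range (l + 1), ∑ a ∈ Finset.range (l - c + 1),
        ∑ i : Fin c → Fin n, (|expansionCoeff l c a| *
          if 2 * a + c = l then ‖moment a i f‖ ^ 2 else 0) : ℝ) : ℂ) = 0 := by
      rw [← h, Finset.mul_sum, Complex.ofReal_sum]
      refine Finset.sum_congr rfl fun c hc => ?_
      rw [Finset.mul_sum, Complex.ofReal_sum]
      refine Finset.sum_congr rfl fun a ha => ?_
      rw [Finset.mul_sum, Complex.ofReal_sum]
      exact Finset.sum_congr rfl fun i _ => (hterm c hc a ha i).symm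
    rw [Complex.ofReal_eq_zero, mul_eq_zero] at h1
    exact h1.resolve_left (pow_ne_zero _ (by norm_num))
  have hnn (c a : ℕ) (i : Fin c → Fin n) :
      0 ≤ |expansionCoeff l c a| * if 2 * a + c = l then ‖moment a i f‖ ^ 2 else 0 := by
    split_ifs <;> positivity
  intro a c i hac
  rcases Nat.lt_succ_iff_lt_or_eq.1 hac with hlt | heq
  · exact hφ a c i hlt
  rw [Finset.sum_eq_zero_iff_of_nonneg fun c _ => Finset.sum_nonneg fun a _ =>
    Finset.sum_nonneg fun i _ => hnn c a i] at hsum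
  have h1 := hsum c (by rw [Finset.mem_range]; omega)
  rw [Finset.sum_eq_zero_iff_of_nonneg fun a _ => Finset.sum_nonneg fun i _ => hnn c a i] at h1
  have h2 := h1 a (by rw [Finset.mem_range]; omega)
  rw [Finset.sum_eq_zero_iff_of_nonneg fun i _ => hnn c a i] at h2
  have h3 := h2 i (Finset.mem_univ _)
  rw [if_pos heq, mul_eq_zero] at h3
  have h4 : |expansionCoeff l c a| ≠ 0 := by
    rw [abs_ne_zero, expansionCoeff]
    have h5 : l.choose c ≠ 0 := (Nat.choose_pos (by omega)).ne'
    have h6 : (l - c).choose a ≠ 0 := (Nat.choose_pos (by omega)).ne'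
    simp [h5, h6]
  have h5 := h3.resolve_left h4
  exact norm_eq_zero.1 (pow_eq_zero_iff two_ne_zero |>.1 h5)

end QuadraticForm

theorem representedBy_P (hV : HasDecay m k V) :
    RepresentedBy 0 (fun x y => vPot V x * vPot V y / ∫ z, vPot V z ^ 2) (P V) := by
  have h := hV.representedBy_opOf_polynomial (a := 0) aestronglyMeasurable_zero (by simp)
    (∫ z, vPot V z ^ 2)⁻¹ (Nat.zero_le k)
  have heq : (fun x y => vPot V x * vPot V y / ∫ z, vPot V z ^ 2)
      = fun x y : Rn n => (∫ z, vPot V z ^ 2)⁻¹ * (vPot V x * ‖x - y‖ ^ (2 * 0) * vPot V y) := by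
    ext x y
    rw [mul_zero, pow_zero, mul_one, div_eq_inv_mul]
  rw [P, heq]
  exact h

theorem representedBy_A (hV : HasDecay m k V) {j : ℕ} (hj : j + 1 ≤ k) :
    RepresentedBy 0 (vGv m V (j + 2)) (A m V (j + 2)) := by
  have h := hV.representedBy_opOf_polynomial (a := 0) aestronglyMeasurable_zero (by simp) 1 hj
  simp only [one_mul] at h
  exact h

/-- The operators `P` and `vG_jv` have kernels `r v(x) |x - y|^{2l} v(y)`, where `r` vanishes only if
`v = 0`. -/
theorem exists_representedBy_A (hV : HasDecay m k V) {j : ℕ} (hj : j ≤ k) :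
    ∃ r : ℝ, (r = 0 → vPot V =ᵐ[volume] 0) ∧ RepresentedBy 0
      (fun x y => r * (vPot V x * ‖x - y‖ ^ (2 * j) * vPot V y)) (A m V (j + 1)) := by
  rcases j with - | j
  · refine ⟨(∫ z, vPot V z ^ 2)⁻¹, fun h => ?_, ?_⟩
    · rw [inv_eq_zero, integral_eq_zero_iff_of_nonneg (fun x => by positivity)
        hV.memLp_vPot.integrable_sq] at h
      filter_upwards [h] with x hx
      exact pow_eq_zero_iff two_ne_zero |>.1 hx
    · change RepresentedBy 0 _ (P V)
      have h := representedBy_P hV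
      simp only [div_eq_inv_mul] at h
      simpa using h
  · refine ⟨1, by simp, ?_⟩
    simp only [one_mul]
    exact representedBy_A hV hj

theorem mem_SL2_succ_iff {j : ℕ} {φ : L2 n} :
    φ ∈ SL2 m V (j + 1) ↔ S m V j φ = φ ∧ S m V j (A m V j (S m V j φ)) = 0 := by
  rw [SL2, S]
  erw [Submodule.range_starProjection]
  exact mem_compressedKer

/-- For `j ≤ k`, the space `S_{j+1} L²` consists of those `φ ∈ ker T₀` for which the moments of `vφ`
of degree `< j` vanish. -/
theorem mem_SL2_iff (hV : HasDecay m k V) {j : ℕ} (hj : j ≤ k) {φ : L2 n} :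
    φ ∈ SL2 m V (j + 1) ↔
      T0 m V φ = 0 ∧ VanishingMoments j fun y => (vPot V y : ℂ) * φ y := by
  induction j generalizing φ with
  | zero =>
    rw [mem_SL2_succ_iff]
    simp [S, A, VanishingMoments]
  | succ j ih =>
    have hS (g : L2 n) : S m V (j + 1) g = g ↔ g ∈ SL2 m V (j + 1) := by
      rw [SL2, S]
      erw [Submodule.range_starProjection]
      exact Submodule.starProjection_eq_self_iff
    have hS0 (g : L2 n) : S m V (j + 1) g = 0 ↔ ∀ u ∈ SL2 m V (j + 1), inner ℂ u g = 0 := by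
      rw [SL2, S]
      erw [Submodule.range_starProjection]
      exact (Submodule.starProjection_apply_eq_zero_iff _).trans (Submodule.mem_orthogonal _ _)
    obtain ⟨r, hr, hT⟩ := exists_representedBy_A (m := m) hV (Nat.le_of_succ_le hj)
    rw [mem_SL2_succ_iff, hS]
    constructor
    · rintro ⟨h1, h2⟩
      rw [(hS φ).2 h1, hS0] at h2
      have h3 := (ih (by omega)).1 h1
      refine ⟨h3.1, ?_⟩
      by_cases hr0 : r = 0
      · intro a c i _
        refine integral_eq_zero_of_ae ?_
        filter_upwards [hr hr0] with y hy
        simp [hy]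
      · exact h3.2.succ_of_inner_eq_zero hV (by omega) hr0 hT (h2 φ h1)
    · rintro ⟨h1, h2⟩
      have h3 : φ ∈ SL2 m V (j + 1) := (ih (by omega)).2
        ⟨h1, fun a c i hac => h2 a c i (by omega)⟩
      refine ⟨h3, ?_⟩
      rw [(hS φ).2 h3, hS0]
      intro u hu
      exact inner_eq_zero_of_vanishingMoments hV (by omega) hT ((ih (by omega)).1 hu).2 h2

end

section

open scoped ENNReal Topology

variable {n m k q : ℕ} {V : Rn n → ℝ}

/-! ### Weighted `L²` spaces -/

theorem memWeightedL2_iff {s : ℝ} {f : Rn n → ℂ} (hf : AEStronglyMeasurable f volume) :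
    MemWeightedL2 s f ↔ MemLp (fun x => (1 + ‖x‖) ^ s * ‖f x‖) 2 volume := by
  have hc : Continuous fun x : Rn n => (1 + ‖x‖) ^ s :=
    (by fun_prop : Continuous fun x : Rn n => 1 + ‖x‖).rpow_const fun x => Or.inl (by positivity)
  rw [MemWeightedL2, ← memLp_norm_iff (f := fun x => (1 + ‖x‖) ^ s • f x)
    (hc.aestronglyMeasurable.smul hf)]
  refine memLp_congr_ae (.of_forall fun x => ?_)
  simp only
  rw [norm_smul, Real.norm_of_nonneg (by positivity)]

theorem MemWeightedL2.locallyIntegrable {s : ℝ} {f : Rn n → ℂ} (hf : MemWeightedL2 s f) :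
    LocallyIntegrable f volume := by
  have hc : Continuous fun x : Rn n => (1 + ‖x‖) ^ (-s) :=
    (by fun_prop : Continuous fun x : Rn n => 1 + ‖x‖).rpow_const fun x => Or.inl (by positivity)
  have h1 : LocallyIntegrable (fun x : Rn n => (1 + ‖x‖) ^ s • f x) volume :=
    MemLp.locallyIntegrable hf (by norm_num)
  rw [← locallyIntegrableOn_univ] at h1 ⊢
  have h2 := h1.continuousOn_smul isOpen_univ.isLocallyClosed hc.continuousOn
  refine h2.congr (.of_forall fun x => ?_)
  rw [smul_smul, ← Real.rpow_add (by positivity), neg_add_cancel, Real.rpow_zero, one_smul]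

theorem MemWeightedL2.mono {s s' : ℝ} (h : s' ≤ s) {f : Rn n → ℂ} (hf : MemWeightedL2 s f) :
    MemWeightedL2 s' f := by
  have hm := hf.locallyIntegrable.aestronglyMeasurable
  rw [memWeightedL2_iff hm] at hf ⊢
  have hc : Continuous fun x : Rn n => (1 + ‖x‖) ^ s' :=
    (by fun_prop : Continuous fun x : Rn n => 1 + ‖x‖).rpow_const fun x => Or.inl (by positivity)
  refine hf.mono' (hc.aestronglyMeasurable.mul hm.norm) (.of_forall fun x => ?_)
  rw [Real.norm_of_nonneg (by positivity)]
  gcongr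
  linarith [norm_nonneg x]

theorem memWeightedL2_zero_iff {f : Rn n → ℂ} : MemWeightedL2 0 f ↔ MemLp f 2 volume := by
  simp [MemWeightedL2]

/-! ### Riesz potentials as solutions of `(-Δ)^m u = f` -/

theorem aestronglyMeasurable_rieszPotential {f : Rn n → ℂ} (hf : AEStronglyMeasurable f volume) :
    AEStronglyMeasurable (rieszPotential q f) volume :=
  (aestronglyMeasurable_kernel_mul (K := fun x y => rieszKernel q (x - y))
    measurable_rieszKernel_sub.aestronglyMeasurable hf).integral_prod_right'

/-- The integrability that Fubini's theorem needs for pairing a Riesz potential with a test function. -/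
theorem integrable_rieszKernel_mul_mul (hm : 1 ≤ m) (hn : n = 2 * m + 2 * q) {f : Rn n → ℂ}
    (hf : Integrable f) {χ : Rn n → ℂ} (hχ : Continuous χ) (hχc : HasCompactSupport χ) :
    Integrable (fun p : Rn n × Rn n => (rieszKernel q (p.1 - p.2) : ℂ) * f p.2 * χ p.1)
      (volume.prod volume) := by
  obtain ⟨M, hM⟩ : ∃ M, ∀ x, (1 + ‖x‖) ^ (2 * m + 1) * ‖χ x‖ ≤ M := by
    have hc : Continuous fun x => ((1 + ‖x‖) ^ (2 * m + 1) : ℝ) • χ x := by fun_prop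
    obtain ⟨M, hM⟩ := hc.bounded_above_of_compact_support (HasCompactSupport.smul_left
      (f := fun x : Rn n => ((1 + ‖x‖) ^ (2 * m + 1) : ℝ)) hχc)
    refine ⟨M, fun x => ?_⟩
    have := hM x
    rwa [norm_smul, Real.norm_of_nonneg (by positivity)] at this
  have h1 : Integrable (fun p : Rn n × Rn n => ‖f p.2‖ * truncatedKernel m q (p.1 - p.2))
      (volume.prod volume) :=
    hf.norm.convolution_integrand (ContinuousLinearMap.mul ℝ ℝ) (integrable_truncatedKernel hm hn)
  have h2 : Integrable (fun p : Rn n × Rn n => ‖χ p.1‖ * ‖f p.2‖) (volume.prod volume) :=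
    (hχ.integrable_of_hasCompactSupport hχc).norm.mul_prod hf.norm
  refine ((h1.const_mul (2 ^ (2 * m + 1) * M)).add h2).mono'
    ((aestronglyMeasurable_kernel_mul (K := fun x y => rieszKernel q (x - y))
      measurable_rieszKernel_sub.aestronglyMeasurable hf.1).mul
      hχ.aestronglyMeasurable.comp_fst) (.of_forall fun p => ?_)
  obtain ⟨x, y⟩ := p
  have h3 := rieszKernel_le (m := m) (q := q) y x
  rw [← neg_sub, rieszKernel_neg, truncatedKernel, rieszKernel_neg, norm_neg,
    ← truncatedKernel] at h3
  have h4 := truncatedKernel_nonneg (m := m) (q := q) (x - y)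
  simp only [Pi.add_apply]
  rw [norm_mul, norm_mul, Complex.norm_real, Real.norm_of_nonneg (rieszKernel_nonneg _)]
  calc rieszKernel q (x - y) * ‖f y‖ * ‖χ x‖
      ≤ (2 ^ (2 * m + 1) * (truncatedKernel m q (x - y) * (1 + ‖x‖) ^ (2 * m + 1)) + 1)
          * ‖f y‖ * ‖χ x‖ := by gcongr
    _ = 2 ^ (2 * m + 1) * ((1 + ‖x‖) ^ (2 * m + 1) * ‖χ x‖) *
          (‖f y‖ * truncatedKernel m q (x - y)) + ‖χ x‖ * ‖f y‖ := by ring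
    _ ≤ 2 ^ (2 * m + 1) * M * (‖f y‖ * truncatedKernel m q (x - y)) + ‖χ x‖ * ‖f y‖ := by
        gcongr
        exact hM x

/-- The Riesz potential `d₀ |·|^{-2q} * f` solves `(-Δ)^m u = f` in the sense of distributions. -/
theorem integral_rieszPotential_mul (hm : 1 ≤ m) (hq : 1 ≤ q) (hn : n = 2 * m + 2 * q)
    {f : Rn n → ℂ} (hf : Integrable f) {χ : Rn n → ℂ} (hχ : ContDiff ℝ ∞ χ)
    (hχc : HasCompactSupport χ) :
    ∫ x, rieszConst n m * rieszPotential q f x * negLaplacianPow m χ x = ∫ x, f x * χ x := by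
  have hL := (contDiff_negLaplacianPow hχ m).continuous
  have hLc := hasCompactSupport_negLaplacianPow hχc m
  have hint := integrable_rieszKernel_mul_mul (q := q) hm hn hf hL hLc
  calc ∫ x, rieszConst n m * rieszPotential q f x * negLaplacianPow m χ x
      = rieszConst n m *
          ∫ x, ∫ y, (rieszKernel q (x - y) : ℂ) * f y * negLaplacianPow m χ x := by
        rw [← integral_const_mul]
        refine integral_congr_ae (.of_forall fun x => ?_)
        simp only
        rw [integral_mul_const, rieszPotential, mul_assoc]
    _ = rieszConst n m *
          ∫ y, ∫ x, (rieszKernel q (x - y) : ℂ) * f y * negLaplacianPow m χ x := by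
        rw [integral_integral_swap hint]
    _ = ∫ y, f y * χ y := by
        rw [← integral_const_mul]
        refine integral_congr_ae (.of_forall fun y => ?_)
        simp only
        rw [← rieszConst_mul_integral_negLaplacianPow hm hq hn hχ hχc y, mul_left_comm,
          ← integral_const_mul (f y)]
        congr 1
        refine integral_congr_ae (.of_forall fun x => ?_)
        simp only
        rw [← neg_sub, rieszKernel_neg]
        ring

/-- `|x|^{-2q-l}` lies in `L²_{-s}` at infinity if `s > m - q - l`. -/
theorem VanishingMoments.memWeightedL2_rieszPotential {f : Rn n → ℂ} {l : ℕ}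
    (hl : VanishingMoments l f) (hm : 1 ≤ m)
    (hn : n = 2 * m + 2 * q) (hfm : AEStronglyMeasurable f volume)
    (hf : Integrable (fun y => (1 + ‖y‖) ^ (2 * l) * ‖f y‖))
    (hf2 : MemLp (fun y => (1 + ‖y‖) ^ (2 * m + 1) * ‖f y‖) 2 volume) {s : ℝ} (hs : 0 ≤ s)
    (hls : (m : ℝ) - q - l < s) : MemWeightedL2 (-s) (rieszPotential q f) := by
  obtain ⟨F, C, hF, hb⟩ := hl.rieszPotential_bound hm hn hfm hf hf2
  have hrm := aestronglyMeasurable_rieszPotential (q := q) hfm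
  rw [memWeightedL2_iff hrm]
  have hc : Continuous fun x : Rn n => (1 + ‖x‖) ^ (-s) :=
    (by fun_prop : Continuous fun x : Rn n => 1 + ‖x‖).rpow_const fun x => Or.inl (by positivity)
  have hn' : (n : ℝ) = 2 * m + 2 * q := by exact_mod_cast hn
  have hw : (n : ℝ) < 2 * (s + (2 * q + l : ℕ)) := by push_cast; linarith
  refine (hF.norm.add ((memLp_two_one_add_norm_rpow hw).const_mul |C|)).mono'
    (hc.aestronglyMeasurable.mul hrm.norm) ?_
  filter_upwards [hb] with x hx
  have h1 : (1 + ‖x‖) ^ (-s) ≤ 1 :=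
    Real.rpow_le_one_of_one_le_of_nonpos (by linarith [norm_nonneg x]) (by linarith)
  simp only [Pi.add_apply]
  rw [Real.norm_of_nonneg (by positivity), neg_add, Real.rpow_add (by positivity),
    Real.rpow_neg (y := ((2 * q + l : ℕ) : ℝ)) (by positivity), Real.rpow_natCast]
  calc (1 + ‖x‖) ^ (-s) * ‖rieszPotential q f x‖
      ≤ (1 + ‖x‖) ^ (-s) * (‖F x‖ + |C| * ((1 + ‖x‖) ^ (2 * q + l))⁻¹) := by
        gcongr
        refine hx.2.trans ?_
        gcongr
        · exact Real.le_norm_self _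
        · exact le_abs_self C
    _ = (1 + ‖x‖) ^ (-s) * ‖F x‖ +
          |C| * ((1 + ‖x‖) ^ (-s) * ((1 + ‖x‖) ^ (2 * q + l))⁻¹) := by ring
    _ ≤ _ := by
        gcongr
        exact mul_le_of_le_one_left (norm_nonneg _) h1

/-! ### Elements of `S_j L²` and distributional solutions -/

/-- The equation `T₀ φ = 0` says that `Uφ = vψ` with `ψ = -G₀ v φ`. -/
theorem T0_eq_zero_iff (hV : HasDecay m k V) (hm : 1 ≤ m) (hn : n = 2 * m + 2 * q) {φ : L2 n} :
    T0 m V φ = 0 ↔ φ =ᵐ[volume] fun x => (uSign V x : ℂ) * (vPot V x : ℂ) *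
      -(rieszConst n m * rieszPotential q (fun y => (vPot V y : ℂ) * φ y) x) := by
  have h1 : T0 m V φ =ᵐ[volume] fun x => (uSign V x : ℂ) * φ x + (vPot V x : ℂ) *
      (rieszConst n m * rieszPotential q (fun y => (vPot V y : ℂ) * φ y) x) := by
    filter_upwards [hV.representedBy_T0 hm hn φ] with x hx
    rw [hx.2, rieszPotential, ← integral_const_mul, ← integral_const_mul]
    congr 2
    ext y
    rw [vGv, G_zero_eq hn]
    push_cast; ring
  have hU (x : Rn n) : (uSign V x : ℂ) * (uSign V x : ℂ) = 1 := by
    rw [← Complex.ofReal_mul, uSign_mul_self, Complex.ofReal_one]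
  rw [Lp.eq_zero_iff_ae_eq_zero]
  constructor
  · intro h
    filter_upwards [h, h1] with x hx hx1
    rw [hx, Pi.zero_apply] at hx1
    linear_combination (-(uSign V x : ℂ)) * hx1 - φ x * hU x
  · intro h
    filter_upwards [h, h1] with x hx hx1
    rw [hx1, Pi.zero_apply]
    nth_rw 1 [hx]
    linear_combination (-((vPot V x : ℂ) *
      (rieszConst n m * rieszPotential q (fun y => (vPot V y : ℂ) * φ y) x))) * hU x

theorem vPot_mul_eq {φ ψ : Rn n → ℂ}
    (h : φ =ᵐ[volume] fun x => (uSign V x : ℂ) * (vPot V x : ℂ) * ψ x) :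
    (fun x => (vPot V x : ℂ) * φ x) =ᵐ[volume] fun x => (V x : ℂ) * ψ x := by
  filter_upwards [h] with x hx
  have h1 : V x = uSign V x * vPot V x ^ 2 := by rw [sq_vPot, uSign_mul_abs]
  rw [hx, h1]
  push_cast; ring

theorem HasDecay.integrable_vPot_mul (hV : HasDecay m k V) {φ : Rn n → ℂ} (hφ : MemLp φ 2 volume) :
    Integrable (fun y => (vPot V y : ℂ) * φ y) := by
  refine (hV.integrable_weight hφ).mono' (hV.aestronglyMeasurable_vPot_mul hφ.1)
    (.of_forall fun y => ?_)
  exact le_mul_of_one_le_left (norm_nonneg _) (one_le_pow₀ (by linarith [norm_nonneg y]))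

/-- The pairing of a solution with test functions, the potential term being isolated. -/
theorem integral_mul_negLaplacianPow_add {ψ f χ : Rn n → ℂ} (hψ : LocallyIntegrable ψ volume)
    (hf : Integrable f) (hfψ : f =ᵐ[volume] fun x => (V x : ℂ) * ψ x) (hχ : ContDiff ℝ ∞ χ)
    (hχc : HasCompactSupport χ) :
    ∫ x, ψ x * (negLaplacianPow m χ x + (V x : ℂ) * χ x)
      = (∫ x, ψ x * negLaplacianPow m χ x) + ∫ x, f x * χ x := by
  have h1 : Integrable (fun x => ψ x * negLaplacianPow m χ x) := by
    simpa using hψ.integrable_smul_right_of_hasCompactSupport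
      (contDiff_negLaplacianPow hχ m).continuous (hasCompactSupport_negLaplacianPow hχc m)
  have h2 : Integrable (fun x => f x * χ x) := by
    simpa using hf.locallyIntegrable.integrable_smul_right_of_hasCompactSupport hχ.continuous hχc
  rw [← integral_add h1 h2]
  refine integral_congr_ae ?_
  filter_upwards [hfψ] with x hx
  rw [hx]; ring

/-- For `φ ∈ S_{l+1} L²`, the function `ψ = -G₀ v φ` is the desired solution. -/
theorem exists_solution_of_mem_SL2 (hV : HasDecay m k V) (hm : 1 ≤ m) (hq : 1 ≤ q)
    (hn : n = 2 * m + 2 * q) {l : ℕ} (hl : l ≤ k) {φ : L2 n} (hφ : φ ∈ SL2 m V (l + 1)) :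
    ∃ ψ : Rn n → ℂ, (∀ s : ℝ, 0 ≤ s → (m : ℝ) - q - l < s → MemWeightedL2 (-s) ψ) ∧
      IsDistribSolution m V ψ ∧
      φ =ᵐ[volume] fun x => (uSign V x : ℂ) * (vPot V x : ℂ) * ψ x := by
  obtain ⟨hT, hmom⟩ := (mem_SL2_iff hV hl).1 hφ
  rw [T0_eq_zero_iff hV hm hn] at hT
  set f : Rn n → ℂ := fun y => (vPot V y : ℂ) * φ y with hf
  have hfi : Integrable f := hV.integrable_vPot_mul (Lp.memLp φ)
  have hfw : Integrable (fun y => (1 + ‖y‖) ^ (2 * l) * ‖f y‖) := by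
    refine (hV.integrable_weight (Lp.memLp φ)).mono'
      ((by fun_prop : Continuous fun y : Rn n => (1 + ‖y‖) ^ (2 * l)).aestronglyMeasurable.mul
        hfi.1.norm) (.of_forall fun y => ?_)
    rw [Real.norm_of_nonneg (by positivity)]
    gcongr
    linarith [norm_nonneg y]
  have hw (s : ℝ) (hs : 0 ≤ s) (hls : (m : ℝ) - q - l < s) : MemWeightedL2 (-s)
      fun x => -(rieszConst n m * rieszPotential q f x : ℂ) := by
    have := (hmom.memWeightedL2_rieszPotential hm hn hfi.1 hfw (hV.memLp_weight (Lp.memLp φ)) hs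
      hls).const_smul (-(rieszConst n m : ℂ))
    refine (memLp_congr_ae (.of_forall fun x => ?_)).1 this
    simp only [Pi.smul_apply, smul_eq_mul, Complex.real_smul]
    ring
  refine ⟨_, hw, ⟨(hw (|(m : ℝ) - q - l| + 1) (by positivity) ?_).locallyIntegrable,
    fun χ hχ hχc => ?_⟩, hT⟩
  · linarith [le_abs_self ((m : ℝ) - q - l)]
  · rw [integral_mul_negLaplacianPow_add (hw (|(m : ℝ) - q - l| + 1) (by positivity)
      (by linarith [le_abs_self ((m : ℝ) - q - l)])).locallyIntegrable hfi (vPot_mul_eq hT) hχ hχc,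
      ← integral_rieszPotential_mul hm hq hn hfi hχ hχc]
    simp only [neg_mul, integral_neg, neg_add_cancel]

/-- A solution `ψ` in `L²_{-s}` with `s < n/2` satisfies `ψ = -G₀ V ψ` by the Liouville theorem, and thus
`φ = Uvψ` lies in `ker T₀`; the moments of `vφ = Vψ` vanish by the decay of `ψ`. -/
theorem mem_SL2_of_solution (hV : HasDecay m k V) (hm : 1 ≤ m) (hq : 1 ≤ q)
    (hn : n = 2 * m + 2 * q) {l : ℕ} (hl : l ≤ k) (hlm : l + q ≤ m + 1)
    {ψ : Rn n → ℂ} (hψ : IsDistribSolution m V ψ)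
    {s : ℝ} (hs0 : 0 ≤ s) (hs : (m : ℝ) - q < s) (hsn : 2 * s < n) (hψs : MemWeightedL2 (-s) ψ)
    (hψl : ∀ d < l, MemWeightedL2 (-((m : ℝ) - q - d)) ψ) {φ : L2 n}
    (hφ : φ =ᵐ[volume] fun x => (uSign V x : ℂ) * (vPot V x : ℂ) * ψ x) :
    φ ∈ SL2 m V (l + 1) ∧ (φ = 0 → ψ =ᵐ[volume] 0) := by
  set f : Rn n → ℂ := fun y => (vPot V y : ℂ) * φ y with hf
  have hfi : Integrable f := hV.integrable_vPot_mul (Lp.memLp φ)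
  have hfψ : f =ᵐ[volume] fun x => (V x : ℂ) * ψ x := vPot_mul_eq hφ
  set p : Rn n → ℂ := fun x => rieszConst n m * rieszPotential q f x with hp
  have hps : MemWeightedL2 (-s) p := by
    have hmom : VanishingMoments 0 f := fun a c i h => absurd h (by omega)
    have := (hmom.memWeightedL2_rieszPotential hm hn hfi.1 (by simpa using hfi.norm)
      (hV.memLp_weight (Lp.memLp φ)) hs0 (by simpa using hs)).const_smul (rieszConst n m : ℂ)
    refine (memLp_congr_ae (.of_forall fun x => ?_)).1 this
    simp only [hp, Pi.smul_apply, smul_eq_mul, Complex.real_smul]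
    ring
  have hsol : ψ =ᵐ[volume] fun x => -p x := by
    have hsum : MemWeightedL2 (-s) (fun x => ψ x + p x) := by
      refine (memLp_congr_ae (.of_forall fun x => ?_)).1 (hψs.add hps)
      simp only [Pi.add_apply, smul_add]
    have h0 := ae_eq_zero_of_polyharmonic hm hq hn hsum.locallyIntegrable hsn hsum
      fun χ hχ hχc => by
        have hi {u : Rn n → ℂ} (hu : LocallyIntegrable u) :
            Integrable (fun x => u x * negLaplacianPow m χ x) := by
          simpa using hu.integrable_smul_right_of_hasCompactSupport
            (contDiff_negLaplacianPow hχ m).continuous (hasCompactSupport_negLaplacianPow hχc m)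
        have h1 := hψ.2 χ hχ hχc
        rw [integral_mul_negLaplacianPow_add hψ.1 hfi hfψ hχ hχc,
          ← integral_rieszPotential_mul hm hq hn hfi hχ hχc,
          ← integral_add (hi hψ.1) (hi hps.locallyIntegrable)] at h1
        simpa only [add_mul] using h1
    filter_upwards [h0] with x hx
    exact eq_neg_of_add_eq_zero_left hx
  refine ⟨(mem_SL2_iff hV hl).2 ⟨(T0_eq_zero_iff hV hm hn).2 ?_, fun a c i hac => ?_⟩, fun h => ?_⟩
  · filter_upwards [hφ, hsol] with x hx hx1
    rw [hx, hx1]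
  · have hint : Integrable (fun x => (monomialFn a i x : ℂ) * f x) :=
      integrable_monomialFn_mul hfi.1 (hV.integrable_weight (Lp.memLp φ)) i (by omega)
    have heq : (fun x => (monomialFn a i x : ℂ) * f x) =ᵐ[volume]
        fun x => (monomialFn a i x : ℂ) * ((V x : ℂ) * ψ x) := by
      filter_upwards [hfψ] with x hx
      rw [hx]
    have hd : ((2 * a + c : ℕ) : ℝ) + q ≤ m := by
      have : 2 * a + c + q ≤ m := by omega
      exact_mod_cast this
    rw [integral_congr_ae heq]
    exact integral_monomialFn_mul_eq_zero hm hq hn hψ (by linarith) (hψl _ hac) i (by linarith)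
      (hint.congr heq)
  · have hf0 : f =ᵐ[volume] 0 := by
      filter_upwards [(Lp.eq_zero_iff_ae_eq_zero).1 h] with x hx
      simp [hf, hx]
    filter_upwards [hsol] with x hx
    have : rieszPotential q f x = 0 := by
      refine integral_eq_zero_of_ae ?_
      filter_upwards [hf0] with y hy
      simp [hy]
    simp [hx, hp, this]

end

section

variable {n m k : ℕ} {V : Rn n → ℝ}

/-! ### The characterisation of the spaces `S_j L²` -/

/-- The characterisation of `S_{l+1} L²` by solutions in a class `X`, for any class `X` that contains
the functions that decay like `|x|^{-2q-l}` up to `L²`, where `n = 2m + 2q`, and that has enough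
decay to give the moment conditions. -/
theorem mem_SL2_ne_zero_iff (hm : 1 ≤ m) (hk : 1 ≤ k) (hkm : k ≤ m) (hn : n + 2 * k = 4 * m + 2)
    (hV : HasDecay m k V) {l : ℕ} (hl : l ≤ k) {X : (Rn n → ℂ) → Prop}
    (hX : ∀ ψ, X ψ → MemWeightedL2 (-((k : ℝ) - 1 / 2)) ψ ∧
      ∀ d < l, MemWeightedL2 (-((k : ℝ) - 1 - d)) ψ)
    (hX' : ∀ ψ, (∀ s : ℝ, 0 ≤ s → (k : ℝ) - 1 - l < s → MemWeightedL2 (-s) ψ) → X ψ)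
    (φ : L2 n) : (φ ∈ SL2 m V (l + 1) ∧ φ ≠ 0) ↔ ComesFromSolutionIn m V X φ := by
  obtain ⟨q, hq⟩ : ∃ q, q + k = m + 1 := ⟨m + 1 - k, by omega⟩
  have hmq : (m : ℝ) - q = k - 1 := by
    have : (q : ℝ) + k = m + 1 := by exact_mod_cast hq
    linarith
  have hn' : n = 2 * m + 2 * q := by omega
  have hq1 : 1 ≤ q := by omega
  constructor
  · rintro ⟨hφ, hφ0⟩
    obtain ⟨ψ, hψw, hψ, hφψ⟩ := exists_solution_of_mem_SL2 hV hm hq1 hn' hl hφ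
    rw [hmq] at hψw
    refine ⟨ψ, hX' ψ hψw, fun h => hφ0 ?_, hψ, hφψ⟩
    rw [Lp.eq_zero_iff_ae_eq_zero]
    filter_upwards [hφψ, h] with x hx hx0
    simp [hx, hx0]
  · rintro ⟨ψ, hψX, hψ0, hψ, hφψ⟩
    obtain ⟨h1, h2⟩ := hX ψ hψX
    have hk1 : (1 : ℝ) ≤ k := by exact_mod_cast hk
    have hkn : 2 * (k : ℝ) ≤ n := by exact_mod_cast (by omega : 2 * k ≤ n)
    -- the weight `k - 1/2` lies in the window `k - 1 < s < n/2` of the Liouville theorem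
    obtain ⟨h3, h4⟩ := mem_SL2_of_solution (q := q) hV hm hq1 hn' hl (by omega) hψ
      (s := (k : ℝ) - 1 / 2) (by linarith) (by rw [hmq]; linarith) (by linarith) h1
      (by simpa only [hmq] using h2) hφψ
    exact ⟨h3, fun h => hψ0 (h4 h)⟩

/-- For `j ≤ k`, the space `S_j L²` corresponds to the solutions in `W_{k-j}`. -/
theorem mem_SL2_ne_zero_iff_memW (hm : 1 ≤ m) (hkm : k ≤ m) (hn : n + 2 * k = 4 * m + 2)
    (hV : HasDecay m k V) {j : ℕ} (hj : 1 ≤ j) (hjk : j ≤ k) {σ : ℝ} (hσ : σ = k - j)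
    (φ : L2 n) : (φ ∈ SL2 m V j ∧ φ ≠ 0) ↔ ComesFromSolutionIn m V (MemW σ) φ := by
  obtain ⟨l, rfl⟩ : ∃ l, j = l + 1 := ⟨j - 1, by omega⟩
  have hlk : (l : ℝ) + 1 ≤ k := by exact_mod_cast hjk
  have hl0 : (0 : ℝ) ≤ l := by positivity
  push_cast at hσ
  refine mem_SL2_ne_zero_iff hm (by omega) hkm hn hV (by omega)
    (fun ψ hψ => ⟨hψ _ (by linarith), fun d hd => hψ _ ?_⟩)
    (fun ψ hψ s hs => hψ s (by linarith) (by linarith)) φ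
  have : (d : ℝ) + 1 ≤ l := by exact_mod_cast hd
  linarith

end

end PolyharmonicSchrodinger

open PolyharmonicSchrodinger in
theorem proposition2p6 (m k n : ℕ) (hm : 1 ≤ m) (hk : 1 ≤ k) (hkm : k ≤ m / 2 + 1)
    (hn : n + 2 * k = 4 * m + 2) (V : Rn n → ℝ) (hV : AEStronglyMeasurable V volume)
    (β C : ℝ) (hβ : (n : ℝ) + 4 * k < β)
    (hdecay : ∀ᵐ x : Rn n, |V x| ≤ C * (1 + ‖x‖) ^ (-β)) :
    -- the operators that define the spaces `S_j L²` are bounded operators on `L²`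
    (RepresentedBy (uSign V) (vGv m V 0) (T0 m V) ∧
      RepresentedBy 0 (fun x y => vPot V x * vPot V y / ∫ z, vPot V z ^ 2) (P V) ∧
      ∀ j : ℕ, 2 ≤ j → j ≤ k → RepresentedBy 0 (vGv m V j) (A m V j)) ∧
    -- (i)
    (∀ φ : L2 n, (φ ∈ SL2 m V 1 ∧ φ ≠ 0) ↔
      ComesFromSolutionIn m V (MemW (2 * (m : ℝ) - (n : ℝ) / 2)) φ) ∧
    -- (ii)
    (∀ j : ℕ, 2 ≤ j → j + 1 ≤ k → ∀ φ : L2 n, (φ ∈ SL2 m V j ∧ φ ≠ 0) ↔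
      ComesFromSolutionIn m V (MemW (2 * (m : ℝ) - (n : ℝ) / 2 - j + 1)) φ) ∧
    -- (iii)
    (∀ φ : L2 n, (φ ∈ SL2 m V k ∧ φ ≠ 0) ↔ ComesFromSolutionIn m V (MemW 0) φ) ∧
    -- (iv)
    (∀ φ : L2 n, (φ ∈ SL2 m V (k + 1) ∧ φ ≠ 0) ↔
      ComesFromSolutionIn m V (fun ψ => MemLp ψ 2 volume) φ) := by
  have hVd : HasDecay m k V := hasDecay_of_le hn hV hβ hdecay
  have hkm' : k ≤ m := by omega
  have hnr : (n : ℝ) + 2 * k = 4 * m + 2 := by exact_mod_cast hn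
  refine ⟨⟨hVd.representedBy_T0 (q := m + 1 - k) hm (by omega), representedBy_P hVd,
    fun j hj2 hjk => ?_⟩, mem_SL2_ne_zero_iff_memW hm hkm' hn hVd le_rfl hk ?_,
    fun j hj2 hjk => mem_SL2_ne_zero_iff_memW hm hkm' hn hVd (by omega) (by omega) ?_,
    mem_SL2_ne_zero_iff_memW hm hkm' hn hVd hk le_rfl (by ring),
    mem_SL2_ne_zero_iff hm hk hkm' hn hVd le_rfl (fun ψ hψ => ?_) (fun ψ hψ => ?_)⟩
  · obtain ⟨j, rfl⟩ := Nat.exists_eq_add_of_le' hj2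
    exact representedBy_A hVd (by omega)
  · push_cast
    linarith
  · linarith
  · have hk1 : (1 : ℝ) ≤ k := by exact_mod_cast hk
    rw [← memWeightedL2_zero_iff] at hψ
    refine ⟨hψ.mono (by linarith), fun d hd => hψ.mono ?_⟩
    have : (d : ℝ) + 1 ≤ k := by exact_mod_cast hd
    linarith
  · have h := hψ 0 le_rfl (by linarith)
    rwa [neg_zero, memWeightedL2_zero_iff] at h
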